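/- All graphs are finite and simple, and have at least one vertex; $\mathbb N=\{1,2,\dots\}$. Write $\deg_G(v,U)$ for the number of neighbours of $v$ in $U$. **LKS classes.** For a graph $G$ on $n$ vertices let $\mathbb L_{\eta,k}(G)$ be the set of vertices of degree at least $(1+\eta)k$ and $\mathbb S_{\eta,k}(G)=V(G)\setminus\mathbb L_{\eta,k}(G)$. $G\in\mathbf{LKS}(n,k,\eta)$ means $|\mathbb L_{\eta,k}(G)|\ge(\frac12+\eta)n$. $G\in\mathbf{LKSsmall}(n,k,\eta)$ means that $G\in\mathbf{LKS}(n,k,\eta)$, all neighbours of any vertex of degree $>\lceil(1+2\eta)k\rceil$ have degree at most $\lceil(1+2\eta)k\rceil$, all neighbours of any vertex of $\mathbb S_{\eta,k}(G)$ have degree exactly $\lceil(1+\eta)k\rceil$, and $e(G)\le kn$. **Dense spots.** An $(m,\gamma)$-dense spot in $G$ is a non-empty bipartite subgraph $D=(U,W;F)$ of $G$ with $|F|/(|U||W|)>\gamma$ and minimum degree $>m$. $G$ is $(m,\gamma)$-nowhere-dense if it contains none. For a family $\mathcal D$ of dense spots in $G$, a set $\mathfrak A\subset\bigcup_{D\in\mathcal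 D}V(D)$ is $(\Lambda,\varepsilon,\gamma,k)$-avoiding with respect to $\mathcal D$ if for every $\bar U\subset V(G)$ with $|\bar U|\le\Lambda k$, all but at most $\varepsilon k$ vertices $v\in\mathfrak A$ lie in some $D\in\mathcal D$ with $|\bar U\cap V(D)|\le\gamma^2k$. **Bounded decomposition.** Let $\mathcal V$ be a partition of $V(G)$ (empty parts allowed). $(\mathbf V,\mathcal D,G_{reg},G_{exp},\mathfrak A)$ is a $(k,\Lambda,\gamma,\varepsilon,\nu,\rho)$-bounded decomposition of $G$ with respect to $\mathcal V$ if: 1. $\mathbf V$ is a family of disjoint subsets of $V(G)$ (clusters); 2. $G_{reg}$ is a subgraph of $G-G_{exp}$ (edge deletion) with vertex set $\bigcup\mathbf V$; each edge $xy$ of $G_{reg}$ has distinct clusters $C_x\ni x$, $C_y\ni y$ with $G[C_x,C_y]=G_{reg}[C_x,C_y]$, and this pair is $\varepsilon$-regular of density at least $\gamma^2$; 3. $\nu k\le|C|=|C'|\le\varepsilon k$ for all $C,C'\in\mathbf V$; 4. $\mathcal D$ is a family of edge-disjoint $(\gamma k,\gamma)$-dense spots in $G-G_{exp}$, and for each $(U,W;F)\in\mathcal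 D$ all edges of $G[U,W]$ belong to members of $\mathcal D$; 5. if $G_{reg}$ has an edge between $C_1,C_2\in\mathbf V$, then some $(U,W;F)\in\mathcal D$ has $C_1\subset U$, $C_2\subset W$ (up to swapping $U$ and $W$); 6. for each $C\in\mathbf V$ some $X\in\mathcal V$ satisfies $C\subset X\cap V(G_{exp})$ or $C\subset X\setminus V(G_{exp})$; and $C\cap U,\,C\cap W\in\{\emptyset,C\}$ for each $C\in\mathbf V$ and $(U,W;F)\in\mathcal D$; 7. $G_{exp}$ is a $(\gamma k,\gamma)$-nowhere-dense subgraph of $G$ in which each vertex has degree $>\rho k$; 8. $\mathfrak A\subset V(G)\setminus\bigcup\mathbf V$ is $(\Lambda,\varepsilon,\gamma,k)$-avoiding with respect to $\mathcal D$. It respects the avoiding threshold $b$ if for each $C\in\mathbf V$ either $\deg_G(v,\mathfrak A)\le b$ for all $v\in C$, or $\deg_G(v,\mathfrak A)>b$ for all $v\in C$. **Sparse decomposition.** $(\Psi,\mathbf V,\mathcal D,G_{reg},G_{exp},\mathfrak A)$ is a $(k,\Omega^{**},\Omega^*,\Lambda,\gamma,\varepsilon,\nu,\rho)$-sparse decomposition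 of $G$ with respect to $\mathcal V$ if $\Psi\subset V(G)$, every $v\in\Psi$ has $\deg_G(v)\ge\Omega^{**}k$, every $v\notin\Psi$ has degree at most $\Omega^*k$ in the graph formed by the edges of $\mathcal D$, the edges of $G_{exp}$ and the edges of $G$ incident with $\Psi$, and $(\mathbf V,\mathcal D,G_{reg},G_{exp},\mathfrak A)$ is a $(k,\Lambda,\gamma,\varepsilon,\nu,\rho)$-bounded decomposition of $G-\Psi$ with respect to $\{X\setminus\Psi:X\in\mathcal V\}$. It respects the threshold $b$ if this bounded decomposition does. It captures the edges of $G_{reg}$ and $G_{exp}$, the edges of $G$ incident with $\Psi$, and the edges of $G$ between $\mathfrak A$ and $\mathfrak A\cup\bigcup\mathbf V$. **Lemma.** For all $\eta,\Lambda,\gamma,\varepsilon,\rho>0$ there are $\nu>0$ and $k_0\in\mathbb N$ such that for every integer $k>k_0$ and every real $b$ the following holds. For every sequence $(\Omega_j)_{j\in\mathbb N}$ of positive numbers with $\Omega_j/\Omega_{j+1}\le\eta^2/100$ for all $j$, and every $G\in\mathbf{LKS}(n,k,\eta)$, there are an index $i\in\mathbb N$ and a subgraph $G'$ of $G$ such that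 (a) $G'\in\mathbf{LKSsmall}(n,k,\eta/2)$; (b) $i\le100\eta^{-2}$; (c) $G'$ has a $(k,\Omega_{i+1},\Omega_i,\Lambda,\gamma,\varepsilon,\nu,\rho)$-sparse decomposition $(\Psi,\mathbf V,\mathcal D,G'_{reg},G'_{exp},\mathfrak A)$ with respect to $\{\mathbb S_{\eta/2,k}(G'),\mathbb L_{\eta/2,k}(G')\}$ that respects the avoiding threshold $b$; (d) this decomposition captures all but at most $\bigl(\frac{4\varepsilon}{\gamma}+\varepsilon\Omega_{\lfloor100\eta^{-2}\rfloor}+\gamma+\rho\bigr)kn$ edges of $G'$; (e) the number of edges of members of $\mathcal D$ that are neither in $G'_{reg}$ nor edges of $G'$ between $\mathfrak A$ and $\mathfrak A\cup\bigcup\mathbf V$ is at most $\bigl(\frac{4\varepsilon}{\gamma}+\varepsilon\Omega_{\lfloor100\eta^{-2}\rfloor}+\gamma\bigr)kn$. -/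

import Mathlib

universe u

namespace SparseDecomp

open scoped Classical in
/-- The vertices of degree at least `(1 + η) k`. -/
noncomputable def largeVertices {V : Type u} [Fintype V] (G : SimpleGraph V) (k : ℕ) (η : ℝ) :
    Finset V :=
  Finset.univ.filter fun v => (1 + η) * (k : ℝ) ≤ (G.degree v : ℝ)

open scoped Classical in
/-- The vertices of degree less than `(1 + η) k`. -/
noncomputable def smallVertices {V : Type u} [Fintype V] (G : SimpleGraph V) (k : ℕ) (η : ℝ) :
    Finset V :=
  Finset.univ.filter fun v => (G.degree v : ℝ) < (1 + η) * (k : ℝ)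

open scoped Classical in
/-- The number of edges of a graph. -/
noncomputable def numEdges {V : Type u} [Fintype V] (G : SimpleGraph V) : ℕ :=
  G.edgeFinset.card

open scoped Classical in
/-- The number of neighbours of `v` in the set `U`. -/
noncomputable def degInto {V : Type u} (G : SimpleGraph V) (v : V) (U : Finset V) : ℕ :=
  (U.filter fun u => G.Adj v u).card

/-- The class `LKS(n, k, η)`, where `n` is the number of vertices of `G`. -/
def IsLKS {V : Type u} [Fintype V] (G : SimpleGraph V) (k : ℕ) (η : ℝ) : Prop :=
  (1 / 2 + η) * (Fintype.card V : ℝ) ≤ ((largeVertices G k η).card : ℝ)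

open scoped Classical in
/-- The class of small LKS graphs with parameters `n`, `k`, `η`. -/
structure IsLKSSmall {V : Type u} [Fintype V] (G : SimpleGraph V) (k : ℕ) (η : ℝ) : Prop where
  isLKS : IsLKS G k η
  degree_le_of_adj : ∀ v w : V, G.Adj v w → ⌈(1 + 2 * η) * (k : ℝ)⌉₊ < G.degree v →
    G.degree w ≤ ⌈(1 + 2 * η) * (k : ℝ)⌉₊
  degree_eq_of_adj : ∀ v w : V, G.Adj v w → v ∈ smallVertices G k η →
    G.degree w = ⌈(1 + η) * (k : ℝ)⌉₊
  numEdges_le : numEdges G ≤ k * Fintype.card V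

/-- A bipartite graph `(U, W; F)` whose vertices lie in `V`. Its vertex set is `U ∪ W`. All
notions below are insensitive to swapping `U` and `W`. -/
structure BipGraph (V : Type u) where
  U : Finset V
  W : Finset V
  F : SimpleGraph V
  disj : Disjoint U W
  between : ∀ x y : V, F.Adj x y → (x ∈ U ∧ y ∈ W) ∨ (x ∈ W ∧ y ∈ U)

open scoped Classical in
/-- The vertex set of a bipartite graph. -/
noncomputable def BipGraph.verts {V : Type u} (D : BipGraph V) : Finset V := D.U ∪ D.W

open scoped Classical in
/-- `D` is an `(m, γ)`-dense spot in `G`. -/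
structure IsDenseSpot {V : Type u} [Fintype V] (G : SimpleGraph V) (m γ : ℝ) (D : BipGraph V) :
    Prop where
  le : D.F ≤ G
  nonempty : D.F ≠ ⊥
  density_gt : γ < (numEdges D.F : ℝ) / ((D.U.card : ℝ) * (D.W.card : ℝ))
  degree_gt : ∀ v ∈ D.verts, m < (D.F.degree v : ℝ)

/-- `G` is `(m, γ)`-nowhere-dense. -/
def IsNowhereDense {V : Type u} [Fintype V] (G : SimpleGraph V) (m γ : ℝ) : Prop :=
  ∀ D : BipGraph V, ¬ IsDenseSpot G m γ D

/-- The graph formed by all edges of the members of `𝒟`. -/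
def spotGraph {V : Type u} (𝒟 : Set (BipGraph V)) : SimpleGraph V where
  Adj x y := ∃ D ∈ 𝒟, D.F.Adj x y
  symm := ⟨fun _ _ ⟨D, hD, h⟩ => ⟨D, hD, h.symm⟩⟩
  loopless := ⟨fun x ⟨D, _, h⟩ => D.F.irrefl (v := x) h⟩

/-- The graph formed by the edges of `G` with one end in `X` and the other in `Y`
(the two sets need not be disjoint). -/
def edgesBetween {V : Type u} (G : SimpleGraph V) (X Y : Set V) : SimpleGraph V where
  Adj x y := G.Adj x y ∧ ((x ∈ X ∧ y ∈ Y) ∨ (x ∈ Y ∧ y ∈ X))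
  symm := ⟨fun _ _ ⟨h, h'⟩ => ⟨h.symm, h'.symm.imp And.symm And.symm⟩⟩
  loopless := ⟨fun x ⟨h, _⟩ => G.irrefl (v := x) h⟩

/-- The union `⋃ 𝒞` of the clusters. -/
def clusterUnion {V : Type u} (𝒞 : Finset (Finset V)) : Set V := {v | ∃ C ∈ 𝒞, v ∈ C}

/-- `𝒱` partitions the set `X`. As usual in this context, `𝒱` may have an empty member. -/
def IsPartitionOf {V : Type u} (𝒱 : Set (Set V)) (X : Set V) : Prop :=
  𝒱.PairwiseDisjoint id ∧ ⋃₀ 𝒱 = X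

open scoped Classical in
/-- `𝔄` is a `(Λ, ε, γ, k)`-avoiding set with respect to the family `𝒟` of dense spots in a graph
with vertex set `X`. -/
structure IsAvoiding {V : Type u} (X : Set V) (𝒟 : Set (BipGraph V)) (Λ ε γ : ℝ) (k : ℕ)
    (𝔄 : Finset V) : Prop where
  covered : ∀ v ∈ 𝔄, ∃ D ∈ 𝒟, v ∈ D.verts
  avoids : ∀ Ubar : Finset V, (Ubar : Set V) ⊆ X → (Ubar.card : ℝ) ≤ Λ * k →
    ((𝔄.filter fun v =>
      ¬ ∃ D ∈ 𝒟, v ∈ D.verts ∧ ((Ubar ∩ D.verts).card : ℝ) ≤ γ ^ 2 * k).card : ℝ) ≤ ε * k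

open scoped Classical in
/-- `(𝒞, 𝒟, Greg, Gexp, 𝔄)` is a `(k, Λ, γ, ε, ν, ρ)`-bounded decomposition of the graph `H` with
respect to the partition `𝒱` of its vertex set. The graph `H` is given as a subgraph, with its own
vertex set, of an ambient graph `G`. -/
structure IsBoundedDecomposition {V : Type u} [Fintype V] {G : SimpleGraph V} (H : G.Subgraph)
    (𝒱 : Set (Set V)) (k : ℕ) (Λ γ ε ν ρ : ℝ) (𝒞 : Finset (Finset V)) (𝒟 : Set (BipGraph V))
    (Greg Gexp : G.Subgraph) (𝔄 : Finset V) : Prop where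
  partition : IsPartitionOf 𝒱 H.verts
  cluster_subset : ∀ C ∈ 𝒞, (C : Set V) ⊆ H.verts
  cluster_disjoint : ∀ C ∈ 𝒞, ∀ C' ∈ 𝒞, C ≠ C' → Disjoint C C'
  reg_le : Greg ≤ H
  reg_not_exp : ∀ x y : V, Greg.Adj x y → ¬ Gexp.Adj x y
  reg_verts : Greg.verts = clusterUnion 𝒞
  reg_pair : ∀ x y : V, Greg.Adj x y → ∃ Cx ∈ 𝒞, ∃ Cy ∈ 𝒞, Cx ≠ Cy ∧ x ∈ Cx ∧ y ∈ Cy ∧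
    (∀ a ∈ Cx, ∀ b ∈ Cy, H.Adj a b ↔ Greg.Adj a b) ∧
    H.spanningCoe.IsUniform ε Cx Cy ∧ γ ^ 2 ≤ (H.spanningCoe.edgeDensity Cx Cy : ℝ)
  cluster_card : ∀ C ∈ 𝒞, ∀ C' ∈ 𝒞,
    ν * k ≤ (C.card : ℝ) ∧ C.card = C'.card ∧ (C'.card : ℝ) ≤ ε * k
  spot_dense : ∀ D ∈ 𝒟, IsDenseSpot (H.spanningCoe \ Gexp.spanningCoe) (γ * k) γ D
  spot_edge_disjoint : ∀ D ∈ 𝒟, ∀ D' ∈ 𝒟, D ≠ D' → ∀ x y : V, D.F.Adj x y → ¬ D'.F.Adj x y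
  spot_covered : ∀ D ∈ 𝒟, ∀ x ∈ D.U, ∀ y ∈ D.W, H.Adj x y → (spotGraph 𝒟).Adj x y
  reg_in_spot : ∀ C₁ ∈ 𝒞, ∀ C₂ ∈ 𝒞, (∃ x ∈ C₁, ∃ y ∈ C₂, Greg.Adj x y) →
    ∃ D ∈ 𝒟, (C₁ ⊆ D.U ∧ C₂ ⊆ D.W) ∨ (C₁ ⊆ D.W ∧ C₂ ⊆ D.U)
  cluster_prepartition : ∀ C ∈ 𝒞, ∃ X ∈ 𝒱,
    (C : Set V) ⊆ X ∩ Gexp.verts ∨ (C : Set V) ⊆ X \ Gexp.verts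
  cluster_spot : ∀ C ∈ 𝒞, ∀ D ∈ 𝒟,
    (Disjoint C D.U ∨ C ⊆ D.U) ∧ (Disjoint C D.W ∨ C ⊆ D.W)
  exp_le : Gexp ≤ H
  exp_nowhereDense : IsNowhereDense Gexp.spanningCoe (γ * k) γ
  exp_degree : ∀ v ∈ Gexp.verts, ρ * k < (Gexp.spanningCoe.degree v : ℝ)
  avoiding_subset : (𝔄 : Set V) ⊆ H.verts \ clusterUnion 𝒞
  avoiding : IsAvoiding H.verts 𝒟 Λ ε γ k 𝔄

/-- The family of clusters `𝒞` and the set `𝔄` respect the avoiding threshold `b` in the graph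
`G`. -/
def RespectsThreshold {V : Type u} (G : SimpleGraph V) (𝒞 : Finset (Finset V)) (𝔄 : Finset V)
    (b : ℝ) : Prop :=
  ∀ C ∈ 𝒞, (∀ v ∈ C, (degInto G v 𝔄 : ℝ) ≤ b) ∨ (∀ v ∈ C, b < (degInto G v 𝔄 : ℝ))

/-- The graph `G - Ψ`. -/
def removeVerts {V : Type u} (G : SimpleGraph V) (Ψ : Finset V) : G.Subgraph :=
  (⊤ : G.Subgraph).deleteVerts (Ψ : Set V)

open scoped Classical in
/-- `(Ψ, 𝒞, 𝒟, Greg, Gexp, 𝔄)` is a `(k, Ω₂, Ω₁, Λ, γ, ε, ν, ρ)`-sparse decomposition of `G` with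
respect to the partition `𝒱` of its vertex set. -/
structure IsSparseDecomposition {V : Type u} [Fintype V] (G : SimpleGraph V) (𝒱 : Set (Set V))
    (k : ℕ) (Ω₂ Ω₁ Λ γ ε ν ρ : ℝ) (Ψ : Finset V) (𝒞 : Finset (Finset V)) (𝒟 : Set (BipGraph V))
    (Greg Gexp : G.Subgraph) (𝔄 : Finset V) : Prop where
  partition : IsPartitionOf 𝒱 Set.univ
  huge_degree : ∀ v ∈ Ψ, Ω₂ * k ≤ (G.degree v : ℝ)
  moderate_degree : ∀ v ∉ Ψ,
    ((spotGraph 𝒟 ⊔ Gexp.spanningCoe ⊔ edgesBetween G Ψ Set.univ).degree v : ℝ) ≤ Ω₁ * k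
  bounded : IsBoundedDecomposition (removeVerts G Ψ) ((fun X => X \ (Ψ : Set V)) '' 𝒱)
    k Λ γ ε ν ρ 𝒞 𝒟 Greg Gexp 𝔄

/-- The graph formed by the edges of `G` captured by a sparse decomposition. -/
def capturedGraph {V : Type u} (G : SimpleGraph V) (Ψ : Finset V) (𝒞 : Finset (Finset V))
    (Greg Gexp : G.Subgraph) (𝔄 : Finset V) : SimpleGraph V :=
  Greg.spanningCoe ⊔ Gexp.spanningCoe ⊔ edgesBetween G Ψ Set.univ ⊔
    edgesBetween G 𝔄 ((𝔄 : Set V) ∪ clusterUnion 𝒞)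

end SparseDecomp

/-!
The proof has two independent halves.

*A gap in the degree sequence.* By `exists_degree_gap`, some subgraph `G'` in the class of small LKS
graphs has no degrees strictly between `Ω i k` and `Ω (i + 1) k`, for some `i ≤ 100 / η²`. If the scales
from the tenth on are at least `2`, averaging over the scales gives one where the degrees in the
window have a negligible sum, and the edges at these vertices can be removed
(`exists_gap_of_two_le`). The difficulty is that this removal lowers the other degrees; it is overcome
by minimising a potential (`exists_separation`), which discards further vertices until every remaining
one loses a small part of its degree. Otherwise the second scale is tiny, and it suffices to avoid
small nonzero degrees. Then the vertices of large degree are given their degrees inside a well chosen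
set as far as possible and are filled up by edges to the outside, spread by Hall's theorem so that an
outside vertex receives either many edges or none (`exists_small_of_tiny`). Minimality of the graphs
under edge deletion yields the exact degrees and the bound `k n` on the number of edges.

*The decomposition.* If `ε Ω i > 1`, the admissible errors exceed the number of edges, and the empty
decomposition serves. Otherwise let `Ψ` be the vertices of degree at least `Ω (i + 1) k`. The other
degrees are at most `Ω i k ≤ k / ε`. A maximal edge-disjoint family of dense spots in `G' - Ψ` leaves a
nowhere-dense graph (`exists_dense_spots`), whose `ρ k`-core is `G'_exp` (`exists_core`). A vertex lies
in boundedly many spots. Call two vertices of spots of the same type if they lie on the same sides of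
the same spots and carry the same labels. The vertices of rare type form the avoiding set `𝔄`: a set
of size `Λ k` meets boundedly many spots heavily, so that the exceptional vertices have
boundedly many types (`rareVertices_isAvoiding`). The vertices of the other types are cut into cells
of equal size. A cell is linked by spots to boundedly many cells, and hence a regularity lemma for
patterns of bounded degree applies (`exists_regular_packing`, by energy increment), with a bound that
does not depend on the number of vertices. The pieces are the clusters. The edges of spots that
are not captured lie in irregular pairs, in pairs of density below `γ²`, which are few since spots have
density at least `γ`, or at the few vertices left over (`exists_clusters`).
-/

namespace SparseDecomp

open scoped Classical

/-! ### Degrees and edge counts -/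

section Basic

variable {V : Type u} {G H : SimpleGraph V}

theorem degInto_mono_set {v : V} {A B : Finset V} (h : A ⊆ B) :
    degInto G v A ≤ degInto G v B :=
  Finset.card_le_card (Finset.filter_subset_filter _ h)

theorem degInto_mono_graph (h : H ≤ G) (v : V) (A : Finset V) :
    degInto H v A ≤ degInto G v A :=
  Finset.card_le_card fun x hx => by
    rw [Finset.mem_filter] at hx ⊢
    exact ⟨hx.1, h hx.2⟩

theorem degInto_le_card (v : V) (A : Finset V) : degInto G v A ≤ A.card :=
  Finset.card_filter_le _ _

theorem degInto_union_le (v : V) (A B : Finset V) :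
    degInto G v (A ∪ B) ≤ degInto G v A + degInto G v B := by
  unfold degInto
  rw [Finset.filter_union]
  exact Finset.card_union_le _ _

theorem degInto_union_of_disjoint (v : V) {A B : Finset V} (h : Disjoint A B) :
    degInto G v (A ∪ B) = degInto G v A + degInto G v B := by
  unfold degInto
  rw [Finset.filter_union]
  exact Finset.card_union_of_disjoint (Finset.disjoint_filter_filter h)

theorem degInto_sdiff_add (v : V) {A B : Finset V} (h : A ⊆ B) :
    degInto G v (B \ A) + degInto G v A = degInto G v B := by
  rw [← degInto_union_of_disjoint v Finset.sdiff_disjoint, Finset.sdiff_union_of_subset h]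

theorem degInto_eq_sum (v : V) (A : Finset V) :
    degInto G v A = ∑ u ∈ A, if G.Adj v u then 1 else 0 := by
  unfold degInto
  rw [Finset.card_filter]

theorem sum_degInto_comm (A B : Finset V) :
    ∑ a ∈ A, degInto G a B = ∑ b ∈ B, degInto G b A := by
  simp only [degInto_eq_sum]
  rw [Finset.sum_comm]
  simp only [G.adj_comm]

theorem degInto_congr {v : V} {A : Finset V} (h : ∀ u ∈ A, (G.Adj v u ↔ H.Adj v u)) :
    degInto G v A = degInto H v A := by
  unfold degInto
  congr 1
  exact Finset.filter_congr h

variable [Fintype V]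

theorem degree_eq_degInto (v : V) [Fintype (G.neighborSet v)] :
    G.degree v = degInto G v Finset.univ := by
  unfold degInto
  rw [← SimpleGraph.card_neighborFinset_eq_degree]
  congr 1
  ext x
  simp

theorem degInto_le_degree (v : V) (A : Finset V) [Fintype (G.neighborSet v)] :
    degInto G v A ≤ G.degree v := by
  rw [degree_eq_degInto]
  exact degInto_mono_set (Finset.subset_univ _)

theorem degree_mono_graph (h : H ≤ G) (v : V) [Fintype (H.neighborSet v)]
    [Fintype (G.neighborSet v)] : H.degree v ≤ G.degree v := by
  rw [degree_eq_degInto, degree_eq_degInto]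
  exact degInto_mono_graph h v _

theorem degree_eq_degInto_of_forall {v : V} {A : Finset V} [Fintype (G.neighborSet v)]
    (h : ∀ u, G.Adj v u → u ∈ A) :
    G.degree v = degInto G v A := by
  rw [degree_eq_degInto]
  unfold degInto
  congr 1
  ext x
  simp only [Finset.mem_filter, Finset.mem_univ, true_and]
  exact ⟨fun hx => ⟨h x hx, hx⟩, fun hx => hx.2⟩

/-- A set of ordered pairs that contains each edge in at least one orientation has at least as
many elements as the graph has edges. -/
theorem numEdges_le_card (T : Finset (V × V))
    (h : ∀ x y, G.Adj x y → (x, y) ∈ T ∨ (y, x) ∈ T) : numEdges G ≤ T.card := by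
  unfold numEdges
  refine le_trans (Finset.card_le_card ?_)
    (Finset.card_image_le (s := T) (f := fun p => s(p.1, p.2)))
  intro e he
  induction e with
  | _ x y =>
    rw [SimpleGraph.mem_edgeFinset, SimpleGraph.mem_edgeSet] at he
    rw [Finset.mem_image]
    rcases h x y he with h1 | h1
    · exact ⟨_, h1, rfl⟩
    · exact ⟨_, h1, Sym2.eq_swap⟩

theorem numEdges_mono (h : H ≤ G) : numEdges H ≤ numEdges G := by
  unfold numEdges
  exact Finset.card_le_card fun e he => by
    rw [SimpleGraph.mem_edgeFinset] at he ⊢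
    exact SimpleGraph.edgeSet_mono h he

theorem numEdges_lt (h : H < G) : numEdges H < numEdges G := by
  unfold numEdges
  refine Finset.card_lt_card ?_
  rw [Finset.ssubset_iff_subset_ne]
  refine ⟨fun e he => ?_, fun he => h.ne ?_⟩
  · rw [SimpleGraph.mem_edgeFinset] at he ⊢
    exact SimpleGraph.edgeSet_mono h.le he
  · ext x y
    rw [← SimpleGraph.mem_edgeSet, ← SimpleGraph.mem_edgeSet, ← SimpleGraph.mem_edgeFinset, he,
      SimpleGraph.mem_edgeFinset]

theorem two_mul_numEdges : 2 * numEdges G = ∑ v, degInto G v Finset.univ := by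
  unfold numEdges
  rw [← SimpleGraph.sum_degrees_eq_twice_card_edges]
  exact Finset.sum_congr rfl fun v _ => degree_eq_degInto v

theorem numEdges_sup_le {G₁ G₂ : SimpleGraph V} :
    numEdges (G₁ ⊔ G₂) ≤ numEdges G₁ + numEdges G₂ := by
  have h : 2 * numEdges (G₁ ⊔ G₂) ≤ 2 * (numEdges G₁ + numEdges G₂) := by
    rw [mul_add, two_mul_numEdges, two_mul_numEdges, two_mul_numEdges, ← Finset.sum_add_distrib]
    refine Finset.sum_le_sum fun v _ => ?_
    simp only [degInto_eq_sum, ← Finset.sum_add_distrib]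
    refine Finset.sum_le_sum fun u _ => ?_
    simp only [SimpleGraph.sup_adj]
    by_cases h1 : G₁.Adj v u <;> by_cases h2 : G₂.Adj v u <;> simp [h1, h2]
  omega


theorem numEdges_le_sum_degInto (U W : Finset V)
    (h : ∀ x y, G.Adj x y → (x ∈ U ∧ y ∈ W) ∨ (y ∈ U ∧ x ∈ W)) :
    numEdges G ≤ ∑ u ∈ U, degInto G u W := by
  refine le_trans (numEdges_le_card ((U ×ˢ W).filter fun p => G.Adj p.1 p.2) ?_) (le_of_eq ?_)
  · intro x y hxy
    simp only [Finset.mem_filter, Finset.mem_product]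
    exact (h x y hxy).imp (fun h => ⟨h, hxy⟩) (fun h => ⟨h, hxy.symm⟩)
  · rw [Finset.card_filter, Finset.sum_product]
    simp only [degInto_eq_sum]

theorem numEdges_le_sum_degree (U : Finset V) (h : ∀ x y, G.Adj x y → x ∈ U ∨ y ∈ U) :
    numEdges G ≤ ∑ u ∈ U, G.degree u := by
  refine le_trans (numEdges_le_sum_degInto U Finset.univ fun x y hxy => ?_)
    (Finset.sum_le_sum fun u _ => degInto_le_degree u _)
  simpa using h x y hxy

theorem numEdges_eq_sum_degInto {U W : Finset V} (hd : Disjoint U W)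
    (h : ∀ x y, G.Adj x y → (x ∈ U ∧ y ∈ W) ∨ (x ∈ W ∧ y ∈ U)) :
    numEdges G = ∑ u ∈ U, degInto G u W := by
  have h0 : ∀ v, v ∉ U → v ∉ W → degInto G v Finset.univ = 0 := by
    intro v h1 h2
    unfold degInto
    rw [Finset.card_eq_zero, Finset.filter_eq_empty_iff]
    intro x _ hx
    rcases h v x hx with h | h <;> tauto
  have h1 : ∀ v ∈ U, degInto G v Finset.univ = degInto G v W := by
    intro v hv
    rw [← degree_eq_degInto]
    refine degree_eq_degInto_of_forall fun x hx => ?_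
    rcases h v x hx with h | h
    · exact h.2
    · exact absurd h.1 (Finset.disjoint_left.1 hd hv)
  have h2 : ∀ v ∈ W, degInto G v Finset.univ = degInto G v U := by
    intro v hv
    rw [← degree_eq_degInto]
    refine degree_eq_degInto_of_forall fun x hx => ?_
    rcases h v x hx with h | h
    · exact absurd hv (Finset.disjoint_left.1 hd h.1)
    · exact h.2
  have h3 : 2 * numEdges G = 2 * ∑ u ∈ U, degInto G u W := by
    rw [two_mul_numEdges, two_mul]
    nth_rewrite 2 [sum_degInto_comm]
    rw [← Finset.sum_subset (Finset.subset_univ (U ∪ W)) (fun v _ hv => by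
      rw [Finset.mem_union, not_or] at hv; exact h0 v hv.1 hv.2), Finset.sum_union hd,
      Finset.sum_congr rfl h1, Finset.sum_congr rfl h2]
    exact add_comm _ _
  omega

omit [Fintype V] in
theorem degInto_deleteEdge_of_ne {v a b : V} (ha : v ≠ a) (hb : v ≠ b) (A : Finset V) :
    degInto (G.deleteEdges {s(a, b)}) v A = degInto G v A := by
  refine degInto_congr fun u _ => ?_
  simp only [SimpleGraph.deleteEdges_adj, Set.mem_singleton_iff, Sym2.eq_iff]
  tauto

theorem degInto_deleteEdge_ge (a b v : V) :
    degInto G v Finset.univ ≤ degInto (G.deleteEdges {s(a, b)}) v Finset.univ + 1 := by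
  by_cases h : v = a ∨ v = b
  · obtain ⟨w, hw⟩ : ∃ w, s(a, b) = s(v, w) := by
      rcases h with rfl | rfl
      · exact ⟨b, rfl⟩
      · exact ⟨a, Sym2.eq_swap⟩
    rw [hw]
    have : degInto (G.deleteEdges {s(v, w)}) v Finset.univ ≥
        degInto G v (Finset.univ.erase w) := by
      refine Finset.card_le_card fun x hx => ?_
      simp only [Finset.mem_filter, Finset.mem_erase, Finset.mem_univ, and_true, true_and,
        SimpleGraph.deleteEdges_adj, Set.mem_singleton_iff, Sym2.eq_iff] at hx ⊢
      refine ⟨hx.2, ?_⟩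
      rintro (h | h)
      · exact hx.1 h
      · exact hx.1 (h.2.trans h.1)
    have h2 := degInto_union_le (G := G) v (Finset.univ.erase w) {w}
    have h3 : (Finset.univ.erase w) ∪ {w} = (Finset.univ : Finset V) := by
      ext x; by_cases hx : x = w <;> simp [hx]
    have h4 := degInto_le_card (G := G) v {w}
    rw [h3] at h2
    simp only [Finset.card_singleton] at h4
    omega
  · push Not at h
    rw [degInto_deleteEdge_of_ne h.1 h.2]
    omega

omit [Fintype V] in
theorem deleteEdge_lt {a b : V} (h : G.Adj a b) : G.deleteEdges {s(a, b)} < G := by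
  refine lt_of_le_of_ne (SimpleGraph.deleteEdges_le _) fun he => ?_
  have : (G.deleteEdges {s(a, b)}).Adj a b := by rw [he]; exact h
  simp at this

/-- A graph property that holds for `G` holds for some subgraph of `G` that loses it whenever an
edge is deleted. -/
theorem exists_edge_minimal (P : SimpleGraph V → Prop) (hG : P G) :
    ∃ H ≤ G, P H ∧ ∀ a b, H.Adj a b → ¬ P (H.deleteEdges {s(a, b)}) := by
  obtain ⟨H, hH, hmin⟩ := Set.exists_min_image {H : SimpleGraph V | H ≤ G ∧ P H} numEdges
    (Set.toFinite _) ⟨G, le_rfl, hG⟩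
  refine ⟨H, hH.1, hH.2, fun a b hab hP => ?_⟩
  have h1 := hmin _ ⟨(SimpleGraph.deleteEdges_le _).trans hH.1, hP⟩
  have h2 := numEdges_lt (deleteEdge_lt hab)
  omega

end Basic

section Combinatorics

/-- A selection lemma from Hall's theorem: if every `x` has at least `g * q x` related elements and
every `y` is related to at most `g * cap y` elements, then one can assign to each `x` exactly `q x`
of its related elements without using any `y` more than `cap y` times. -/
theorem exists_selection {α β : Type*} [Fintype α] [Fintype β] (J : α → Finset β) (q : α → ℕ)
    (cap : β → ℕ) {g : ℕ} (hg : 1 ≤ g) (hq : ∀ x, g * q x ≤ (J x).card)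
    (hcap : ∀ y, (Finset.univ.filter fun x => y ∈ J x).card ≤ g * cap y) :
    ∃ H : α → Finset β, (∀ x, H x ⊆ J x) ∧ (∀ x, (H x).card = q x) ∧
      ∀ y, (Finset.univ.filter fun x => y ∈ H x).card ≤ cap y := by
  -- Split the neighbours of `x` into `q x` disjoint groups of size `g`.
  have hgroups : ∀ x, ∃ f : Fin g × Fin (q x) → β, Function.Injective f ∧ ∀ p, f p ∈ J x := by
    intro x
    have : Fintype.card (Fin g × Fin (q x)) ≤ Fintype.card (J x) := by
      simpa using hq x
    obtain ⟨f⟩ := Function.Embedding.nonempty_of_card_le this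
    exact ⟨fun p => (f p).1, fun p p' h => f.injective (Subtype.ext h), fun p => (f p).2⟩
  choose f hfinj hfmem using hgroups
  let t : (Σ x, Fin (q x)) → Finset (Σ y, Fin (cap y)) := fun i =>
    (Finset.univ : Finset (Σ y, Fin (cap y))).filter fun c => ∃ j : Fin g, f i.1 (j, i.2) = c.1
  have hall : ∀ s : Finset (Σ x, Fin (q x)), s.card ≤ (s.biUnion t).card := by
    intro s
    -- the set of elements of `β` covered by the groups of `s`
    let Y : Finset β := (s ×ˢ (Finset.univ : Finset (Fin g))).image fun p => f p.1.1 (p.2, p.1.2)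
    have h1 : s.card * g ≤ ∑ y ∈ Y, g * cap y := by
      have e1 : s.card * g = (s ×ˢ (Finset.univ : Finset (Fin g))).card := by
        rw [Finset.card_product]; simp
      rw [e1, Finset.card_eq_sum_card_image (fun p => f p.1.1 (p.2, p.1.2))]
      refine Finset.sum_le_sum fun y _ => le_trans ?_ (hcap y)
      refine Finset.card_le_card_of_injOn (fun p => p.1.1) ?_ ?_
      · rintro p hp
        simp only [Finset.coe_filter, Set.mem_ofPred_eq, Finset.mem_univ, true_and] at hp ⊢
        rw [← hp.2]
        exact hfmem _ _
      · rintro ⟨⟨x, i⟩, j⟩ hp ⟨⟨x', i'⟩, j'⟩ hp' hxx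
        simp only at hxx
        subst hxx
        simp only [Finset.coe_filter, Set.mem_ofPred_eq] at hp hp'
        have := hfinj _ (hp.2.trans hp'.2.symm)
        simp only [Prod.mk.injEq] at this
        rw [this.1, this.2]
    have h2 : (s.biUnion t).card = ∑ y ∈ Y, cap y := by
      have e2 : s.biUnion t = Y.sigma fun _ => Finset.univ := by
        ext ⟨y, c⟩
        simp only [t, Y, Finset.mem_biUnion, Finset.mem_filter, Finset.mem_univ, true_and,
          Finset.mem_sigma, Finset.mem_image, Finset.mem_product, and_true, Prod.exists]
        constructor
        · rintro ⟨i, hi, j, hj⟩; exact ⟨i, j, hi, hj⟩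
        · rintro ⟨i, j, hi, hj⟩; exact ⟨i, hi, j, hj⟩
      rw [e2, Finset.card_sigma]; simp
    rw [h2]
    rw [← Finset.mul_sum, mul_comm] at h1
    exact Nat.le_of_mul_le_mul_left h1 hg
  obtain ⟨F, hFinj, hFmem⟩ := (Finset.all_card_le_biUnion_card_iff_exists_injective t).1 hall
  have hF : ∀ i, ∃ j : Fin g, f i.1 (j, i.2) = (F i).1 := fun i => by
    have := hFmem i
    simp only [t, Finset.mem_filter, Finset.mem_univ, true_and] at this
    exact this
  refine ⟨fun x => Finset.univ.image fun i : Fin (q x) => (F ⟨x, i⟩).1, ?_, ?_, ?_⟩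
  · intro x y hy
    simp only [Finset.mem_image, Finset.mem_univ, true_and] at hy
    obtain ⟨i, rfl⟩ := hy
    obtain ⟨j, hj⟩ := hF ⟨x, i⟩
    rw [← hj]
    exact hfmem _ _
  · intro x
    rw [Finset.card_image_of_injective, Finset.card_univ, Fintype.card_fin]
    intro i i' h
    obtain ⟨j, hj⟩ := hF ⟨x, i⟩
    obtain ⟨j', hj'⟩ := hF ⟨x, i'⟩
    have := hfinj x (hj.trans (h.trans hj'.symm))
    simp only [Prod.mk.injEq] at this
    exact this.2
  · intro y
    have : ∀ x, y ∈ (Finset.univ.image fun i : Fin (q x) => (F ⟨x, i⟩).1) →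
        ∃ c : Fin (cap y), ∃ i : Fin (q x), F ⟨x, i⟩ = ⟨y, c⟩ := by
      intro x hx
      simp only [Finset.mem_image, Finset.mem_univ, true_and] at hx
      obtain ⟨i, hi⟩ := hx
      subst hi
      exact ⟨(F ⟨x, i⟩).2, i, rfl⟩
    have hle : Fintype.card {x // y ∈ (Finset.univ.image fun i : Fin (q x) => (F ⟨x, i⟩).1)} ≤
        Fintype.card (Fin (cap y)) := by
      choose c i hc using fun x : {x // y ∈
        (Finset.univ.image fun i : Fin (q x) => (F ⟨x, i⟩).1)} => this x.1 x.2
      refine Fintype.card_le_of_injective c fun x x' h => ?_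
      have h1 := hc x
      rw [h, ← hc x'] at h1
      have := hFinj h1
      exact Subtype.ext (congrArg Sigma.fst this)
    rw [Fintype.card_fin, Fintype.card_subtype] at hle
    exact hle

/-- A derandomised second moment bound: some subset `D` of `L` meets each set `N i` in about
`p * |N i ∩ L|` elements, the weighted sum of the squared deviations being at most its mean when
every element of `L` is taken with probability `p`. -/
theorem exists_subset_sq_deviation_le {α ι : Type*} [Fintype ι] (L : Finset α) (N : ι → Finset α)
    (w : ι → ℝ) (hw : ∀ i, 0 ≤ w i) {p : ℝ} (hp0 : 0 ≤ p) (hp1 : p ≤ 1) :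
    ∃ D ⊆ L, ∑ i, w i * (((N i ∩ D).card : ℝ) - p * (N i ∩ L).card) ^ 2 ≤
      ∑ i, w i * (N i ∩ L).card := by
  suffices h : ∀ c : ι → ℝ, ∃ D ⊆ L,
      ∑ i, w i * (((N i ∩ D).card : ℝ) - p * (N i ∩ L).card - c i) ^ 2 ≤
      ∑ i, w i * ((c i) ^ 2 + p * (1 - p) * (N i ∩ L).card) by
    obtain ⟨D, hD, h⟩ := h 0
    refine ⟨D, hD, le_trans (le_of_eq (by simp)) (h.trans (Finset.sum_le_sum fun i _ => ?_))⟩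
    refine mul_le_mul_of_nonneg_left ?_ (hw i)
    have : p * (1 - p) ≤ 1 := by nlinarith
    have h0 : (0 : ℝ) ≤ (N i ∩ L).card := Nat.cast_nonneg _
    simp only [Pi.zero_apply]
    nlinarith
  induction L using Finset.induction_on with
  | empty => intro c; exact ⟨∅, le_rfl, by simp⟩
  | insert u L hu ih =>
    intro c
    let χ : ι → ℝ := fun i => if u ∈ N i then 1 else 0
    have hχ : ∀ i, χ i * χ i = χ i := by intro i; simp only [χ]; split_ifs <;> simp
    have hcard : ∀ (i : ι) (D : Finset α), u ∉ D →
        ((N i ∩ insert u D).card : ℝ) = (N i ∩ D).card + χ i := by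
      intro i D hD
      simp only [χ]
      by_cases h : u ∈ N i
      · rw [Finset.inter_insert_of_mem h, Finset.card_insert_of_notMem (by simp [hD])]
        simp [h]
      · rw [Finset.inter_insert_of_notMem h]; simp [h]
    obtain ⟨D₁, hD₁, h₁⟩ := ih fun i => c i - (1 - p) * χ i
    obtain ⟨D₀, hD₀, h₀⟩ := ih fun i => c i + p * χ i
    have hu1 : u ∉ D₁ := fun h => hu (hD₁ h)
    have key : p * ∑ i, w i * ((c i - (1 - p) * χ i) ^ 2 + p * (1 - p) * (N i ∩ L).card) +
        (1 - p) * ∑ i, w i * ((c i + p * χ i) ^ 2 + p * (1 - p) * (N i ∩ L).card) =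
        ∑ i, w i * ((c i) ^ 2 + p * (1 - p) * (N i ∩ insert u L).card) := by
      rw [Finset.mul_sum, Finset.mul_sum, ← Finset.sum_add_distrib]
      refine Finset.sum_congr rfl fun i _ => ?_
      rw [hcard i L hu]
      linear_combination w i * p * (1 - p) * hχ i
    by_cases hcase : ∑ i, w i * ((c i - (1 - p) * χ i) ^ 2 + p * (1 - p) * (N i ∩ L).card) ≤
        ∑ i, w i * ((c i) ^ 2 + p * (1 - p) * (N i ∩ insert u L).card)
    · refine ⟨insert u D₁, Finset.insert_subset_insert _ hD₁, le_trans (le_of_eq ?_)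
        (h₁.trans hcase)⟩
      refine Finset.sum_congr rfl fun i _ => ?_
      rw [hcard i L hu, hcard i D₁ hu1]
      ring
    · refine ⟨D₀, hD₀.trans (Finset.subset_insert _ _), le_trans (le_of_eq ?_) (h₀.trans ?_)⟩
      · refine Finset.sum_congr rfl fun i _ => ?_
        rw [hcard i L hu]
        ring
      · push Not at hcase
        by_contra hcon
        push Not at hcon
        rcases hp0.eq_or_lt with rfl | hp
        · linarith
        · nlinarith [mul_lt_mul_of_pos_left hcase hp,
            mul_le_mul_of_nonneg_left hcon.le (sub_nonneg.2 hp1)]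

end Combinatorics

/-! ### Minimal subgraphs and separation -/

section Gap

variable {V : Type u} [Fintype V] {G : SimpleGraph V}

/-- An edge-minimal subgraph with at least `m` vertices of degree at least `d`: every edge meets the
set of vertices of degree exactly `d`, and there are hardly more than `m` vertices of large
degree. -/
theorem exists_minimal_large {d m : ℕ} (hd : 1 ≤ d)
    (hm : m ≤ (Finset.univ.filter fun v => d ≤ G.degree v).card) :
    ∃ H ≤ G, m ≤ (Finset.univ.filter fun v => d ≤ H.degree v).card ∧
      (Finset.univ.filter fun v => d ≤ H.degree v).card ≤ m + 1 ∧
      ∀ a b, H.Adj a b → H.degree a = d ∨ H.degree b = d := by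
  simp only [degree_eq_degInto] at hm ⊢
  obtain ⟨H, hHG, hH, hmin⟩ := exists_edge_minimal
    (fun H : SimpleGraph V => m ≤ (Finset.univ.filter fun v => d ≤ degInto H v Finset.univ).card) hm
  refine ⟨H, hHG, hH, ?_, ?_⟩
  · by_contra hcon
    push Not at hcon
    obtain ⟨a, ha⟩ := Finset.card_pos.1 (lt_of_le_of_lt (Nat.zero_le _) hcon)
    simp only [Finset.mem_filter, Finset.mem_univ, true_and] at ha
    rw [← degree_eq_degInto] at ha
    obtain ⟨b, hab⟩ := (H.degree_pos_iff_exists_adj (v := a)).1 (by omega)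
    refine hmin a b hab ?_
    have hsub : (((Finset.univ.filter fun v => d ≤ degInto H v Finset.univ).erase a).erase b) ⊆
        Finset.univ.filter fun v => d ≤ degInto (H.deleteEdges {s(a, b)}) v Finset.univ := by
      intro v hv
      simp only [Finset.mem_erase, Finset.mem_filter, Finset.mem_univ, true_and] at hv ⊢
      rw [degInto_deleteEdge_of_ne hv.2.1 hv.1]
      exact hv.2.2
    have h1 := Finset.card_le_card hsub
    have h2 := Finset.pred_card_le_card_erase (a := b)
      (s := (Finset.univ.filter fun v => d ≤ degInto H v Finset.univ).erase a)
    have h3 := Finset.pred_card_le_card_erase (a := a)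
      (s := Finset.univ.filter fun v => d ≤ degInto H v Finset.univ)
    omega
  · intro a b hab
    by_contra hcon
    push Not at hcon
    refine hmin a b hab (hH.trans (Finset.card_le_card fun v hv => ?_))
    simp only [Finset.mem_filter, Finset.mem_univ, true_and] at hv ⊢
    by_cases h : v = a ∨ v = b
    · have := degInto_deleteEdge_ge (G := H) a b v
      have : degInto H v Finset.univ ≠ d := by rcases h with rfl | rfl <;> tauto
      omega
    · push Not at h
      rwa [degInto_deleteEdge_of_ne h.1 h.2]

/-- An edge-minimal subgraph obeying lower bounds on the degrees: every edge has an end at which the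
bound is attained. -/
theorem exists_minimal_degree (D : V → ℕ) (hD : ∀ v, D v ≤ G.degree v) :
    ∃ H ≤ G, (∀ v, D v ≤ H.degree v) ∧ ∀ a b, H.Adj a b → H.degree a = D a ∨ H.degree b = D b := by
  simp only [degree_eq_degInto] at hD ⊢
  obtain ⟨H, hHG, hH, hmin⟩ := exists_edge_minimal
    (fun H : SimpleGraph V => ∀ v, D v ≤ degInto H v Finset.univ) hD
  refine ⟨H, hHG, hH, fun a b hab => ?_⟩
  by_contra hcon
  push Not at hcon
  refine hmin a b hab fun v => ?_
  have h0 := hH v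
  by_cases h : v = a ∨ v = b
  · have := degInto_deleteEdge_ge (G := H) a b v
    have : degInto H v Finset.univ ≠ D v := by rcases h with rfl | rfl <;> tauto
    omega
  · push Not at h
    rwa [degInto_deleteEdge_of_ne h.1 h.2]

theorem numEdges_le_sum_of_tight (D : V → ℕ)
    (h : ∀ a b, G.Adj a b → G.degree a = D a ∨ G.degree b = D b) :
    numEdges G ≤ ∑ v, D v := by
  refine (numEdges_le_sum_degree (Finset.univ.filter fun v => G.degree v = D v)
    (by simpa using h)).trans ?_
  rw [Finset.sum_congr rfl (g := D) fun v hv => by simpa using hv]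
  exact Finset.sum_le_sum_of_subset (Finset.filter_subset _ _)

/-- Separation of the vertices of intermediate degree `X` from the rest. Later, the edges at `X ∪ Y`
and those between `B` and `Z` are deleted; then a vertex of `T \ Z` loses at most `s` of its degree,
and a vertex of `B \ Y` keeps the fraction `1 / R` of it. The pair `(Y, Z)` minimises
`c s |Z| + ∑_{X ∪ Y} deg - c e(Z, X ∪ Y)` with `c = R / (R - 1)`: minimality under adding one vertex
to `Y` or to `Z` gives the local properties, comparison with `Y = Z = ∅` bounds the size of `Z`. -/
theorem exists_separation {X B T : Finset V} (hXB : Disjoint X B) (R s : ℝ) (hR : 1 < R) :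
    ∃ Y ⊆ B, ∃ Z ⊆ T, (∀ v ∈ T \ Z, (degInto G v (X ∪ Y) : ℝ) ≤ s) ∧
      (∀ b ∈ B \ Y, (G.degree b : ℝ) ≤ R * ((G.degree b : ℝ) - degInto G b Z)) ∧
      s * (Z.card : ℝ) ≤ ∑ x ∈ X, (G.degree x : ℝ) + (∑ x ∈ B, (G.degree x : ℝ)) / R := by
  set c : ℝ := R / (R - 1) with hc
  have hR1 : 0 < R - 1 := by linarith
  have hc0 : 0 < c := div_pos (by linarith) hR1
  have hcR : c * (R - 1) = R := div_mul_cancel₀ _ hR1.ne'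
  let F : Finset V × Finset V → ℝ := fun p =>
    c * s * (p.2.card : ℝ) + ∑ x ∈ X ∪ p.1, (G.degree x : ℝ) -
      c * ∑ z ∈ p.2, (degInto G z (X ∪ p.1) : ℝ)
  obtain ⟨⟨Y, Z⟩, hYZ, hmin⟩ := Finset.exists_min_image (B.powerset ×ˢ T.powerset) F
    ⟨(∅, ∅), by simp⟩
  simp only [Finset.mem_product, Finset.mem_powerset] at hYZ
  obtain ⟨hY, hZ⟩ := hYZ
  refine ⟨Y, hY, Z, hZ, ?_, ?_, ?_⟩
  · intro v hv
    rw [Finset.mem_sdiff] at hv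
    have h := hmin (Y, insert v Z) (by
      simp only [Finset.mem_product, Finset.mem_powerset]
      exact ⟨hY, Finset.insert_subset hv.1 hZ⟩)
    simp only [F, Finset.card_insert_of_notMem hv.2, Finset.sum_insert hv.2] at h
    push_cast at h
    have : c * (degInto G v (X ∪ Y) : ℝ) ≤ c * s := by linarith
    exact le_of_mul_le_mul_left this hc0
  · intro b hb
    rw [Finset.mem_sdiff] at hb
    have hbX : b ∉ X ∪ Y := by
      rw [Finset.mem_union, not_or]
      exact ⟨fun h => Finset.disjoint_left.1 hXB h hb.1, hb.2⟩
    have h := hmin (insert b Y, Z) (by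
      simp only [Finset.mem_product, Finset.mem_powerset]
      exact ⟨Finset.insert_subset hb.1 hY, hZ⟩)
    have hU : X ∪ insert b Y = insert b (X ∪ Y) := by
      rw [Finset.union_insert]
    simp only [F, hU, Finset.sum_insert hbX] at h
    have e1 : ∑ z ∈ Z, (degInto G z (insert b (X ∪ Y)) : ℝ) =
        ∑ z ∈ Z, (degInto G z (X ∪ Y) : ℝ) + degInto G b Z := by
      have := sum_degInto_comm (G := G) Z (insert b (X ∪ Y))
      rw [Finset.sum_insert hbX, sum_degInto_comm (G := G) (X ∪ Y) Z] at this
      have := congrArg (Nat.cast (R := ℝ)) this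
      push_cast at this
      linarith
    rw [e1] at h
    have h3 : c * (degInto G b Z : ℝ) ≤ G.degree b := by linarith
    have h4 := mul_le_mul_of_nonneg_right h3 hR1.le
    have h5 : c * (degInto G b Z : ℝ) * (R - 1) = R * degInto G b Z := by
      linear_combination (degInto G b Z : ℝ) * hcR
    rw [h5] at h4
    linarith
  · have h := hmin (∅, ∅) (by simp)
    simp only [F, Finset.union_empty, Finset.card_empty, Finset.sum_empty] at h
    have hXY : Disjoint X Y := hXB.mono_right hY
    rw [Finset.sum_union hXY] at h
    have e1 : ∑ z ∈ Z, (degInto G z (X ∪ Y) : ℝ) ≤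
        ∑ x ∈ X, (G.degree x : ℝ) + ∑ x ∈ Y, (G.degree x : ℝ) := by
      rw [← Finset.sum_union hXY]
      have := sum_degInto_comm (G := G) Z (X ∪ Y)
      have h2 : ∑ x ∈ X ∪ Y, degInto G x Z ≤ ∑ x ∈ X ∪ Y, G.degree x :=
        Finset.sum_le_sum fun x _ => degInto_le_degree x Z
      rw [← this] at h2
      exact_mod_cast h2
    have e2 : ∑ x ∈ Y, (G.degree x : ℝ) ≤ ∑ x ∈ B, (G.degree x : ℝ) :=
      Finset.sum_le_sum_of_subset_of_nonneg hY fun _ _ _ => Nat.cast_nonneg _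
    set a := ∑ x ∈ X, (G.degree x : ℝ)
    set y := ∑ x ∈ Y, (G.degree x : ℝ)
    set E := ∑ z ∈ Z, (degInto G z (X ∪ Y) : ℝ)
    -- `(c - 1) / c = 1 / R`
    have h1 : c * (s * (Z.card : ℝ)) ≤ c * (a + y / R) := by
      have : c * (a + y / R) = c * (a + y) - y := by
        rw [hc]; field_simp; ring
      rw [this]
      push_cast at h
      nlinarith [mul_le_mul_of_nonneg_left e1 hc0.le]
    have h2 := le_of_mul_le_mul_left h1 hc0
    have h3 : y / R ≤ (∑ x ∈ B, (G.degree x : ℝ)) / R :=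
      div_le_div_of_nonneg_right e2 (by linarith)
    linarith

omit [Fintype V] in
/-- Among the scales `11, …, N` there is one such that the degrees between it and the next but one
have a small sum. Each degree lies in at most two of these windows. -/
theorem exists_sparse_scale (f : V → ℝ) (hf : ∀ v, 0 ≤ f v) (M : Finset V) (θ : ℕ → ℝ) (N : ℕ)
    (hN : 11 ≤ N) (hθ : ∀ i j, 1 ≤ i → i ≤ j → θ i ≤ θ j) :
    ∃ i, 11 ≤ i ∧ i ≤ N ∧
      ((N : ℝ) - 10) * ∑ v ∈ M.filter (fun v => θ i < f v ∧ f v < θ (i + 2)), f v ≤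
        2 * ∑ v ∈ M, f v := by
  have hne : (Finset.Icc 11 N).Nonempty := ⟨11, by simp [hN]⟩
  obtain ⟨i, hi, hmin⟩ := Finset.exists_min_image (Finset.Icc 11 N)
    (fun i => ∑ v ∈ M.filter (fun v => θ i < f v ∧ f v < θ (i + 2)), f v) hne
  rw [Finset.mem_Icc] at hi
  refine ⟨i, hi.1, hi.2, ?_⟩
  have h1 : ((Finset.Icc 11 N).card : ℝ) *
      ∑ v ∈ M.filter (fun v => θ i < f v ∧ f v < θ (i + 2)), f v ≤
      ∑ j ∈ Finset.Icc 11 N, ∑ v ∈ M.filter (fun v => θ j < f v ∧ f v < θ (j + 2)), f v := by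
    rw [← nsmul_eq_mul]
    exact Finset.card_nsmul_le_sum _ _ _ hmin
  have h2 : ((Finset.Icc 11 N).card : ℝ) = (N : ℝ) - 10 := by
    rw [Nat.card_Icc, Nat.cast_sub (by omega)]
    push_cast
    ring
  rw [h2] at h1
  refine h1.trans ?_
  simp only [Finset.sum_filter]
  rw [Finset.sum_comm, Finset.mul_sum]
  refine Finset.sum_le_sum fun v _ => ?_
  rw [← Finset.sum_filter, Finset.sum_const, nsmul_eq_mul]
  refine mul_le_mul_of_nonneg_right ?_ (hf v)
  set S := (Finset.Icc 11 N).filter fun j => θ j < f v ∧ f v < θ (j + 2)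
  rcases S.eq_empty_or_nonempty with hS | hS
  · rw [hS]; simp
  · have hsub : S ⊆ {S.min' hS, S.min' hS + 1} := by
      intro j hj
      have h3 := S.min'_le j hj
      have h4 := S.min'_mem hS
      set a := S.min' hS
      simp only [S, Finset.mem_filter, Finset.mem_Icc] at hj h4
      by_contra hcon
      simp only [Finset.mem_insert, Finset.mem_singleton, not_or] at hcon
      have := hθ (a + 2) j (by omega) (by omega)
      linarith [h4.2.2, hj.2.1]
    have := (Finset.card_le_card hsub).trans Finset.card_le_two
    exact_mod_cast this

end Gap

/-! ### The degree gap for large scales -/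

section Gap

variable {V : Type u} [Fintype V] {G : SimpleGraph V}

theorem isLKS_iff {k : ℕ} {η : ℝ} : IsLKS G k η ↔ (1 / 2 + η) * (Fintype.card V : ℝ) ≤
    ((Finset.univ.filter fun v => ⌈(1 + η) * (k : ℝ)⌉₊ ≤ G.degree v).card : ℝ) := by
  unfold IsLKS largeVertices
  simp only [Nat.ceil_le]

set_option maxHeartbeats 4000000 in
/-- A degree gap when the scales from the tenth on exceed the typical degree `k`.

In an edge-minimal subgraph with the right number of vertices of degree at least `d = ⌈(1 + η) k⌉`,
every edge meets the set `T` of vertices of degree exactly `d`, so that the degrees of the other large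
vertices `M` add up to at most `d |T|`. Averaging gives a scale `i` for which the vertices `X ⊆ M` with
degrees between `Ω i k` and `Ω (i + 2) k` have a small degree sum. After a separation, the vertices of
`X` are isolated, those of higher degree keep degree at least `Ω (i + 1) k` or are isolated, and the
remaining large vertices keep degree at least `⌈(1 + η / 2) k⌉`. A second minimisation subject to
these lower bounds yields the small LKS graph. -/
theorem exists_gap_of_two_le {η : ℝ} (hη0 : 0 < η) (hη1 : η ≤ 1 / 2) {k : ℕ}
    (hk : 10000 ≤ η ^ 2 * k) {Ω : ℕ → ℝ} (hpos : ∀ j, 1 ≤ j → 0 < Ω j)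
    (hΩ : ∀ j, 1 ≤ j → 100 / η ^ 2 * Ω j ≤ Ω (j + 1)) (h10 : 2 ≤ Ω 10)
    (hG : IsLKS G k η) (hn : k ≤ Fintype.card V) :
    ∃ i : ℕ, 1 ≤ i ∧ (i : ℝ) ≤ 100 / η ^ 2 ∧ ∃ H ≤ G, IsLKSSmall H k (η / 2) ∧
      ∀ v, (H.degree v : ℝ) ≤ Ω i * k ∨ Ω (i + 1) * k ≤ (H.degree v : ℝ) := by
  set n : ℝ := (Fintype.card V : ℝ) with hn_def
  have hη2 : η ^ 2 ≤ η / 2 := by nlinarith only [hη0, hη1]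
  have hη2' : η ^ 2 ≤ 1 / 4 := by nlinarith only [hη0, hη1]
  have hηp : 0 < η ^ 2 := by positivity
  set R : ℝ := 100 / η ^ 2 with hR
  have hRη : R * η ^ 2 = 100 := div_mul_cancel₀ _ hηp.ne'
  have hR400 : 400 ≤ R := by nlinarith only [hRη, hη2', hηp]
  have hk0 : (40000 : ℝ) ≤ k := by
    nlinarith only [hk, hη2', Nat.cast_nonneg (α := ℝ) k]
  have hηk : 20000 ≤ η * k := by nlinarith only [hk, hη2, hk0]
  have hnk : (k : ℝ) ≤ n := Nat.cast_le.2 hn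
  have hηn : 20000 ≤ η * n := hηk.trans (mul_le_mul_of_nonneg_left hnk hη0.le)
  have hn0 : 0 ≤ n := le_trans (by linarith) hnk
  clear_value n R
  have hstep : ∀ j, 1 ≤ j → Ω j ≤ Ω (j + 1) := fun j hj => by
    nlinarith only [hΩ j hj, hpos j hj, hR400]
  have hmono : ∀ i j, 1 ≤ i → i ≤ j → Ω i ≤ Ω j := by
    intro i j hi hij
    induction j, hij using Nat.le_induction with
    | base => exact le_rfl
    | succ j hij ih => exact ih.trans (hstep j (hi.trans hij))
  -- `0.58` leaves room for removing `0.08 η n` large vertices below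
  set d : ℕ := ⌈(1 + η) * (k : ℝ)⌉₊ with hd
  set d' : ℕ := ⌈(1 + η / 2) * (k : ℝ)⌉₊ with hd'
  have hd1 : (1 + η) * k ≤ d := Nat.le_ceil _
  have hd2 : (d : ℝ) < (1 + η) * k + 1 := Nat.ceil_lt_add_one (by positivity)
  have hd'1 : (1 + η / 2) * k ≤ d' := Nat.le_ceil _
  have hd'2 : (d' : ℝ) < (1 + η / 2) * k + 1 := Nat.ceil_lt_add_one (by positivity)
  have hdd : d' ≤ d := Nat.ceil_le_ceil (by linarith)
  have hd'pos : 0 < d' := Nat.ceil_pos.2 (by positivity)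
  clear_value d d'
  set m : ℕ := ⌈(1 / 2 + 0.58 * η) * n⌉₊ with hm
  have hm1 : (1 / 2 + 0.58 * η) * n ≤ m := Nat.le_ceil _
  have hm2 : (m : ℝ) < (1 / 2 + 0.58 * η) * n + 1 :=
    Nat.ceil_lt_add_one (mul_nonneg (by linarith) hn0)
  clear_value m
  have hmG : m ≤ (Finset.univ.filter fun v => d ≤ G.degree v).card := by
    have := isLKS_iff.1 hG
    rw [← hd, ← hn_def] at this
    have h2 : (m : ℝ) ≤ ((Finset.univ.filter fun v => d ≤ G.degree v).card : ℝ) := by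
      refine le_trans ?_ this
      linarith
    exact_mod_cast h2
  obtain ⟨G₀, hG₀, hL1, hL2, hedge⟩ := exists_minimal_large (by omega) hmG
  set L : Finset V := Finset.univ.filter fun v => d ≤ G₀.degree v with hL
  set T : Finset V := Finset.univ.filter fun v => G₀.degree v = d with hT
  have hTL : T ⊆ L := fun v hv => by
    simp only [hT, hL, Finset.mem_filter, Finset.mem_univ, true_and] at hv ⊢
    omega
  set M : Finset V := L \ T with hM
  have hMT : ∀ v u, v ∉ T → G₀.Adj v u → u ∈ T := by
    intro v u hv huv
    have := hedge v u huv
    simp only [hT, Finset.mem_filter, Finset.mem_univ, true_and] at hv ⊢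
    tauto
  have hL2' : (L.card : ℝ) ≤ (1 / 2 + 0.58 * η) * n + 2 := by
    have : (L.card : ℝ) ≤ m + 1 := by exact_mod_cast hL2
    linarith
  set E : ℝ := ∑ v ∈ M, (G₀.degree v : ℝ) with hE
  clear_value L T
  have hE0 : 0 ≤ E := hE ▸ Finset.sum_nonneg fun _ _ => Nat.cast_nonneg _
  have hEle : E ≤ 1.186 * (n * k) := by
    have h1 : ∑ v ∈ M, G₀.degree v ≤ ∑ v ∈ T, d := by
      calc ∑ v ∈ M, G₀.degree v = ∑ v ∈ M, degInto G₀ v T :=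
            Finset.sum_congr rfl fun v hv => degree_eq_degInto_of_forall fun u hu =>
              hMT v u (Finset.mem_sdiff.1 hv).2 hu
        _ = ∑ v ∈ T, degInto G₀ v M := sum_degInto_comm _ _
        _ ≤ ∑ v ∈ T, d := Finset.sum_le_sum fun v hv => by
            have := degInto_le_degree (G := G₀) v M
            simp only [hT, Finset.mem_filter, Finset.mem_univ, true_and] at hv
            omega
    rw [Finset.sum_const, smul_eq_mul] at h1
    have h2 : E ≤ (T.card : ℝ) * d := by
      rw [hE]; exact_mod_cast h1
    have h3 : (T.card : ℝ) ≤ L.card := by exact_mod_cast Finset.card_le_card hTL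
    have h4 : (T.card : ℝ) ≤ 0.7901 * n := by nlinarith only [h3, hL2', hη1, hηn, hnk, hk0]
    have h5 : (d : ℝ) ≤ 1.50005 * k := by nlinarith only [hd2, hη1, hk0]
    calc E ≤ (T.card : ℝ) * d := h2
      _ ≤ 0.7901 * n * (1.50005 * k) := mul_le_mul h4 h5 (Nat.cast_nonneg _) (by positivity)
      _ ≤ 1.186 * (n * k) := by
          have : 0 ≤ n * k := by positivity
          linarith
  set N : ℕ := ⌊R⌋₊ with hN
  have hN1 : (N : ℝ) ≤ R := Nat.floor_le (by linarith)
  have hN2 : R < N + 1 := Nat.lt_floor_add_one R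
  have hN11 : 11 ≤ N := Nat.le_floor (by norm_num; linarith)
  clear_value N
  obtain ⟨i, hi11, hiN, hi⟩ := exists_sparse_scale (fun v => (G₀.degree v : ℝ))
    (fun v => Nat.cast_nonneg _) M (fun j => Ω j * k) N hN11
    (fun i j hi hij => mul_le_mul_of_nonneg_right (hmono i j hi hij) (Nat.cast_nonneg _))
  have hΩi : 2 * R ≤ Ω i := by
    have h1 := hΩ 10 (by norm_num)
    have h2 := hmono 11 i (by norm_num) hi11
    have h3 := mul_le_mul_of_nonneg_left h10 (by linarith : 0 ≤ R)
    norm_num at h1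
    linarith
  have hΩ1 := hΩ i (by omega)
  have hΩ2 := hΩ (i + 1) (by omega)
  have hΩi1 : Ω i ≤ Ω (i + 1) := hstep i (by omega)
  have hΩi2 : Ω (i + 1) ≤ Ω (i + 2) := hstep (i + 1) (by omega)
  set X : Finset V := M.filter fun v => Ω i * k < (G₀.degree v : ℝ) ∧
    (G₀.degree v : ℝ) < Ω (i + 2) * k with hX
  set B : Finset V := M.filter fun v => Ω (i + 2) * k ≤ (G₀.degree v : ℝ) with hB
  have hXB : Disjoint X B := by
    rw [Finset.disjoint_left]
    intro v hv hv'
    simp only [hX, hB, Finset.mem_filter] at hv hv'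
    linarith [hv.2.2, hv'.2]
  have hXM : X ⊆ M := Finset.filter_subset _ _
  have hBM : B ⊆ M := Finset.filter_subset _ _
  set QX : ℝ := ∑ v ∈ X, (G₀.degree v : ℝ) with hQX
  set QB : ℝ := ∑ v ∈ B, (G₀.degree v : ℝ) with hQB
  have hQX0 : 0 ≤ QX := Finset.sum_nonneg fun _ _ => Nat.cast_nonneg _
  have hQBE : QB ≤ E := Finset.sum_le_sum_of_subset_of_nonneg hBM fun _ _ _ => Nat.cast_nonneg _
  have hQXE : R * QX ≤ 2.0566 * E := by
    have h1 : ((N : ℝ) - 10) * QX ≤ 2 * E := hE ▸ hi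
    have h2 : 0.9725 * R ≤ (N : ℝ) - 10 := by linarith
    have h3 := mul_le_mul_of_nonneg_right h2 hQX0
    linarith
  set s : ℝ := (d : ℝ) - d' with hs
  have hs1 : 0.4999 * (η * k) ≤ s := by
    have : (1 + η) * k - ((1 + η / 2) * k + 1) ≤ s := by linarith
    linarith
  clear_value E X B QX QB s
  obtain ⟨Y, hYB, Z, hZT, hTZ, hBY, hZcard⟩ := exists_separation (G := G₀) (T := T) hXB R s
    (by linarith)
  rw [← hQX, ← hQB] at hZcard
  have hYM : Y ⊆ M := hYB.trans hBM
  have hMdisj : ∀ v ∈ M, v ∉ T := fun v hv => (Finset.mem_sdiff.1 hv).2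
  -- `X`, `B` and `Z` together have at most `0.08 η n` vertices
  have hZsmall : (Z.card : ℝ) ≤ 0.0726 * (η * n) := by
    have h1 : R * (s * Z.card) ≤ 3.0566 * E := by
      have : R * (QX + QB / R) = R * QX + QB := by field_simp
      have h2 := mul_le_mul_of_nonneg_left hZcard (by linarith : 0 ≤ R)
      rw [this] at h2
      linarith
    have h2 : 100 * (s * Z.card) ≤ η ^ 2 * (3.0566 * (1.186 * (n * k))) := by
      have h3 := mul_le_mul_of_nonneg_left (h1.trans (mul_le_mul_of_nonneg_left hEle
        (by norm_num))) hηp.le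
      calc 100 * (s * Z.card) = η ^ 2 * (R * (s * Z.card)) := by
            rw [← hRη]; ring
        _ ≤ _ := h3
    have h3 : 0.4999 * (η * k) * Z.card ≤ s * Z.card :=
      mul_le_mul_of_nonneg_right hs1 (Nat.cast_nonneg _)
    have h4 : (η * k) * (49.99 * Z.card) ≤ (η * k) * (3.6252 * (η * n)) := by
      have : 0 ≤ η * k * (η * n) := by positivity
      linarith
    have h5 := le_of_mul_le_mul_left h4 (by linarith)
    have : 0 ≤ η * n := by linarith
    linarith
  have hXsmall : (X.card : ℝ) ≤ 0.001 * (η * n) := by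
    have h1 : (X.card : ℝ) * (Ω i * k) ≤ QX := by
      rw [← nsmul_eq_mul, hQX]
      exact Finset.card_nsmul_le_sum _ _ _ fun v hv => by
        simp only [hX, Finset.mem_filter] at hv
        exact hv.2.1.le
    have h2 : (X.card : ℝ) * (2 * R * k) ≤ QX :=
      le_trans (mul_le_mul_of_nonneg_left (mul_le_mul_of_nonneg_right hΩi (Nat.cast_nonneg _))
        (Nat.cast_nonneg _)) h1
    have h3 : R * (R * ((X.card : ℝ) * k)) ≤ 1.22 * (n * k) := by
      have := mul_le_mul_of_nonneg_left h2 (by linarith : 0 ≤ R)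
      linarith
    have h4 : 10000 * ((X.card : ℝ) * k) ≤ η ^ 4 * (1.22 * (n * k)) := by
      have := mul_le_mul_of_nonneg_left h3 (by positivity : 0 ≤ η ^ 4)
      calc 10000 * ((X.card : ℝ) * k) = η ^ 4 * (R * (R * ((X.card : ℝ) * k))) := by
            linear_combination (-(R * η ^ 2) - 100) * ((X.card : ℝ) * k) * hRη
        _ ≤ _ := this
    have h5 : η ^ 4 ≤ η := by
      nlinarith only [hη0, hη2', hη1, hηp, mul_pos hη0 hηp]
    have h6 : k * (10000 * (X.card : ℝ)) ≤ k * (1.22 * (η * n)) := by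
      have : η ^ 4 * (1.22 * (n * k)) ≤ η * (1.22 * (n * k)) :=
        mul_le_mul_of_nonneg_right h5 (by positivity)
      linarith
    have := le_of_mul_le_mul_left h6 (by linarith)
    linarith
  have hBsmall : R * ((B.card : ℝ) * (Ω (i + 1) * k)) ≤ E := by
    have h1 : (B.card : ℝ) * (Ω (i + 2) * k) ≤ QB := by
      rw [← nsmul_eq_mul, hQB]
      exact Finset.card_nsmul_le_sum _ _ _ fun v hv => by
        simp only [hB, Finset.mem_filter] at hv
        exact hv.2
    have h2 : (B.card : ℝ) * (R * Ω (i + 1) * k) ≤ (B.card : ℝ) * (Ω (i + 2) * k) :=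
      mul_le_mul_of_nonneg_left (mul_le_mul_of_nonneg_right hΩ2 (Nat.cast_nonneg _))
        (Nat.cast_nonneg _)
    linarith
  have hΩi1R : 2 * R ≤ Ω (i + 1) := hΩi.trans hΩi1
  have hBsmall' : (B.card : ℝ) ≤ 0.001 * (η * n) := by
    have h3 : R * (R * ((B.card : ℝ) * k)) ≤ 1.22 * (n * k) := by
      have : (B.card : ℝ) * (R * k) ≤ (B.card : ℝ) * (Ω (i + 1) * k) :=
        mul_le_mul_of_nonneg_left (mul_le_mul_of_nonneg_right (by linarith) (Nat.cast_nonneg _))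
          (Nat.cast_nonneg _)
      have h0 : (0 : ℝ) ≤ n * k := by positivity
      linarith [mul_le_mul_of_nonneg_left this (by linarith : 0 ≤ R)]
    have h4 : 10000 * ((B.card : ℝ) * k) ≤ η ^ 4 * (1.22 * (n * k)) := by
      have := mul_le_mul_of_nonneg_left h3 (by positivity : 0 ≤ η ^ 4)
      calc 10000 * ((B.card : ℝ) * k) = η ^ 4 * (R * (R * ((B.card : ℝ) * k))) := by
            linear_combination (-(R * η ^ 2) - 100) * ((B.card : ℝ) * k) * hRη
        _ ≤ _ := this
    have h5 : η ^ 4 ≤ η := by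
      nlinarith only [hη0, hη2', hη1, hηp, mul_pos hη0 hηp]
    have h6 : k * (10000 * (B.card : ℝ)) ≤ k * (1.22 * (η * n)) := by
      have : η ^ 4 * (1.22 * (n * k)) ≤ η * (1.22 * (n * k)) :=
        mul_le_mul_of_nonneg_right h5 (by positivity)
      linarith
    have := le_of_mul_le_mul_left h6 (by linarith)
    linarith
  -- `L'` are the large vertices of the graph to be constructed
  set L' : Finset V := L \ (X ∪ Y ∪ Z) with hL'
  clear_value L'
  have hL'card : (1 / 2 + η / 2) * n ≤ (L'.card : ℝ) := by
    have h1 : L.card ≤ L'.card + (X ∪ Y ∪ Z).card := by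
      have := Finset.le_card_sdiff (X ∪ Y ∪ Z) L
      rw [← hL'] at this
      omega
    have h2 : (X ∪ Y ∪ Z).card ≤ X.card + B.card + Z.card :=
      (Finset.card_union_le _ _).trans (Nat.add_le_add_right ((Finset.card_union_le _ _).trans
        (Nat.add_le_add_left (Finset.card_le_card hYB) _)) _)
    have h3 : (L.card : ℝ) ≤ L'.card + (X.card + B.card + Z.card) := by
      exact_mod_cast h1.trans (Nat.add_le_add_left h2 _)
    have h4 : (m : ℝ) ≤ L.card := by exact_mod_cast hL1
    have : 0 ≤ η * n := by linarith
    linarith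
  obtain ⟨G₁, hG₁adj⟩ : ∃ G₁ : SimpleGraph V, ∀ x y, G₁.Adj x y ↔
      (G₀.Adj x y ∧ x ∉ X ∪ Y ∧ y ∉ X ∪ Y ∧ ¬ (x ∈ B ∧ y ∈ Z) ∧ ¬ (x ∈ Z ∧ y ∈ B)) :=
    ⟨{ Adj := fun x y => G₀.Adj x y ∧ x ∉ X ∪ Y ∧ y ∉ X ∪ Y ∧ ¬ (x ∈ B ∧ y ∈ Z) ∧
        ¬ (x ∈ Z ∧ y ∈ B)
       symm := ⟨fun x y h => ⟨h.1.symm, h.2.2.1, h.2.1, fun h' => h.2.2.2.2 h'.symm,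
        fun h' => h.2.2.2.1 h'.symm⟩⟩
       loopless := ⟨fun x h => G₀.irrefl (v := x) h.1⟩ }, fun _ _ => Iff.rfl⟩
  have hG₁ : G₁ ≤ G₀ := fun x y h => ((hG₁adj x y).1 h).1
  set t : ℕ := ⌈Ω (i + 1) * k⌉₊ with ht
  have ht1 : Ω (i + 1) * k ≤ t := Nat.le_ceil _
  have hΩ800 : 800 ≤ Ω (i + 1) := by linarith
  have hΩk : 800 * k ≤ Ω (i + 1) * k := mul_le_mul_of_nonneg_right hΩ800 (Nat.cast_nonneg _)
  have hΩk' : 800 * k ≤ Ω i * k :=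
    mul_le_mul_of_nonneg_right (by linarith) (Nat.cast_nonneg _)
  have ht2 : (t : ℝ) < Ω (i + 1) * k + 1 := Nat.ceil_lt_add_one (by linarith)
  clear_value t
  have hdΩ : (d : ℝ) ≤ Ω i * k := by
    have : (d : ℝ) ≤ 2 * k := by nlinarith only [hd2, hη1, hk0]
    linarith
  have hd't : d' ≤ t := by
    have h1 : (d' : ℝ) ≤ t := by
      have : (d' : ℝ) ≤ d := by exact_mod_cast hdd
      linarith [mul_le_mul_of_nonneg_right hΩi1 (Nat.cast_nonneg (α := ℝ) k)]
    exact_mod_cast h1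
  let D : V → ℕ := fun v => if v ∈ B \ Y then t else if v ∈ L' then d' else 0
  have hXYM : X ∪ Y ⊆ M := Finset.union_subset hXM hYM
  have hDdeg : ∀ v, D v ≤ G₁.degree v := by
    intro v
    simp only [D]
    split_ifs with h1 h2
    -- a vertex of `B` is outside `T`, hence has all its neighbours in `T` and loses only those in `Z`
    · rw [Finset.mem_sdiff] at h1
      have hvX : v ∉ X ∪ Y := by
        rw [Finset.mem_union, not_or]
        exact ⟨fun h => Finset.disjoint_left.1 hXB h h1.1, h1.2⟩
      have hvT := hMdisj v (hBM h1.1)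
      have h3 : degInto G₀ v (Finset.univ \ Z) ≤ degInto G₁ v Finset.univ := by
        refine Finset.card_le_card fun u hu => ?_
        simp only [Finset.mem_filter, Finset.mem_sdiff, Finset.mem_univ, true_and] at hu ⊢
        refine (hG₁adj v u).2 ⟨hu.2, hvX, fun h => hMdisj u (hXYM h) (hMT v u hvT hu.2), fun h => hu.1 h.2,
          fun h => hvT (hZT h.1)⟩
      have h4 := hBY v (Finset.mem_sdiff.2 h1)
      have h5 := degInto_sdiff_add (G := G₀) v (Finset.subset_univ Z)
      rw [← degree_eq_degInto] at h5 h3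
      have h6 : (G₀.degree v : ℝ) - degInto G₀ v Z = degInto G₀ v (Finset.univ \ Z) := by
        rw [← h5]; push_cast; ring
      rw [h6] at h4
      have h7 : Ω (i + 2) * k ≤ (G₀.degree v : ℝ) := by
        have := h1.1
        simp only [hB, Finset.mem_filter] at this
        exact this.2
      have h8 : R * (Ω (i + 1) * k) ≤ R * (degInto G₀ v (Finset.univ \ Z) : ℝ) := by
        have : R * Ω (i + 1) * k ≤ Ω (i + 2) * k :=
          mul_le_mul_of_nonneg_right hΩ2 (Nat.cast_nonneg _)
        linarith
      have h9 := le_of_mul_le_mul_left h8 (by linarith)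
      rw [ht]
      exact (Nat.ceil_le.2 h9).trans h3
    · simp only [hL', Finset.mem_sdiff, Finset.mem_union, not_or] at h1 h2
      have hvX : v ∉ X ∪ Y := by
        rw [Finset.mem_union, not_or]; exact h2.2.1
      have hvB : v ∉ B := fun h => h1 ⟨h, h2.2.1.2⟩
      have h3 : degInto G₀ v (Finset.univ \ (X ∪ Y)) ≤ degInto G₁ v Finset.univ := by
        refine Finset.card_le_card fun u hu => ?_
        simp only [Finset.mem_filter, Finset.mem_sdiff, Finset.mem_univ, true_and] at hu ⊢
        exact (hG₁adj v u).2 ⟨hu.2, hvX, hu.1, fun h => hvB h.1, fun h => h2.2.2 h.1⟩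
      have h5 := degInto_sdiff_add (G := G₀) v (Finset.subset_univ (X ∪ Y))
      rw [← degree_eq_degInto] at h5 h3
      refine le_trans ?_ h3
      have h2L : d ≤ G₀.degree v := by
        have := h2.1
        simp only [hL, Finset.mem_filter, Finset.mem_univ, true_and] at this
        exact this
      by_cases hvT : v ∈ T
      · have h6 := hTZ v (Finset.mem_sdiff.2 ⟨hvT, h2.2.2⟩)
        have h7 : ((degInto G₀ v (X ∪ Y) + d' : ℕ) : ℝ) ≤ (d : ℕ) := by
          push_cast; linarith
        have h8 := Nat.cast_le.1 h7
        omega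
      · have h6 : degInto G₀ v (X ∪ Y) = 0 := by
          unfold degInto
          rw [Finset.card_eq_zero, Finset.filter_eq_empty_iff]
          exact fun u hu huv => hMdisj u (hXYM hu) (hMT v u hvT huv)
        omega
    · exact Nat.zero_le _
  obtain ⟨H, hH, hHD, htight⟩ := exists_minimal_degree D hDdeg
  have hHG₀ : H ≤ G₀ := hH.trans hG₁
  have hBL' : ∀ v ∈ B \ Y, v ∈ L' := by
    intro v hv
    rw [Finset.mem_sdiff] at hv
    simp only [hL', Finset.mem_sdiff, Finset.mem_union, not_or]
    exact ⟨(Finset.mem_sdiff.1 (hBM hv.1)).1, ⟨fun h => Finset.disjoint_left.1 hXB h hv.1, hv.2⟩,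
      fun h => hMdisj v (hBM hv.1) (hZT h)⟩
  have hDL' : ∀ v ∈ L', d' ≤ D v := by
    intro v hv
    simp only [D]
    split_ifs
    · exact hd't
    · exact le_rfl
  refine ⟨i, by omega, le_trans (by exact_mod_cast hiN) hN1, H, hHG₀.trans hG₀, ⟨?_, ?_, ?_, ?_⟩,
    ?_⟩
  · rw [isLKS_iff, ← hn_def, ← hd']
    refine hL'card.trans ?_
    exact_mod_cast Finset.card_le_card fun v hv => by
      simp only [Finset.mem_filter, Finset.mem_univ, true_and]
      exact (hDL' v hv).trans (hHD v)
  · intro v w hvw hv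
    have e : (1 + 2 * (η / 2)) * (k : ℝ) = (1 + η) * k := by ring
    rw [e, ← hd] at hv ⊢
    have hvT : v ∉ T := fun h => by
      simp only [hT, Finset.mem_filter, Finset.mem_univ, true_and] at h
      have := degree_mono_graph hHG₀ v
      omega
    have hwT := hMT v w hvT (hHG₀ hvw)
    simp only [hT, Finset.mem_filter, Finset.mem_univ, true_and] at hwT
    rw [← hwT]
    exact degree_mono_graph hHG₀ w
  · intro v w hvw hv
    rw [← hd']
    have hv' : H.degree v < d' := by
      simp only [smallVertices, Finset.mem_filter, Finset.mem_univ, true_and] at hv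
      rw [hd']
      exact Nat.lt_ceil.2 hv
    have hvL' : v ∉ L' := fun h => by
      have := (hDL' v h).trans (hHD v)
      omega
    have hvB : v ∉ B \ Y := fun h => hvL' (hBL' v h)
    have hDv : D v = 0 := by simp only [D, if_neg hvB, if_neg hvL']
    have hvpos : 0 < H.degree v := (H.degree_pos_iff_exists_adj (v := v)).2 ⟨w, hvw⟩
    have hwpos : 0 < H.degree w := (H.degree_pos_iff_exists_adj (v := w)).2 ⟨v, hvw.symm⟩
    rcases htight v w hvw with h | h
    · omega
    · have hwB : w ∉ B \ Y := by
        intro hw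
        rw [Finset.mem_sdiff] at hw
        have hadj := (hG₁adj v w).1 (hH hvw)
        have hvT : v ∈ T := hMT w v (hMdisj w (hBM hw.1)) (hHG₀ hvw.symm)
        refine hvL' ?_
        simp only [hL', Finset.mem_sdiff, Finset.mem_union, not_or]
        have h1 := hadj.2.1
        rw [Finset.mem_union, not_or] at h1
        exact ⟨hTL hvT, h1, fun hz => hadj.2.2.2.2 ⟨hz, hw.1⟩⟩
      simp only [D, if_neg hwB] at h
      split_ifs at h with h1
      · exact h
      · omega
  · have h1 := numEdges_le_sum_of_tight D htight
    have h2 : ∑ v, D v ≤ B.card * t + L.card * d' := by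
      calc ∑ v, D v ≤ ∑ v, ((if v ∈ B then t else 0) + (if v ∈ L then d' else 0)) := by
            refine Finset.sum_le_sum fun v _ => ?_
            simp only [D]
            split_ifs with h1 h2 h3 h4 h5 h6 h7 <;>
              simp only [hL', Finset.mem_sdiff] at * <;> first | omega | tauto
        _ = B.card * t + L.card * d' := by
            rw [Finset.sum_add_distrib, ← Finset.sum_filter, ← Finset.sum_filter]
            simp
    have h3 : ((B.card * t + L.card * d' : ℕ) : ℝ) ≤ (k * Fintype.card V : ℕ) := by
      push_cast
      rw [← hn_def]
      have h4 : (B.card : ℝ) * t ≤ 0.006 * (n * k) := by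
        have h5 : (B.card : ℝ) * t ≤ (B.card : ℝ) * (2 * (Ω (i + 1) * k)) :=
          mul_le_mul_of_nonneg_left (by linarith) (Nat.cast_nonneg _)
        have h6 : 0 ≤ (B.card : ℝ) * (Ω (i + 1) * k) :=
          mul_nonneg (Nat.cast_nonneg _) (by linarith)
        nlinarith only [h5, h6, hBsmall, hEle, hR400]
      have h5 : (L.card : ℝ) * d' ≤ 0.7901 * n * (1.25003 * k) :=
        mul_le_mul (by nlinarith only [hL2', hη1, hηn, hnk, hk0])
          (by nlinarith only [hd'2, hη1, hk0]) (Nat.cast_nonneg _) (by positivity)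
      have h6 : (0 : ℝ) ≤ n * k := by positivity
      linarith
    exact (h1.trans h2).trans (by exact_mod_cast h3)
  · intro v
    by_cases hvB : v ∈ B \ Y
    · right
      have h := hHD v
      simp only [D, if_pos hvB] at h
      exact ht1.trans (by exact_mod_cast h)
    · left
      by_cases hvX : v ∈ X ∪ Y
      · have : H.degree v = 0 := by
          by_contra hne
          obtain ⟨w, hw⟩ := (H.degree_pos_iff_exists_adj (v := v)).1 (Nat.pos_of_ne_zero hne)
          exact ((hG₁adj v w).1 (hH hw)).2.1 hvX
        rw [this]
        exact_mod_cast mul_nonneg (hpos i (by omega)).le (Nat.cast_nonneg (α := ℝ) k)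
      · have hle : (H.degree v : ℝ) ≤ G₀.degree v := by
          exact_mod_cast degree_mono_graph hHG₀ v
        refine hle.trans ?_
        by_contra hcon
        push Not at hcon
        have hvM : v ∈ M := by
          have : (d : ℝ) < G₀.degree v := lt_of_le_of_lt hdΩ hcon
          have : d < G₀.degree v := by exact_mod_cast this
          simp only [hM, hL, hT, Finset.mem_sdiff, Finset.mem_filter, Finset.mem_univ, true_and]
          omega
        rw [Finset.mem_union, not_or] at hvX
        rw [Finset.mem_sdiff] at hvB
        simp only [hX, hB, Finset.mem_filter] at hvX hvB
        by_cases h : Ω (i + 2) * k ≤ (G₀.degree v : ℝ)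
        · exact hvB ⟨⟨hvM, h⟩, hvX.2⟩
        · exact hvX.1 ⟨hvM, hcon, not_le.1 h⟩

end Gap

/-! ### Proportional subsets, closures and subgraphs with exact degrees -/

section Split

variable {V : Type u} [Fintype V] {G : SimpleGraph V}

theorem degInto_eq_card_inter (v : V) (A : Finset V) :
    degInto G v A = ((Finset.univ.filter fun u => G.Adj v u) ∩ A).card := by
  unfold degInto
  congr 1
  ext x
  simp [and_comm]

/-- A subset `D` of `L` of density about `p` that contains about a proportion `p` of the
`L`-neighbours of almost every vertex of `L`. -/
theorem exists_proportional_subset (L : Finset V) {p ζ k : ℝ} (hp0 : 0 ≤ p) (hp1 : p ≤ 1)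
    (hζ : 0 < ζ) (hk : 0 < k) (hL : ∀ a ∈ L, k ≤ (G.degree a : ℝ)) :
    ∃ D ⊆ L, ((D.card : ℝ) - p * L.card) ^ 2 ≤ 2 * Fintype.card V ∧
      ((L.filter fun a => ζ * G.degree a < |(degInto G a D : ℝ) - p * degInto G a L|).card : ℝ) *
        (ζ ^ 2 * k) ≤ 2 * Fintype.card V := by
  let N : Option V → Finset V := fun o =>
    o.elim Finset.univ fun a => Finset.univ.filter fun u => G.Adj a u
  let w : Option V → ℝ := fun o => o.elim 1 fun a => if a ∈ L then 1 / (G.degree a : ℝ) else 0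
  have hw : ∀ i, 0 ≤ w i := by
    rintro (_ | a)
    · exact zero_le_one
    · simp only [w, Option.elim_some]
      split_ifs <;> positivity
  obtain ⟨D, hD, h⟩ := exists_subset_sq_deviation_le L N w hw hp0 hp1
  have hdeg : ∀ a ∈ L, 0 < (G.degree a : ℝ) := fun a ha => hk.trans_le (hL a ha)
  rw [Fintype.sum_option, Fintype.sum_option] at h
  simp only [N, w, Option.elim_none, Option.elim_some, Finset.univ_inter, one_mul,
    ← degInto_eq_card_inter] at h
  have hR : (L.card : ℝ) + ∑ a, (if a ∈ L then 1 / (G.degree a : ℝ) else 0) * degInto G a L ≤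
      2 * Fintype.card V := by
    have h1 : (L.card : ℝ) ≤ Fintype.card V := by exact_mod_cast Finset.card_le_univ L
    have h2 : ∑ a, (if a ∈ L then 1 / (G.degree a : ℝ) else 0) * degInto G a L ≤
        ∑ a : V, (1 : ℝ) := by
      refine Finset.sum_le_sum fun a _ => ?_
      split_ifs with ha
      · rw [one_div_mul_eq_div, div_le_one (hdeg a ha)]
        exact_mod_cast degInto_le_degree a L
      · simp
    rw [Finset.sum_const, Finset.card_univ, nsmul_one] at h2
    linarith
  have hterm : ∀ a, 0 ≤ (if a ∈ L then 1 / (G.degree a : ℝ) else 0) *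
      ((degInto G a D : ℝ) - p * degInto G a L) ^ 2 := by
    intro a
    split_ifs <;> positivity
  have hsum := Finset.sum_nonneg fun a (_ : a ∈ (Finset.univ : Finset V)) => hterm a
  refine ⟨D, hD, by linarith, ?_⟩
  refine le_trans ?_ (le_trans (b := ∑ a, (if a ∈ L then 1 / (G.degree a : ℝ) else 0) *
      ((degInto G a D : ℝ) - p * degInto G a L) ^ 2) ?_ ?_) (b := ∑ a ∈ L.filter fun a =>
      ζ * G.degree a < |(degInto G a D : ℝ) - p * degInto G a L|,
      (if a ∈ L then 1 / (G.degree a : ℝ) else 0) *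
      ((degInto G a D : ℝ) - p * degInto G a L) ^ 2)
  · rw [← nsmul_eq_mul]
    refine Finset.card_nsmul_le_sum _ _ _ fun a ha => ?_
    rw [Finset.mem_filter] at ha
    have h0 := hdeg a ha.1
    rw [if_pos ha.1, one_div_mul_eq_div, le_div_iff₀ h0, ← sq_abs ((degInto G a D : ℝ) - _)]
    have h1 : (ζ * G.degree a) ^ 2 ≤ |(degInto G a D : ℝ) - p * degInto G a L| ^ 2 :=
      pow_le_pow_left₀ (by positivity) ha.2.le 2
    refine le_trans ?_ h1
    have h2 : ζ ^ 2 * k * G.degree a ≤ ζ ^ 2 * G.degree a * G.degree a :=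
      mul_le_mul_of_nonneg_right (mul_le_mul_of_nonneg_left (hL a ha.1) (by positivity)) h0.le
    linarith
  · exact Finset.sum_le_sum_of_subset_of_nonneg (Finset.subset_univ _) fun a _ _ => hterm a
  · have := sq_nonneg ((D.card : ℝ) - p * L.card)
    linarith

omit [Fintype V] in
/-- Among `J` values spaced by `ω > 2 δ`, there is one that is `δ`-close to few values of `f`. -/
theorem exists_uncrowded_value (f : V → ℝ) (M : Finset V) {J : ℕ} (hJ : 0 < J) (c : ℝ) {ω δ : ℝ}
    (hω : 2 * δ < ω) (hδ : 0 ≤ δ) :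
    ∃ j < J, (J : ℝ) * ((M.filter fun v => |f v - (c - j * ω)| ≤ δ).card : ℝ) ≤ M.card := by
  obtain ⟨j, hj, hmin⟩ := Finset.exists_min_image (Finset.range J)
    (fun j : ℕ => (M.filter fun v => |f v - (c - j * ω)| ≤ δ).card) ⟨0, by simpa using hJ⟩
  refine ⟨j, Finset.mem_range.1 hj, ?_⟩
  have h1 := Finset.card_nsmul_le_sum _ _ _ hmin
  have hdisj : ((Finset.range J : Finset ℕ) : Set ℕ).PairwiseDisjoint
      fun j : ℕ => M.filter fun v => |f v - (c - j * ω)| ≤ δ := by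
    intro i _ j _ hij
    rw [Function.onFun, Finset.disjoint_left]
    intro v hi hj
    simp only [Finset.mem_filter] at hi hj
    have hi := abs_le.1 hi.2
    have hj := abs_le.1 hj.2
    have hω0 : 0 < ω := by linarith
    rcases lt_or_gt_of_ne hij with h | h
    · have h2 : (i : ℝ) + 1 ≤ j := by exact_mod_cast h
      nlinarith
    · have h2 : (j : ℝ) + 1 ≤ i := by exact_mod_cast h
      nlinarith
  rw [← Finset.card_biUnion hdisj, Finset.card_range, smul_eq_mul] at h1
  have h2 := h1.trans (Finset.card_le_card (t := M)
    (Finset.biUnion_subset.2 fun j _ => Finset.filter_subset _ _))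
  exact_mod_cast h2

/-- Discarding a few vertices `Z` of `U₀` and a set `C` from the rest of the graph leaves a set
`U = U₀ \ Z` with few neighbours in `C`, while every vertex outside `U ∪ C` has many neighbours
in `U`. Both sets are found by minimising a potential. -/
theorem exists_closure (U₀ : Finset V) {θ κ : ℝ} (hκ : 0 ≤ κ) :
    ∃ Z ⊆ U₀, ∃ C : Finset V, Disjoint (U₀ \ Z) C ∧
      (∀ v ∈ U₀ \ Z, (degInto G v C : ℝ) ≤ θ) ∧
      (∀ s, s ∉ U₀ \ Z → s ∉ C → κ ≤ degInto G s (U₀ \ Z)) ∧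
      θ * (Z.card : ℝ) ≤ κ * Fintype.card V := by
  let F : Finset V × Finset V → ℝ := fun p =>
    θ * p.1.card + ∑ v ∈ U₀ \ p.1, (degInto G v p.2 : ℝ) - κ * p.2.card
  obtain ⟨⟨Z, C⟩, hZC, hmin⟩ := Finset.exists_min_image
    ((Finset.univ : Finset (Finset V × Finset V)).filter fun p =>
      p.1 ⊆ U₀ ∧ Disjoint (U₀ \ p.1) p.2) F ⟨(∅, ∅), by simp⟩
  simp only [Finset.mem_filter, Finset.mem_univ, true_and] at hZC hmin
  obtain ⟨hZ, hC⟩ := hZC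
  refine ⟨Z, hZ, C, hC, ?_, ?_, ?_⟩
  · intro v hv
    have hv' := Finset.mem_sdiff.1 hv
    have hsub : U₀ \ insert v Z = (U₀ \ Z).erase v := by
      ext x; simp only [Finset.mem_sdiff, Finset.mem_insert, Finset.mem_erase]; tauto
    have h := hmin (insert v Z, C) ⟨Finset.insert_subset hv'.1 hZ, by
      rw [hsub]; exact hC.mono_left (Finset.erase_subset _ _)⟩
    simp only [F, hsub, Finset.card_insert_of_notMem hv'.2] at h
    have := Finset.add_sum_erase (U₀ \ Z) (fun v => (degInto G v C : ℝ)) hv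
    push_cast at h
    linarith
  · intro s hsU hsC
    have h := hmin (Z, insert s C) ⟨hZ, by
      rw [Finset.disjoint_insert_right]; exact ⟨hsU, hC⟩⟩
    simp only [F, Finset.card_insert_of_notMem hsC] at h
    have e : ∑ v ∈ U₀ \ Z, (degInto G v (insert s C) : ℝ) =
        ∑ v ∈ U₀ \ Z, (degInto G v C : ℝ) + degInto G s (U₀ \ Z) := by
      have h1 := sum_degInto_comm (G := G) (U₀ \ Z) (insert s C)
      rw [Finset.sum_insert hsC, sum_degInto_comm (G := G) C (U₀ \ Z)] at h1
      have := congrArg (Nat.cast (R := ℝ)) h1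
      push_cast at this
      linarith
    rw [e] at h
    push_cast at h
    linarith
  · have h := hmin (∅, ∅) (by simp)
    simp only [F, Finset.card_empty] at h
    have h0 : ∑ v ∈ U₀ \ ∅, (degInto G v ∅ : ℝ) = 0 :=
      Finset.sum_eq_zero fun v _ => by simp [degInto]
    rw [h0] at h
    have h1 : 0 ≤ ∑ v ∈ U₀ \ Z, (degInto G v C : ℝ) :=
      Finset.sum_nonneg fun _ _ => Nat.cast_nonneg _
    have h2 : (C.card : ℝ) ≤ Fintype.card V := by exact_mod_cast Finset.card_le_univ C
    have h3 := mul_le_mul_of_nonneg_left h2 hκ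
    push_cast at h
    linarith

/-- A subgraph in which the vertices of `U` have degree exactly `d`: they keep their edges to
`U ∪ W`, and each fills up its degree with neighbours from `O`, spread so that every vertex of `O`
receives at least `t` of them. -/
theorem exists_exact_subgraph {U W O : Finset V} (hUO : Disjoint U O)
    (hWO : Disjoint W O) {d t g : ℕ} (hg : 1 ≤ g)
    (hU1 : ∀ a ∈ U, degInto G a (U ∪ W) ≤ d)
    (hU2 : ∀ a ∈ U, d ≤ degInto G a (U ∪ W) + degInto G a O)
    (hU3 : ∀ a ∈ U, degInto G a O ≤ g * (d - degInto G a (U ∪ W)))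
    (hO : ∀ s ∈ O, g * t ≤ degInto G s U) (hW : ∀ w ∈ W, d ≤ degInto G w U)
    (hWW : ∀ w ∈ W, ∀ x ∈ W, ¬ G.Adj w x) :
    ∃ H ≤ G, (∀ a ∈ U, H.degree a = d) ∧ (∀ w ∈ W, d ≤ H.degree w) ∧
      (∀ s ∈ O, t ≤ H.degree s) ∧
      ∀ x y, H.Adj x y → (x ∈ U ∨ y ∈ U) ∧ x ∈ U ∪ W ∪ O := by
  obtain ⟨S, hSJ, hScard, hScap⟩ := exists_selection
    (fun s : V => if s ∈ O then U.filter fun a => G.Adj s a else ∅)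
    (fun s => if s ∈ O then t else 0)
    (fun a => if a ∈ U then d - degInto G a (U ∪ W) else 0) hg
    (by
      intro s
      split_ifs with hs
      · exact hO s hs
      · simp)
    (by
      intro a
      split_ifs with ha
      · refine le_trans (Finset.card_le_card fun s hs => ?_) (hU3 a ha)
        simp only [Finset.mem_filter, Finset.mem_univ, true_and] at hs ⊢
        split_ifs at hs with hsO
        · exact ⟨hsO, (Finset.mem_filter.1 hs).2.symm⟩
        · simp at hs
      · rw [mul_zero, Nat.le_zero, Finset.card_eq_zero, Finset.filter_eq_empty_iff]
        intro s _ hs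
        split_ifs at hs with hsO
        · exact ha (Finset.mem_filter.1 hs).1
        · simp at hs)
  have hpick : ∀ a, ∃ P : Finset V, a ∈ U → (Finset.univ.filter fun s => a ∈ S s) ⊆ P ∧
      P ⊆ O.filter (fun s => G.Adj a s) ∧ P.card = d - degInto G a (U ∪ W) := by
    intro a
    by_cases ha : a ∈ U
    · have h1 := hScap a
      rw [if_pos ha] at h1
      have h2 := hU2 a ha
      have hsub : (Finset.univ.filter fun s => a ∈ S s) ⊆ O.filter (fun s => G.Adj a s) := by
        intro s hs
        simp only [Finset.mem_filter, Finset.mem_univ, true_and] at hs ⊢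
        have h3 := hSJ s hs
        split_ifs at h3 with hsO
        · exact ⟨hsO, (Finset.mem_filter.1 h3).2.symm⟩
        · simp at h3
      obtain ⟨P, hP1, hP2, hP3⟩ := Finset.exists_subsuperset_card_eq hsub h1
        (by unfold degInto at h2 ⊢; omega)
      exact ⟨P, fun _ => ⟨hP1, hP2, hP3⟩⟩
    · exact ⟨∅, fun h => absurd h ha⟩
  choose P hP using hpick
  have hPG : ∀ x ∈ U, ∀ y ∈ P x, y ∈ O ∧ G.Adj x y := fun x hx y hy =>
    Finset.mem_filter.1 ((hP x hx).2.1 hy)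
  obtain ⟨H, hH⟩ : ∃ H : SimpleGraph V, ∀ x y, H.Adj x y ↔
      (G.Adj x y ∧ x ∈ U ∪ W ∧ y ∈ U ∪ W) ∨ (x ∈ U ∧ y ∈ P x) ∨ (y ∈ U ∧ x ∈ P y) :=
    ⟨{ Adj := fun x y => (G.Adj x y ∧ x ∈ U ∪ W ∧ y ∈ U ∪ W) ∨ (x ∈ U ∧ y ∈ P x) ∨
        (y ∈ U ∧ x ∈ P y)
       symm := ⟨fun x y h => h.imp (fun h => ⟨h.1.symm, h.2.2, h.2.1⟩) Or.symm⟩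
       loopless := ⟨fun x h => by
        rcases h with h | h | h
        · exact G.irrefl h.1
        · exact G.irrefl (hPG x h.1 x h.2).2
        · exact G.irrefl (hPG x h.1 x h.2).2⟩ }, fun _ _ => Iff.rfl⟩
  have hUWO : Disjoint (U ∪ W) O := Finset.disjoint_union_left.2 ⟨hUO, hWO⟩
  refine ⟨H, ?_, ?_, ?_, ?_, ?_⟩
  · intro x y h
    rcases (hH x y).1 h with h | h | h
    · exact h.1
    · exact (hPG x h.1 y h.2).2
    · exact (hPG y h.1 x h.2).2.symm
  · intro a ha
    have haO : a ∉ O := Finset.disjoint_left.1 hUO ha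
    have hPO : P a ⊆ O := fun y hy => (hPG a ha y hy).1
    rw [degree_eq_degInto_of_forall (A := (U ∪ W) ∪ P a), degInto_union_of_disjoint _
      (hUWO.mono_right hPO)]
    · have h1 : degInto H a (U ∪ W) = degInto G a (U ∪ W) := by
        refine degInto_congr fun u hu => ?_
        rw [hH]
        have : u ∉ P a := fun h => Finset.disjoint_left.1 hUWO hu (hPO h)
        have h2 : ¬ (u ∈ U ∧ a ∈ P u) := fun h => haO (hPG u h.1 a h.2).1
        have h3 : a ∈ U ∪ W := Finset.mem_union_left _ ha
        tauto
      have h2 : degInto H a (P a) = (P a).card := by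
        unfold degInto
        rw [Finset.filter_true_of_mem]
        exact fun y hy => (hH a y).2 (Or.inr (Or.inl ⟨ha, hy⟩))
      rw [h1, h2, (hP a ha).2.2]
      have := hU1 a ha
      omega
    · intro u hu
      rw [Finset.mem_union]
      rcases (hH a u).1 hu with h | h | h
      · exact Or.inl h.2.2
      · exact Or.inr h.2
      · exact absurd (hPG u h.1 a h.2).1 haO
  · intro w hw
    refine (hW w hw).trans (le_trans (Finset.card_le_card fun u hu => ?_)
      (degInto_le_degree (G := H) w U))
    simp only [Finset.mem_filter] at hu ⊢
    exact ⟨hu.1, (hH w u).2 (Or.inl ⟨hu.2, Finset.mem_union_right _ hw,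
      Finset.mem_union_left _ hu.1⟩)⟩
  · intro s hs
    have h1 := hScard s
    rw [if_pos hs] at h1
    have h0 := hSJ s
    rw [if_pos hs] at h0
    rw [← h1]
    refine le_trans (Finset.card_le_card (t := U.filter fun a => H.Adj s a) fun a ha => ?_)
      (degInto_le_degree (G := H) s U)
    have haU := (Finset.mem_filter.1 (h0 ha)).1
    rw [Finset.mem_filter]
    exact ⟨haU, (hH s a).2 (Or.inr (Or.inr ⟨haU, (hP a haU).1 (by simpa using ha)⟩))⟩
  · intro x y h
    simp only [Finset.mem_union]
    rcases (hH x y).1 h with h | h | h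
    · simp only [Finset.mem_union] at h
      have := hWW x
      have := fun hx hy => hWW x hx y hy h.1
      tauto
    · tauto
    · have := (hPG y h.1 x h.2).1
      tauto

end Split

/-! ### The degree gap for small scales -/

section Split

variable {V : Type u} [Fintype V] {G : SimpleGraph V}

theorem density_bounds {η x : ℝ} (hη0 : 0 < η) (hη1 : η ≤ 1 / 2) (hx0 : 0 ≤ x)
    (hx1 : x ≤ 0.036 * η) {p : ℝ} (hp : p = 0.84 * η / (1 + 2 * η) + x) :
    0 ≤ p ∧ p ≤ 0.24 ∧ p * (1 / 2 + η) ≤ 0.456 * η ∧ 0.42 * η ≤ p * (1 / 2 + η) ∧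
      0.63 * η ≤ p * (1 + η) := by
  have h0 : 0 ≤ 0.84 * η / (1 + 2 * η) := by positivity
  have h1 : 0.84 * η / (1 + 2 * η) * (1 + 2 * η) = 0.84 * η := div_mul_cancel₀ _ (by positivity)
  set p₀ := 0.84 * η / (1 + 2 * η)
  clear_value p₀
  subst hp
  refine ⟨by linarith, ?_, ?_, ?_, ?_⟩
  · nlinarith only [h0, h1, hη0, hη1, hx1]
  · nlinarith only [h1, hη0, hη1, hx0, hx1]
  · nlinarith only [h1, hη0, hx0]
  · nlinarith only [h1, hη0, hη1, hx0, h0]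

set_option maxHeartbeats 4000000 in
/-- When `σ` is tiny, some small LKS subgraph has no nonzero degree below `σ k`.

From the large vertices `L` of an edge-minimal subgraph, a set `D` is deleted that contains about the
proportion `p` of the `L`-neighbours of almost every vertex. For a suitable `p < η`,
the vertices of degree `⌈(1 + η) k⌉` have fewer than `d' = ⌈(1 + η / 2) k⌉` neighbours left in `L`. So
they can be given degree exactly `d'` by selecting some of their edges to the outside, and the
selection can be spread so that every outside vertex is met either at least `σ k` times or
never. -/
theorem exists_small_of_tiny {η : ℝ} (hη0 : 0 < η) (hη1 : η ≤ 1 / 2) {k : ℕ}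
    (hk : 10 ^ 19 ≤ η ^ 7 * k) {σ : ℝ} (hσ0 : 0 < σ) (hσ : σ ≤ η ^ 6 / 10 ^ 14)
    (hG : IsLKS G k η) (hn : k ≤ Fintype.card V) :
    ∃ H ≤ G, IsLKSSmall H k (η / 2) ∧ ∀ v, H.degree v = 0 ∨ σ * k ≤ (H.degree v : ℝ) := by
  set n : ℝ := (Fintype.card V : ℝ) with hn_def
  have hη2 : η ^ 2 ≤ η / 2 := by nlinarith only [hη0, hη1]
  have hη2' : η ^ 2 ≤ 1 / 4 := by nlinarith only [hη0, hη1]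
  have hηp : 0 < η ^ 2 := by positivity
  have hη1' : η ≤ 1 := by linarith
  have hpow : ∀ i, i ≤ 7 → (10 : ℝ) ^ 19 ≤ η ^ i * k := fun i hi =>
    hk.trans (mul_le_mul_of_nonneg_right (pow_le_pow_of_le_one hη0.le hη1' hi) (Nat.cast_nonneg _))
  have hk0 : (10 : ℝ) ^ 19 ≤ k := by simpa using hpow 0 (by norm_num)
  have hηk : (10 : ℝ) ^ 19 ≤ η * k := by simpa using hpow 1 (by norm_num)
  have hη2k := hpow 2 (by norm_num)
  have hη6k := hpow 6 (by norm_num)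
  have hkpos : (0 : ℝ) < k := by linarith
  have hnk : (k : ℝ) ≤ n := Nat.cast_le.2 hn
  have hn0 : 0 ≤ n := by linarith
  have hηn : η * k ≤ η * n := mul_le_mul_of_nonneg_left hnk hη0.le
  have hη2n : η ^ 2 * k ≤ η ^ 2 * n := mul_le_mul_of_nonneg_left hnk hηp.le
  clear_value n
  obtain ⟨ζ, hζ⟩ : ∃ ζ : ℝ, ζ = η ^ 2 / 10 ^ 5 := ⟨_, rfl⟩
  have hζ0 : 0 < ζ := by rw [hζ]; positivity
  have hζη : ζ ≤ 0.000005 * η := by rw [hζ]; linarith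
  have hζk : (10 : ℝ) ^ 14 ≤ ζ * k := by rw [hζ]; linarith
  obtain ⟨d, hd⟩ : ∃ d : ℕ, d = ⌈(1 + η) * (k : ℝ)⌉₊ := ⟨_, rfl⟩
  obtain ⟨d', hd'⟩ : ∃ d' : ℕ, d' = ⌈(1 + η / 2) * (k : ℝ)⌉₊ := ⟨_, rfl⟩
  have hd1 : (1 + η) * k ≤ d := hd ▸ Nat.le_ceil _
  have hd2 : (d : ℝ) < (1 + η) * k + 1 := hd ▸ Nat.ceil_lt_add_one (by positivity)
  have hd'1 : (1 + η / 2) * k ≤ d' := hd' ▸ Nat.le_ceil _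
  have hd'2 : (d' : ℝ) < (1 + η / 2) * k + 1 := hd' ▸ Nat.ceil_lt_add_one (by positivity)
  have hdd : d' ≤ d := hd ▸ hd' ▸ Nat.ceil_le_ceil (by linarith)
  have hd2k : (d : ℝ) ≤ 1.50005 * k := by nlinarith only [hd2, hη1, hk0]
  have hd'2k : (d' : ℝ) ≤ 1.25003 * k := by nlinarith only [hd'2, hη1, hk0]
  have hkd : (k : ℝ) ≤ d := by linarith
  have hd'pos : 0 < d' := hd' ▸ Nat.ceil_pos.2 (by positivity)
  obtain ⟨m, hm⟩ : ∃ m : ℕ, m = ⌈(1 / 2 + η) * n⌉₊ := ⟨_, rfl⟩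
  have hm1 : (1 / 2 + η) * n ≤ m := hm ▸ Nat.le_ceil _
  have hm2 : (m : ℝ) < (1 / 2 + η) * n + 1 :=
    hm ▸ Nat.ceil_lt_add_one (mul_nonneg (by linarith) hn0)
  have hmG : m ≤ (Finset.univ.filter fun v => d ≤ G.degree v).card := by
    have := isLKS_iff.1 hG
    rw [← hd, ← hn_def] at this
    rw [hm]
    exact Nat.ceil_le.2 this
  obtain ⟨G₀, hG₀, hL1, hL2, hedge⟩ := exists_minimal_large (by omega) hmG
  obtain ⟨L, hL⟩ : ∃ L : Finset V, L = Finset.univ.filter fun v => d ≤ G₀.degree v := ⟨_, rfl⟩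
  rw [← hL] at hL1 hL2
  have hLmem : ∀ v, v ∈ L ↔ d ≤ G₀.degree v := fun v => by simp [hL]
  have hedge' : ∀ v u, G₀.degree v ≠ d → G₀.Adj v u → G₀.degree u = d := by
    intro v u hv huv
    have := hedge v u huv
    tauto
  have hL1' : (1 / 2 + η) * n ≤ L.card := hm1.trans (by exact_mod_cast hL1)
  have hL2' : (L.card : ℝ) ≤ (1 / 2 + η) * n + 2 := by
    have : (L.card : ℝ) ≤ m + 1 := by exact_mod_cast hL2
    linarith
  have hLk : ∀ a ∈ L, (k : ℝ) ≤ G₀.degree a := fun a ha =>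
    hkd.trans (by exact_mod_cast (hLmem a).1 ha)
  have hLn : (L.card : ℝ) ≤ n := by rw [hn_def]; exact_mod_cast Finset.card_le_univ L
  -- The density `p` of the deleted part is chosen among `J` values such that `d' / deg v` is close to
  -- `1 - p` for few `v` only; on the other vertices it is clear which of `d'` and `(1 - p) deg v`
  -- is larger.
  obtain ⟨J, hJ⟩ : ∃ J : ℕ, J = ⌈500 / η⌉₊ := ⟨_, rfl⟩
  have hJ1 : 500 / η ≤ J := hJ ▸ Nat.le_ceil _
  have hJ2 : (J : ℝ) < 500 / η + 1 := hJ ▸ Nat.ceil_lt_add_one (by positivity)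
  have hJ0 : 0 < J := hJ ▸ Nat.ceil_pos.2 (by positivity)
  obtain ⟨j, hjJ, hj⟩ := exists_uncrowded_value (fun v => (d' : ℝ) / G₀.degree v) L hJ0
    (1 - 0.84 * η / (1 + 2 * η)) (ω := 7 * ζ) (δ := 3 * ζ) (by linarith) (by linarith)
  obtain ⟨p, hp⟩ : ∃ p : ℝ, p = 0.84 * η / (1 + 2 * η) + j * (7 * ζ) := ⟨_, rfl⟩
  obtain ⟨hp0, hp1, hp2, hp3, hp4⟩ := density_bounds hη0 hη1 (x := j * (7 * ζ)) (by positivity)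
    (by
      have h1 : (j : ℝ) ≤ 500 / η := by
        have : (j : ℝ) + 1 ≤ J := by exact_mod_cast hjJ
        linarith
      have h2 : (j : ℝ) * (7 * ζ) ≤ 500 / η * (7 * ζ) :=
        mul_le_mul_of_nonneg_right h1 (by linarith)
      have h3 : 500 / η * (7 * ζ) = 0.035 * η := by
        rw [hζ]; field_simp; norm_num
      linarith) hp
  obtain ⟨Bd, hBd⟩ : ∃ Bd : Finset V,
      Bd = L.filter fun v => |(d' : ℝ) / G₀.degree v - (1 - p)| ≤ 3 * ζ := ⟨_, rfl⟩
  have hBdcard : (Bd.card : ℝ) ≤ 0.002 * (η * n) := by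
    have e : 1 - 0.84 * η / (1 + 2 * η) - j * (7 * ζ) = 1 - p := by rw [hp]; ring
    simp only [e] at hj
    rw [← hBd] at hj
    have h1 : 500 / η * Bd.card ≤ n :=
      ((mul_le_mul_of_nonneg_right hJ1 (Nat.cast_nonneg _)).trans hj).trans hLn
    have h2 : η * (500 / η * Bd.card) = 500 * Bd.card := by field_simp
    have h3 := mul_le_mul_of_nonneg_left h1 hη0.le
    rw [h2] at h3
    linarith only [h3]
  clear hj hJ1 hJ2 hp
  obtain ⟨D, hDL, hDcard, hBadcard⟩ := exists_proportional_subset (G := G₀) L hp0 (by linarith)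
    hζ0 hkpos hLk
  rw [← hn_def] at hDcard hBadcard
  have hDdev : |(D.card : ℝ) - p * L.card| ≤ 0.001 * (η * n) := by
    refine abs_le_of_sq_le_sq (hDcard.trans ?_) (by positivity)
    have : (10 : ℝ) ^ 19 * n ≤ η ^ 2 * n * n := mul_le_mul_of_nonneg_right (hη2k.trans hη2n) hn0
    nlinarith only [this, hn0]
  have hDdev := abs_le.1 hDdev
  obtain ⟨Bad, hBad⟩ : ∃ Bad : Finset V, Bad = L.filter fun a =>
      ζ * G₀.degree a < |(degInto G₀ a D : ℝ) - p * degInto G₀ a L| := ⟨_, rfl⟩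
  rw [← hBad] at hBadcard
  have hBadcard' : (Bad.card : ℝ) ≤ ζ * (0.001 * (η * n)) := by
    have h1 : 2 ≤ ζ ^ 3 * k * (0.001 * η) := by
      have : ζ ^ 3 * k * (0.001 * η) = η ^ 7 * k / 10 ^ 18 := by rw [hζ]; ring
      rw [this]; linarith
    have h2 : (Bad.card : ℝ) * (ζ ^ 2 * k) ≤ ζ * (0.001 * (η * n)) * (ζ ^ 2 * k) := by
      have := mul_le_mul_of_nonneg_right h1 hn0
      linarith
    exact le_of_mul_le_mul_right h2 (by positivity)
  have hLDcard : ((L \ D).card : ℝ) = L.card - D.card := by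
    rw [Finset.card_sdiff_of_subset hDL, Nat.cast_sub (Finset.card_le_card hDL)]
  have hgood : ∀ a ∈ L, a ∉ Bad →
      (degInto G₀ a (L \ D) : ℝ) ≤ (1 - p + ζ) * G₀.degree a ∧
      (1 - p) * degInto G₀ a L - ζ * G₀.degree a ≤ degInto G₀ a (L \ D) := by
    intro a ha hb
    simp only [hBad, Finset.mem_filter, not_and, not_lt] at hb
    have h1 := abs_le.1 (hb ha)
    have h2 : (degInto G₀ a (L \ D) : ℝ) + degInto G₀ a D = degInto G₀ a L := by
      exact_mod_cast degInto_sdiff_add (G := G₀) a hDL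
    have h3 : (degInto G₀ a L : ℝ) ≤ G₀.degree a := by exact_mod_cast degInto_le_degree a L
    constructor
    · nlinarith only [h1.1, h2, h3, hp1]
    · linarith
  -- Vertices of `U₀` must be topped up with edges to the outside, those of `Mp` have enough
  -- neighbours in `L \ D`.
  obtain ⟨U₀, hU₀⟩ : ∃ U₀ : Finset V, U₀ = ((L \ D) \ Bad).filter fun a =>
    (1 - p + 3 * ζ) * G₀.degree a < d' := ⟨_, rfl⟩
  obtain ⟨Mp, hMp⟩ : ∃ Mp : Finset V, Mp = ((L \ D) \ Bad).filter fun a =>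
    (d' : ℝ) < (1 - p - 3 * ζ) * G₀.degree a := ⟨_, rfl⟩
  have hTlow : (1 - p + 3 * ζ) * d < d' := by
    have h1 : (1 - p) * d ≤ (1 + 0.37 * η) * k + 1 := by
      have h2 := mul_le_mul_of_nonneg_left hd2.le (by linarith : 0 ≤ 1 - p)
      have h3 := mul_le_mul_of_nonneg_right hp4 hkpos.le
      linarith
    have h2 : ζ * d ≤ 0.000005 * η * (1.50005 * k) :=
      mul_le_mul hζη hd2k (Nat.cast_nonneg _) (by positivity)
    linarith
  have hU₀mem : ∀ a ∈ U₀, a ∈ L ∧ (degInto G₀ a (L \ D) : ℝ) + 2 * (ζ * k) ≤ d' ∧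
      (G₀.degree a : ℝ) ≤ 2 * k := by
    intro a ha
    simp only [hU₀, Finset.mem_filter, Finset.mem_sdiff] at ha
    have h1 := (hgood a ha.1.1.1 ha.1.2).1
    have h2 := hLk a ha.1.1.1
    have h3 := mul_le_mul_of_nonneg_left h2 hζ0.le
    have h4 : (0 : ℝ) ≤ G₀.degree a := Nat.cast_nonneg _
    refine ⟨ha.1.1.1, by linarith, ?_⟩
    have h5 := mul_le_mul_of_nonneg_right (by linarith : 0.76 ≤ 1 - p + 3 * ζ) h4
    linarith
  have hMpmem : ∀ a ∈ Mp, a ∈ L ∧ G₀.degree a ≠ d ∧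
      (d' : ℝ) + 2 * (ζ * k) ≤ degInto G₀ a (L \ D) := by
    intro a ha
    simp only [hMp, Finset.mem_filter, Finset.mem_sdiff] at ha
    have h4 : (0 : ℝ) ≤ G₀.degree a := Nat.cast_nonneg _
    have h5 : G₀.degree a ≠ d := by
      intro h
      have h6 := ha.2
      rw [h] at h6 h4
      have := mul_nonneg hζ0.le h4
      linarith
    have h1 := (hgood a ha.1.1.1 ha.1.2).2
    have h2 := mul_le_mul_of_nonneg_left (hLk a ha.1.1.1) hζ0.le
    rw [← degree_eq_degInto_of_forall (A := L) fun u hu => (hLmem u).2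
      (hedge' a u h5 hu).ge] at h1
    refine ⟨ha.1.1.1, h5, by linarith⟩
  -- Outside vertices with few neighbours in `U` are collected in `C` and get isolated; they take
  -- away little degree from the vertices of `U`.
  obtain ⟨Z, hZU, C, hUC, hCdeg, hOdeg, hZcard⟩ := exists_closure (G := G₀) U₀
    (θ := η / 4 * k) (κ := η / 4 * (ζ * (0.005 * η)) * k) (by positivity)
  rw [← hn_def] at hZcard
  have hZcard' : (Z.card : ℝ) ≤ ζ * (0.005 * (η * n)) := by
    have h1 : (η / 4 * k) * Z.card ≤ (η / 4 * k) * (ζ * (0.005 * (η * n))) := by linarith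
    exact le_of_mul_le_mul_left h1 (by positivity)
  obtain ⟨U, hU⟩ : ∃ U : Finset V, U = U₀ \ Z := ⟨_, rfl⟩
  rw [← hU] at hUC hCdeg hOdeg
  have hUU₀ : U ⊆ U₀ := hU ▸ Finset.sdiff_subset
  obtain ⟨W, hW⟩ : ∃ W : Finset V, W = Mp.filter fun a => d' ≤ degInto G₀ a U := ⟨_, rfl⟩
  have hWMp : W ⊆ Mp := hW ▸ Finset.filter_subset _ _
  have hdead : ζ * ((Mp \ W).card : ℝ) ≤ Bad.card + Z.card := by
    obtain ⟨X, hX⟩ : ∃ X : Finset V, X = (Bad ∪ Z).filter fun v => G₀.degree v = d := ⟨_, rfl⟩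
    have hXcard : (X.card : ℝ) ≤ Bad.card + Z.card := by
      have h1 : X.card ≤ (Bad ∪ Z).card := by rw [hX]; exact Finset.card_filter_le _ _
      exact_mod_cast h1.trans (Finset.card_union_le _ _)
    have h1 : ∀ a ∈ Mp \ W, 2 * (ζ * k) ≤ degInto G₀ a X := by
      intro a ha
      rw [Finset.mem_sdiff] at ha
      obtain ⟨_, h2, h3⟩ := hMpmem a ha.1
      have h4 : degInto G₀ a U < d' := by
        have := ha.2
        rw [hW, Finset.mem_filter, not_and, not_le] at this
        exact this ha.1
      have h5 : degInto G₀ a (L \ D) ≤ degInto G₀ a U + degInto G₀ a X := by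
        refine le_trans (Finset.card_le_card fun u hu => ?_) (degInto_union_le a U X)
        rw [Finset.mem_filter] at hu ⊢
        refine ⟨?_, hu.2⟩
        have h6 := hedge' a u h2 hu.2
        simp only [Finset.mem_union, hX, hU, hU₀, Finset.mem_filter, Finset.mem_sdiff]
        have h7 : (1 - p + 3 * ζ) * (G₀.degree u : ℝ) < d' := by rw [h6]; exact hTlow
        have h8 := Finset.mem_sdiff.1 hu.1
        tauto
      have h6 : (degInto G₀ a (L \ D) : ℝ) ≤ degInto G₀ a U + degInto G₀ a X := by
        exact_mod_cast h5
      have h7 : (degInto G₀ a U : ℝ) ≤ d' := by exact_mod_cast h4.le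
      linarith
    have h2 := Finset.card_nsmul_le_sum _ _ _ h1
    rw [nsmul_eq_mul] at h2
    have h3 : ∑ a ∈ Mp \ W, degInto G₀ a X ≤ X.card * d := by
      rw [sum_degInto_comm]
      refine Finset.sum_le_card_nsmul _ _ _ fun x hx => ?_
      have := degInto_le_degree (G := G₀) x (Mp \ W)
      simp only [hX, Finset.mem_filter] at hx
      omega
    have h4 : ((Mp \ W).card : ℝ) * (2 * (ζ * k)) ≤ X.card * d := h2.trans (by exact_mod_cast h3)
    have h5 : (X.card : ℝ) * d ≤ X.card * (2 * k) :=
      mul_le_mul_of_nonneg_left (by linarith) (Nat.cast_nonneg _)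
    have h6 : (2 * (k : ℝ)) * (ζ * ((Mp \ W).card : ℝ)) ≤ (2 * k) * X.card := by linarith
    exact (le_of_mul_le_mul_left h6 (by linarith)).trans hXcard
  have hdead' : ((Mp \ W).card : ℝ) ≤ 0.006 * (η * n) := by
    have h1 : ζ * ((Mp \ W).card : ℝ) ≤ ζ * (0.006 * (η * n)) := by linarith
    exact le_of_mul_le_mul_left h1 hζ0
  have hζ1 : ζ ≤ 0.01 := by linarith
  have hUWL : U ∪ W ⊆ L \ D := by
    refine Finset.union_subset (hUU₀.trans ?_) (hWMp.trans ?_)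
    · rw [hU₀]; exact (Finset.filter_subset _ _).trans Finset.sdiff_subset
    · rw [hMp]; exact (Finset.filter_subset _ _).trans Finset.sdiff_subset
  have hAcard : (1 / 2 + η / 2) * n ≤ ((U ∪ W).card : ℝ) := by
    have hcov : L \ D ⊆ (U ∪ W) ∪ (Bad ∪ Bd ∪ Z ∪ (Mp \ W)) := by
      intro v hv
      have hvL := (Finset.mem_sdiff.1 hv).1
      have hpos : (0 : ℝ) < G₀.degree v := hkpos.trans_le (hLk v hvL)
      have h1 : v ∉ Bad → v ∉ Bd → v ∈ U₀ ∨ v ∈ Mp := by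
        intro h1 h2
        by_contra hcon
        simp only [hU₀, hMp, Finset.mem_filter, not_or, not_and, not_lt] at hcon
        have h3 := hcon.1 (Finset.mem_sdiff.2 ⟨hv, h1⟩)
        have h4 := hcon.2 (Finset.mem_sdiff.2 ⟨hv, h1⟩)
        refine h2 ?_
        rw [hBd, Finset.mem_filter]
        refine ⟨hvL, abs_le.2 ⟨?_, ?_⟩⟩
        · have : 1 - p - 3 * ζ ≤ (d' : ℝ) / G₀.degree v := (le_div_iff₀ hpos).2 h4
          linarith
        · have : (d' : ℝ) / G₀.degree v ≤ 1 - p + 3 * ζ := (div_le_iff₀ hpos).2 h3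
          linarith
      simp only [Finset.mem_union, Finset.mem_sdiff, hU]
      tauto
    have h1 := (Finset.card_le_card hcov).trans (Finset.card_union_le _ _)
    have h2 : (Bad ∪ Bd ∪ Z ∪ (Mp \ W)).card ≤ Bad.card + Bd.card + Z.card + (Mp \ W).card :=
      (Finset.card_union_le _ _).trans (Nat.add_le_add_right ((Finset.card_union_le _ _).trans
        (Nat.add_le_add_right (Finset.card_union_le _ _) _)) _)
    have h3 : ((L \ D).card : ℝ) ≤
        (U ∪ W).card + (Bad.card + Bd.card + Z.card + (Mp \ W).card) := by
      exact_mod_cast h1.trans (Nat.add_le_add_left h2 _)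
    rw [hLDcard] at h3
    have h4 := mul_le_mul_of_nonneg_left hL1' (by linarith : 0 ≤ 1 - p)
    have h5 := mul_le_mul_of_nonneg_right hp2 hn0
    have h6 : 0 ≤ η * n := by positivity
    have h7 := mul_le_mul_of_nonneg_right hζ1 h6
    linarith
  obtain ⟨O, hO⟩ : ∃ O : Finset V, O = Finset.univ \ (U ∪ W ∪ C) := ⟨_, rfl⟩
  have hOmem : ∀ s ∈ O, s ∉ U ∧ s ∉ W ∧ s ∉ C := by
    intro s hs
    simp only [hO, Finset.mem_sdiff, Finset.mem_univ, true_and, Finset.mem_union, not_or] at hs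
    tauto
  obtain ⟨t, ht⟩ : ∃ t : ℕ, t = ⌈σ * k⌉₊ := ⟨_, rfl⟩
  have ht1 : σ * k ≤ t := ht ▸ Nat.le_ceil _
  have ht2 : (t : ℝ) < σ * k + 1 := ht ▸ Nat.ceil_lt_add_one (by positivity)
  obtain ⟨g, hg⟩ : ∃ g : ℕ, g = ⌈1 / ζ⌉₊ := ⟨_, rfl⟩
  have hg1 : 1 / ζ ≤ g := hg ▸ Nat.le_ceil _
  have hg2 : (g : ℝ) < 1 / ζ + 1 := hg ▸ Nat.ceil_lt_add_one (by positivity)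
  have hg0 : 1 ≤ g := hg ▸ Nat.ceil_pos.2 (by positivity)
  have hgζ : 1 ≤ g * ζ := by
    have := mul_le_mul_of_nonneg_right hg1 hζ0.le
    rwa [one_div_mul_cancel hζ0.ne'] at this
  have hgt : (g : ℝ) * t ≤ η / 4 * (ζ * (0.005 * η)) * k := by
    have h1 : ζ * g ≤ 2 := by
      have := mul_le_mul_of_nonneg_left hg2.le hζ0.le
      rw [mul_add, mul_one_div_cancel hζ0.ne'] at this
      linarith
    have h2 : σ * k ≤ η ^ 6 / 10 ^ 14 * k := mul_le_mul_of_nonneg_right hσ hkpos.le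
    have h3 : (t : ℝ) ≤ 1.00001 * (η ^ 6 * k) / 10 ^ 14 := by linarith
    have h4 : ζ * ((g : ℝ) * t) ≤ 2 * (1.00001 * (η ^ 6 * k) / 10 ^ 14) := by
      rw [← mul_assoc]
      exact mul_le_mul h1 h3 (Nat.cast_nonneg _) (by norm_num)
    have h5 : ζ * (η / 4 * (ζ * (0.005 * η)) * k) = 12.5 * (η ^ 6 * k) / 10 ^ 14 := by
      rw [hζ]; ring
    refine le_of_mul_le_mul_left ?_ hζ0
    rw [h5]
    linarith
  have hAdeg : ∀ a ∈ U, (degInto G₀ a (U ∪ W) : ℝ) + 2 * (ζ * k) ≤ d' := by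
    intro a ha
    have h1 := (hU₀mem a (hUU₀ ha)).2.1
    have h2 : (degInto G₀ a (U ∪ W) : ℝ) ≤ degInto G₀ a (L \ D) := by
      exact_mod_cast degInto_mono_set hUWL
    linarith
  have hAdeg' : ∀ a ∈ U, degInto G₀ a (U ∪ W) ≤ d' := by
    intro a ha
    have h1 := hAdeg a ha
    have : (degInto G₀ a (U ∪ W) : ℝ) ≤ d' := by linarith
    exact_mod_cast this
  obtain ⟨H, hHG, hHU, hHW, hHO, hHadj⟩ := exists_exact_subgraph (G := G₀) (U := U) (W := W)
    (O := O) (d := d') (t := t) (g := g)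
    (Finset.disjoint_right.2 fun s hs => (hOmem s hs).1)
    (Finset.disjoint_right.2 fun s hs => (hOmem s hs).2.1) hg0 hAdeg'
    (by
      intro a ha
      have h1 : G₀.degree a ≤ degInto G₀ a (U ∪ W) + degInto G₀ a O + degInto G₀ a C := by
        rw [degree_eq_degInto]
        refine le_trans (degInto_mono_set (B := (U ∪ W) ∪ O ∪ C) fun v _ => ?_)
          ((degInto_union_le _ _ _).trans (Nat.add_le_add_right (degInto_union_le _ _ _) _))
        simp only [hO, Finset.mem_union, Finset.mem_sdiff, Finset.mem_univ, true_and]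
        tauto
      have h2 := hCdeg a ha
      have h3 : (G₀.degree a : ℝ) ≤
          degInto G₀ a (U ∪ W) + degInto G₀ a O + degInto G₀ a C := by exact_mod_cast h1
      have h4 : (d : ℝ) ≤ G₀.degree a := by
        exact_mod_cast (hLmem a).1 (hU₀mem a (hUU₀ ha)).1
      have h5 : (d' : ℝ) ≤ degInto G₀ a (U ∪ W) + degInto G₀ a O := by linarith
      exact_mod_cast h5)
    (by
      intro a ha
      have h1 : (degInto G₀ a O : ℝ) ≤ G₀.degree a := by exact_mod_cast degInto_le_degree a O
      have h2 := (hU₀mem a (hUU₀ ha)).2.2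
      have h3 : (degInto G₀ a O : ℝ) ≤ ((g * (d' - degInto G₀ a (U ∪ W)) : ℕ) : ℝ) := by
        rw [Nat.cast_mul, Nat.cast_sub (hAdeg' a ha)]
        have h4 : (g : ℝ) * (2 * (ζ * k)) ≤ g * ((d' : ℝ) - degInto G₀ a (U ∪ W)) :=
          mul_le_mul_of_nonneg_left (by linarith [hAdeg a ha]) (Nat.cast_nonneg _)
        have h5 := mul_le_mul_of_nonneg_right hgζ hkpos.le
        linarith
      exact_mod_cast h3)
    (by
      intro s hs
      have h1 := hOdeg s (hOmem s hs).1 (hOmem s hs).2.2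
      exact_mod_cast hgt.trans h1)
    (by
      intro w hw
      rw [hW, Finset.mem_filter] at hw
      exact hw.2)
    (by
      intro w hw x hx hwx
      exact (hMpmem x (hWMp hx)).2.1 (hedge' w x (hMpmem w (hWMp hw)).2.1 hwx))
  have hdeg0 : ∀ v, v ∉ U ∪ W ∪ O → H.degree v = 0 := by
    intro v hv
    by_contra hne
    obtain ⟨w, hw⟩ := (H.degree_pos_iff_exists_adj (v := v)).1 (Nat.pos_of_ne_zero hne)
    exact hv (hHadj v w hw).2
  have hbig : ∀ v ∈ U ∪ W, d' ≤ H.degree v := by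
    intro v hv
    rcases Finset.mem_union.1 hv with h | h
    · exact (hHU v h).ge
    · exact hHW v h
  refine ⟨H, hHG.trans hG₀, ⟨?_, ?_, ?_, ?_⟩, ?_⟩
  · rw [isLKS_iff, ← hn_def, ← hd']
    refine hAcard.trans ?_
    exact_mod_cast Finset.card_le_card fun v hv => by
      simp only [Finset.mem_filter, Finset.mem_univ, true_and]
      exact hbig v hv
  · intro v w hvw hv
    have e : (1 + 2 * (η / 2)) * (k : ℝ) = (1 + η) * k := by ring
    rw [e, ← hd] at hv ⊢
    rcases (hHadj v w hvw).1 with h | h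
    · rw [hHU v h] at hv
      omega
    · rw [hHU w h]
      exact hdd
  · intro v w hvw hv
    rw [← hd']
    have hv' : H.degree v < d' := by
      simp only [smallVertices, Finset.mem_filter, Finset.mem_univ, true_and] at hv
      rw [hd']
      exact Nat.lt_ceil.2 hv
    rcases (hHadj v w hvw).1 with h | h
    · have := hHU v h
      omega
    · exact hHU w h
  · have h1 := numEdges_le_sum_degree (G := H) U fun x y hxy => (hHadj x y hxy).1
    rw [Finset.sum_congr rfl fun u hu => hHU u hu, Finset.sum_const, smul_eq_mul] at h1
    have h2 : (U.card : ℝ) ≤ 0.7908 * n := by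
      have h3 : (U.card : ℝ) ≤ (L \ D).card := by
        exact_mod_cast Finset.card_le_card (Finset.subset_union_left.trans hUWL)
      rw [hLDcard] at h3
      have h4 := mul_le_mul_of_nonneg_left hL2' (by linarith : 0 ≤ 1 - p)
      have h5 := mul_le_mul_of_nonneg_right hp3 hn0
      have h6 : η * n ≤ 1 / 2 * n := mul_le_mul_of_nonneg_right hη1 hn0
      linarith
    have h3 : ((U.card * d' : ℕ) : ℝ) ≤ (k * Fintype.card V : ℕ) := by
      push_cast
      rw [← hn_def]
      calc (U.card : ℝ) * d' ≤ 0.7908 * n * (1.25003 * k) :=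
            mul_le_mul h2 hd'2k (Nat.cast_nonneg _) (by positivity)
        _ ≤ k * n := by
            have : 0 ≤ k * n := by positivity
            linarith
    exact h1.trans (by exact_mod_cast h3)
  · intro v
    by_cases hv : v ∈ U ∪ W ∪ O
    · right
      rcases Finset.mem_union.1 hv with h | h
      · have h1 : (d' : ℝ) ≤ H.degree v := by exact_mod_cast hbig v h
        have h2 : σ * k ≤ 1 * k := by
          refine mul_le_mul_of_nonneg_right (hσ.trans ?_) hkpos.le
          have : η ^ 6 ≤ 1 := pow_le_one₀ hη0.le hη1'
          linarith
        have h3 : 0 ≤ η / 2 * k := by positivity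
        linarith
      · exact ht1.trans (by exact_mod_cast hHO v h)
    · exact Or.inl (hdeg0 v hv)

end Split

/-! ### The degree gap -/

section Split

variable {V : Type u} [Fintype V] {G : SimpleGraph V}

theorem IsLKS.le_card [Nonempty V] {k : ℕ} {η : ℝ} (hη0 : 0 < η) (hG : IsLKS G k η) :
    k ≤ Fintype.card V ∧ η ≤ 1 / 2 := by
  have hn : (0 : ℝ) < Fintype.card V := by exact_mod_cast Fintype.card_pos
  unfold IsLKS at hG
  have h1 : ((largeVertices G k η).card : ℝ) ≤ Fintype.card V := by
    exact_mod_cast Finset.card_le_univ _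
  have h2 : (0 : ℝ) < (largeVertices G k η).card := lt_of_lt_of_le (by positivity) hG
  refine ⟨?_, ?_⟩
  · obtain ⟨v, hv⟩ := Finset.card_pos.1 (by exact_mod_cast h2 : 0 < (largeVertices G k η).card)
    simp only [largeVertices, Finset.mem_filter, Finset.mem_univ, true_and] at hv
    have h3 : (k : ℝ) ≤ G.degree v := by nlinarith [Nat.cast_nonneg (α := ℝ) k]
    have h4 : G.degree v < Fintype.card V := G.degree_lt_card_verts v
    have h5 : k ≤ G.degree v := by exact_mod_cast h3
    omega
  · by_contra h
    push Not at h
    nlinarith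

/-- Some small LKS subgraph has no degrees strictly between two consecutive scales. As the scales grow
at least geometrically, either the tenth is at least `2` or the second is tiny. -/
theorem exists_degree_gap [Nonempty V] {η : ℝ} (hη0 : 0 < η) {k : ℕ}
    (hk : 10 ^ 19 ≤ η ^ 7 * k) {Ω : ℕ → ℝ} (hpos : ∀ j, 1 ≤ j → 0 < Ω j)
    (hΩ : ∀ j, 1 ≤ j → Ω j / Ω (j + 1) ≤ η ^ 2 / 100) (hG : IsLKS G k η) :
    ∃ i : ℕ, 1 ≤ i ∧ (i : ℝ) ≤ 100 / η ^ 2 ∧ ∃ H ≤ G, IsLKSSmall H k (η / 2) ∧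
      ∀ v, (H.degree v : ℝ) ≤ Ω i * k ∨ Ω (i + 1) * k ≤ (H.degree v : ℝ) := by
  obtain ⟨hn, hη1⟩ := hG.le_card hη0
  have hη1' : η ≤ 1 := by linarith
  have hΩ' : ∀ j, 1 ≤ j → 100 / η ^ 2 * Ω j ≤ Ω (j + 1) := by
    intro j hj
    have h1 := hΩ j hj
    rw [div_le_div_iff₀ (hpos _ (by omega)) (by norm_num)] at h1
    rw [div_mul_eq_mul_div, div_le_iff₀ (by positivity)]
    linarith
  by_cases h10 : 2 ≤ Ω 10
  · refine exists_gap_of_two_le hη0 hη1 ?_ hpos hΩ' h10 hG hn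
    have h1 : η ^ 7 * k ≤ η ^ 2 * k := mul_le_mul_of_nonneg_right
      (pow_le_pow_of_le_one hη0.le hη1' (by norm_num)) (Nat.cast_nonneg _)
    linarith
  · push Not at h10
    have hη2 : η ^ 2 ≤ 1 / 4 := by nlinarith
    have hR : 400 ≤ 100 / η ^ 2 := by
      rw [le_div_iff₀ (by positivity)]
      linarith
    have h2 : (100 / η ^ 2) ^ 8 * Ω 2 ≤ Ω 10 := by
      have : ∀ r, (100 / η ^ 2) ^ r * Ω 2 ≤ Ω (2 + r) := by
        intro r
        induction r with
        | zero => simp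
        | succ r ih =>
          calc (100 / η ^ 2) ^ (r + 1) * Ω 2 = 100 / η ^ 2 * ((100 / η ^ 2) ^ r * Ω 2) := by ring
            _ ≤ 100 / η ^ 2 * Ω (2 + r) := mul_le_mul_of_nonneg_left ih (by linarith)
            _ ≤ Ω (2 + (r + 1)) := hΩ' (2 + r) (by omega)
      exact this 8
    have hσ : Ω 2 ≤ η ^ 6 / 10 ^ 14 := by
      have h3 : (100 / η ^ 2) ^ 8 * Ω 2 ≤ 2 := by linarith
      have h4 : (100 / η ^ 2) ^ 8 = 10 ^ 16 / η ^ 16 := by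
        rw [div_pow, ← pow_mul]; norm_num
      rw [h4, div_mul_eq_mul_div, div_le_iff₀ (by positivity)] at h3
      have h5 : η ^ 16 ≤ η ^ 6 := pow_le_pow_of_le_one hη0.le hη1' (by norm_num)
      have h6 : 0 ≤ η ^ 6 := by positivity
      linarith
    obtain ⟨H, hH, hsmall, hgap⟩ := exists_small_of_tiny hη0 hη1 hk (hpos 2 (by norm_num)) hσ hG hn
    refine ⟨1, le_rfl, by norm_num; linarith, H, hH, hsmall, fun v => ?_⟩
    refine (hgap v).imp (fun h => ?_) id
    rw [h]
    exact_mod_cast mul_nonneg (hpos 1 le_rfl).le (Nat.cast_nonneg (α := ℝ) k)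

end Split

/-! ### Packings and their energy -/

section Regularity

variable {V : Type u} {G : SimpleGraph V}

/-- The number of ordered pairs `(a, b) ∈ A × B` of adjacent vertices, as a real number. -/
noncomputable def crossEdges (G : SimpleGraph V) (A B : Finset V) : ℝ :=
  ∑ a ∈ A, (degInto G a B : ℝ)

theorem crossEdges_comm (A B : Finset V) : crossEdges G A B = crossEdges G B A := by
  unfold crossEdges
  exact_mod_cast sum_degInto_comm A B

theorem crossEdges_nonneg (A B : Finset V) : 0 ≤ crossEdges G A B :=
  Finset.sum_nonneg fun _ _ => Nat.cast_nonneg _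

theorem crossEdges_le (A B : Finset V) : crossEdges G A B ≤ A.card * B.card := by
  unfold crossEdges
  rw [← nsmul_eq_mul]
  exact Finset.sum_le_card_nsmul _ _ _ fun a _ => by exact_mod_cast degInto_le_card a B

theorem edgeDensity_eq (A B : Finset V) [DecidableRel G.Adj] :
    (G.edgeDensity A B : ℝ) = crossEdges G A B / (A.card * B.card) := by
  rw [SimpleGraph.edgeDensity_def]
  push_cast
  congr 1
  rw [SimpleGraph.interedges_def, Finset.card_filter, Finset.sum_product]
  unfold crossEdges
  simp only [degInto_eq_sum]
  push_cast
  refine Finset.sum_congr rfl fun a _ => Finset.sum_congr rfl fun b _ => ?_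
  split_ifs <;> rfl

theorem crossEdges_biUnion_left {𝒜 : Finset (Finset V)} (h : (𝒜 : Set (Finset V)).PairwiseDisjoint id)
    (B : Finset V) : crossEdges G (𝒜.biUnion id) B = ∑ P ∈ 𝒜, crossEdges G P B :=
  Finset.sum_biUnion h

theorem crossEdges_biUnion {𝒜 𝒬 : Finset (Finset V)}
    (h : (𝒜 : Set (Finset V)).PairwiseDisjoint id) (h' : (𝒬 : Set (Finset V)).PairwiseDisjoint id) :
    crossEdges G (𝒜.biUnion id) (𝒬.biUnion id) = ∑ P ∈ 𝒜, ∑ Q ∈ 𝒬, crossEdges G P Q := by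
  rw [crossEdges_biUnion_left h]
  refine Finset.sum_congr rfl fun P _ => ?_
  rw [crossEdges_comm, crossEdges_biUnion_left h']
  exact Finset.sum_congr rfl fun Q _ => crossEdges_comm _ _

theorem crossEdges_sdiff_left {A A' : Finset V} (h : A' ⊆ A) (B : Finset V) :
    crossEdges G A B = crossEdges G (A \ A') B + crossEdges G A' B :=
  (Finset.sum_sdiff h).symm

/-- Passing to subsets loses few cross edges. -/
theorem crossEdges_le_add {A A' B B' : Finset V} (hA : A' ⊆ A) (hB : B' ⊆ B) :
    crossEdges G A' B' ≤ crossEdges G A B ∧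
      crossEdges G A B ≤ crossEdges G A' B' +
        (((A \ A').card : ℝ) * B.card + A.card * (B \ B').card) := by
  have h1 := crossEdges_sdiff_left (G := G) hA B
  have h2 := crossEdges_sdiff_left (G := G) hB A'
  rw [crossEdges_comm B A', crossEdges_comm B' A', crossEdges_comm (B \ B') A'] at h2
  have h3 := crossEdges_le (G := G) (A \ A') B
  have h4 := crossEdges_le (G := G) A' (B \ B')
  have h5 := crossEdges_nonneg (G := G) (A \ A') B
  have h6 := crossEdges_nonneg (G := G) A' (B \ B')
  have h7 : (A'.card : ℝ) * (B \ B').card ≤ A.card * (B \ B').card :=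
    mul_le_mul_of_nonneg_right (by exact_mod_cast Finset.card_le_card hA) (Nat.cast_nonneg _)
  constructor <;> linarith

/-- A family of disjoint subsets of `C`, all of size `s`. -/
structure IsPacking (𝒜 : Finset (Finset V)) (C : Finset V) (s : ℕ) : Prop where
  subset : ∀ P ∈ 𝒜, P ⊆ C
  card : ∀ P ∈ 𝒜, P.card = s
  disjoint : (𝒜 : Set (Finset V)).PairwiseDisjoint id

theorem IsPacking.biUnion_subset {𝒜 : Finset (Finset V)} {C : Finset V} {s : ℕ}
    (h : IsPacking 𝒜 C s) : 𝒜.biUnion id ⊆ C :=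
  Finset.biUnion_subset.2 h.subset

theorem IsPacking.card_biUnion {𝒜 : Finset (Finset V)} {C : Finset V} {s : ℕ}
    (h : IsPacking 𝒜 C s) : (𝒜.biUnion id).card = 𝒜.card * s := by
  rw [Finset.card_biUnion h.disjoint]
  exact Finset.sum_const_nat fun P hP => h.card P hP

theorem IsPacking.card_mul_le {𝒜 : Finset (Finset V)} {C : Finset V} {s : ℕ}
    (h : IsPacking 𝒜 C s) : 𝒜.card * s ≤ C.card :=
  h.card_biUnion ▸ Finset.card_le_card h.biUnion_subset

theorem IsPacking.filter {𝒜 : Finset (Finset V)} {C : Finset V} {s : ℕ}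
    (h : IsPacking 𝒜 C s) (p : Finset V → Prop) : IsPacking (𝒜.filter p) C s :=
  ⟨fun P hP => h.subset P (Finset.mem_filter.1 hP).1, fun P hP => h.card P (Finset.mem_filter.1 hP).1,
    h.disjoint.subset (by exact_mod_cast Finset.filter_subset _ _)⟩

/-- A maximal packing of `C` by sets that no member of `ℱ` splits leaves few vertices over. -/
theorem exists_pure_packing (C : Finset V) (ℱ : Finset (Finset V)) {s : ℕ} (hs : 1 ≤ s) :
    ∃ 𝒜 : Finset (Finset V), IsPacking 𝒜 C s ∧ (∀ P ∈ 𝒜, ∀ F ∈ ℱ, P ⊆ F ∨ Disjoint P F) ∧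
      (C \ 𝒜.biUnion id).card ≤ 2 ^ ℱ.card * s := by
  obtain ⟨𝒜, h𝒜, hmax⟩ := Finset.exists_max_image
    (C.powerset.powerset.filter fun 𝒜 => IsPacking 𝒜 C s ∧
      ∀ P ∈ 𝒜, ∀ F ∈ ℱ, P ⊆ F ∨ Disjoint P F) Finset.card
    ⟨∅, by
      simp only [Finset.mem_filter, Finset.mem_powerset, Finset.empty_subset, true_and]
      exact ⟨⟨by simp, by simp, by simp⟩, by simp⟩⟩
  rw [Finset.mem_filter] at h𝒜
  refine ⟨𝒜, h𝒜.2.1, h𝒜.2.2, ?_⟩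
  by_contra hcon
  push Not at hcon
  set R := C \ 𝒜.biUnion id with hR
  obtain ⟨τ, hτ, hcard⟩ := Finset.exists_le_card_fiber_of_mul_le_card_of_maps_to
    (s := R) (t := ℱ.powerset) (f := fun x => ℱ.filter fun F => x ∈ F) (n := s)
    (fun x _ => Finset.mem_powerset.2 (Finset.filter_subset _ _)) ⟨∅, by simp⟩
    (by rw [Finset.card_powerset]; exact hcon.le)
  obtain ⟨P, hPsub, hPcard⟩ := Finset.exists_subset_card_eq hcard
  have hPR : P ⊆ R := hPsub.trans (Finset.filter_subset _ _)
  have hPC : P ⊆ C := hPR.trans Finset.sdiff_subset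
  have hPdisj : ∀ Q ∈ 𝒜, Disjoint P Q := by
    intro Q hQ
    rw [Finset.disjoint_left]
    intro x hx hxQ
    exact (Finset.mem_sdiff.1 (hPR hx)).2 (Finset.mem_biUnion.2 ⟨Q, hQ, hxQ⟩)
  have hPne : P ∉ 𝒜 := by
    intro h
    have := hPdisj P h
    rw [disjoint_self, Finset.bot_eq_empty] at this
    rw [this] at hPcard
    simp at hPcard
    omega
  have := hmax (insert P 𝒜) (by
    rw [Finset.mem_filter, Finset.mem_powerset]
    refine ⟨Finset.insert_subset (Finset.mem_powerset.2 hPC) (Finset.mem_powerset.1 h𝒜.1),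
      ⟨?_, ?_, ?_⟩, ?_⟩
    · intro Q hQ
      rcases Finset.mem_insert.1 hQ with rfl | hQ
      · exact hPC
      · exact h𝒜.2.1.subset Q hQ
    · intro Q hQ
      rcases Finset.mem_insert.1 hQ with rfl | hQ
      · exact hPcard
      · exact h𝒜.2.1.card Q hQ
    · rw [Finset.coe_insert]
      exact h𝒜.2.1.disjoint.insert fun Q hQ _ => hPdisj Q hQ
    · intro Q hQ F hF
      rcases Finset.mem_insert.1 hQ with rfl | hQ
      · by_cases hFτ : F ∈ τ
        · left
          intro x hx
          have := (Finset.mem_filter.1 (hPsub hx)).2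
          rw [← this] at hFτ
          exact (Finset.mem_filter.1 hFτ).2
        · right
          rw [Finset.disjoint_left]
          intro x hx hxF
          have := (Finset.mem_filter.1 (hPsub hx)).2
          rw [← this] at hFτ
          exact hFτ (Finset.mem_filter.2 ⟨hF, hxF⟩)
      · exact h𝒜.2.2 Q hQ F hF)
  rw [Finset.card_insert_of_notMem hPne] at this
  omega

/-- The contribution of a pair of packings to the energy: the sum of the squared densities, weighted
by the product of the sizes. -/
noncomputable def pairEnergy (G : SimpleGraph V) (s : ℕ) (𝒜 𝒬 : Finset (Finset V)) : ℝ :=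
  ∑ P ∈ 𝒜, ∑ Q ∈ 𝒬, (crossEdges G P Q / (s * s)) ^ 2 * (s * s)

theorem pairEnergy_le {s : ℕ} {𝒜 𝒬 : Finset (Finset V)} {C C' : Finset V} (h : IsPacking 𝒜 C s)
    (h' : IsPacking 𝒬 C' s) : pairEnergy G s 𝒜 𝒬 ≤ C.card * C'.card := by
  have h1 : pairEnergy G s 𝒜 𝒬 ≤ ∑ P ∈ 𝒜, ∑ Q ∈ 𝒬, ((s : ℝ) * s) := by
    refine Finset.sum_le_sum fun P hP => Finset.sum_le_sum fun Q hQ => ?_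
    have h2 := crossEdges_le (G := G) P Q
    rw [h.card P hP, h'.card Q hQ] at h2
    have h3 : crossEdges G P Q / (s * s) ≤ 1 := div_le_one_of_le₀ h2 (by positivity)
    have h4 : 0 ≤ crossEdges G P Q / (s * s) := div_nonneg (crossEdges_nonneg _ _) (by positivity)
    exact mul_le_of_le_one_left (by positivity) (pow_le_one₀ h4 h3)
  refine h1.trans ?_
  rw [Finset.sum_const, Finset.sum_const, nsmul_eq_mul, nsmul_eq_mul]
  have h2 : (𝒜.card : ℝ) * s ≤ C.card := by exact_mod_cast h.card_mul_le
  have h3 : (𝒬.card : ℝ) * s ≤ C'.card := by exact_mod_cast h'.card_mul_le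
  calc (𝒜.card : ℝ) * (𝒬.card * (s * s)) = (𝒜.card * s) * (𝒬.card * s) := by ring
    _ ≤ _ := mul_le_mul h2 h3 (by positivity) (by positivity)

/-- Refining a pair of sets does not lower the energy by much. If some pair of subsets `D`, `D'`, not
split by the packings, witnesses irregularity, the energy rises. -/
theorem pairEnergy_ge {C C' : Finset V} {s s' : ℕ} (hs : 0 < s) (hs' : 0 < s')
    (hC : C.card = s) (hC' : C'.card = s) {𝒜 𝒬 : Finset (Finset V)} (h𝒜 : IsPacking 𝒜 C s')
    (h𝒬 : IsPacking 𝒬 C' s') {ρ : ℝ} (hρ : ((C \ 𝒜.biUnion id).card : ℝ) ≤ ρ * s)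
    (hρ' : ((C' \ 𝒬.biUnion id).card : ℝ) ≤ ρ * s) :
    (crossEdges G C C' / (s * s)) ^ 2 * (s * s) - 4 * ρ * (s * s) ≤ pairEnergy G s' 𝒜 𝒬 ∧
    ∀ (ε : ℝ) (D D' : Finset V), 0 < ε → 4 * ρ ≤ ε ^ 3 → D ⊆ C → D' ⊆ C' →
      (∀ P ∈ 𝒜, P ⊆ D ∨ Disjoint P D) → (∀ Q ∈ 𝒬, Q ⊆ D' ∨ Disjoint Q D') →
      s * ε ≤ D.card → s * ε ≤ D'.card →
      ε ≤ |(G.edgeDensity D D' : ℝ) - (G.edgeDensity C C' : ℝ)| →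
      (crossEdges G C C' / (s * s)) ^ 2 * (s * s) - 4 * ρ * (s * s) + ε ^ 6 / 4 * (s * s) ≤
        pairEnergy G s' 𝒜 𝒬 := by
  have hsR : (0 : ℝ) < s := by exact_mod_cast hs
  have hsR' : (0 : ℝ) < s' := by exact_mod_cast hs'
  have hρ0 : 0 ≤ ρ := by
    by_contra h
    push Not at h
    have := mul_neg_of_neg_of_pos h hsR
    linarith [Nat.cast_nonneg (α := ℝ) (C \ 𝒜.biUnion id).card]
  set d : ℝ := crossEdges G C C' / (s * s) with hd
  have hds : d * (s * s) = crossEdges G C C' := div_mul_cancel₀ _ (by positivity)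
  have hd0 : 0 ≤ d := div_nonneg (crossEdges_nonneg _ _) (by positivity)
  have hd1 : d ≤ 1 := div_le_one_of_le₀ (by
    have := crossEdges_le (G := G) C C'
    rwa [hC, hC'] at this) (by positivity)
  set g : Finset V → Finset V → ℝ := fun P Q => crossEdges G P Q / (s' * s')
  have hg : ∀ P Q, g P Q * (s' * s') = crossEdges G P Q := fun P Q =>
    div_mul_cancel₀ _ (by positivity)
  have hen : pairEnergy G s' 𝒜 𝒬 = ∑ P ∈ 𝒜, ∑ Q ∈ 𝒬, g P Q ^ 2 * (s' * s') := rfl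
  clear_value g
  have hmain : d ^ 2 * (s * s) - 4 * ρ * (s * s) +
      ∑ P ∈ 𝒜, ∑ Q ∈ 𝒬, (g P Q - d) ^ 2 * (s' * s') ≤ pairEnergy G s' 𝒜 𝒬 := by
    have e1 : pairEnergy G s' 𝒜 𝒬 = ∑ P ∈ 𝒜, ∑ Q ∈ 𝒬, (g P Q - d) ^ 2 * (s' * s') +
        2 * d * crossEdges G (𝒜.biUnion id) (𝒬.biUnion id) -
        d ^ 2 * ((𝒜.card * s') * (𝒬.card * s')) := by
      rw [hen, crossEdges_biUnion h𝒜.disjoint h𝒬.disjoint, Finset.mul_sum]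
      have e2 : d ^ 2 * (((𝒜.card : ℝ) * s') * (𝒬.card * s')) =
          ∑ P ∈ 𝒜, ∑ Q ∈ 𝒬, d ^ 2 * (s' * s') := by
        rw [Finset.sum_const, Finset.sum_const, nsmul_eq_mul, nsmul_eq_mul]; ring
      rw [e2, ← Finset.sum_add_distrib, ← Finset.sum_sub_distrib]
      refine Finset.sum_congr rfl fun P _ => ?_
      rw [Finset.mul_sum, ← Finset.sum_add_distrib, ← Finset.sum_sub_distrib]
      refine Finset.sum_congr rfl fun Q _ => ?_
      rw [← hg P Q]
      ring
    have h1 := (crossEdges_le_add (G := G) h𝒜.biUnion_subset h𝒬.biUnion_subset).2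
    rw [hC, hC', ← hds] at h1
    have h2 : (𝒜.card : ℝ) * s' ≤ s := by exact_mod_cast hC ▸ h𝒜.card_mul_le
    have h3 : (𝒬.card : ℝ) * s' ≤ s := by exact_mod_cast hC' ▸ h𝒬.card_mul_le
    have h4 : (𝒜.card * s') * (𝒬.card * s') ≤ (s : ℝ) * s :=
      mul_le_mul h2 h3 (by positivity) (by positivity)
    have h5 : d * (s * s) - 2 * ρ * (s * s) ≤
        crossEdges G (𝒜.biUnion id) (𝒬.biUnion id) := by
      have h6 := mul_le_mul_of_nonneg_right hρ hsR.le
      have h7 := mul_le_mul_of_nonneg_right hρ' hsR.le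
      linarith
    have h8 := mul_le_mul_of_nonneg_left h5 (by linarith : 0 ≤ 2 * d)
    have h9 := mul_le_mul_of_nonneg_left h4 (sq_nonneg d)
    have h10 : d * (4 * ρ * (s * s)) ≤ 1 * (4 * ρ * (s * s)) :=
      mul_le_mul_of_nonneg_right hd1 (by positivity)
    rw [e1]
    linarith
  refine ⟨?_, ?_⟩
  · have : 0 ≤ ∑ P ∈ 𝒜, ∑ Q ∈ 𝒬, (g P Q - d) ^ 2 * (s' * s') :=
      Finset.sum_nonneg fun _ _ => Finset.sum_nonneg fun _ _ => by positivity
    linarith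
  · intro ε D D' hε hρε hD hD' hpure hpure' hcD hcD' hdens
    have hsub : ∑ P ∈ 𝒜.filter (· ⊆ D), ∑ Q ∈ 𝒬.filter (· ⊆ D'), (g P Q - d) ^ 2 * (s' * s') ≤
        ∑ P ∈ 𝒜, ∑ Q ∈ 𝒬, (g P Q - d) ^ 2 * (s' * s') := by
      refine (Finset.sum_le_sum fun P _ => Finset.sum_le_sum_of_subset_of_nonneg
        (Finset.filter_subset _ _) fun _ _ _ => by positivity).trans
        (Finset.sum_le_sum_of_subset_of_nonneg (Finset.filter_subset _ _) fun _ _ _ =>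
          Finset.sum_nonneg fun _ _ => by positivity)
    set 𝒜₁ := 𝒜.filter (· ⊆ D) with h𝒜₁
    set 𝒬₁ := 𝒬.filter (· ⊆ D') with h𝒬₁
    have hp1 : IsPacking 𝒜₁ D s' := ⟨fun P hP => (Finset.mem_filter.1 hP).2,
      fun P hP => h𝒜.card P (Finset.mem_filter.1 hP).1,
      h𝒜.disjoint.subset (by exact_mod_cast Finset.filter_subset _ _)⟩
    have hq1 : IsPacking 𝒬₁ D' s' := ⟨fun P hP => (Finset.mem_filter.1 hP).2,
      fun P hP => h𝒬.card P (Finset.mem_filter.1 hP).1,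
      h𝒬.disjoint.subset (by exact_mod_cast Finset.filter_subset _ _)⟩
    have hr : ((D \ 𝒜₁.biUnion id).card : ℝ) ≤ ρ * s := by
      refine le_trans ?_ hρ
      exact_mod_cast Finset.card_le_card fun x hx => by
        rw [Finset.mem_sdiff] at hx ⊢
        refine ⟨hD hx.1, fun h => hx.2 ?_⟩
        rw [Finset.mem_biUnion] at h ⊢
        obtain ⟨P, hP, hxP⟩ := h
        refine ⟨P, Finset.mem_filter.2 ⟨hP, (hpure P hP).resolve_right fun h => ?_⟩, hxP⟩
        exact Finset.disjoint_left.1 h hxP hx.1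
    have hr' : ((D' \ 𝒬₁.biUnion id).card : ℝ) ≤ ρ * s := by
      refine le_trans ?_ hρ'
      exact_mod_cast Finset.card_le_card fun x hx => by
        rw [Finset.mem_sdiff] at hx ⊢
        refine ⟨hD' hx.1, fun h => hx.2 ?_⟩
        rw [Finset.mem_biUnion] at h ⊢
        obtain ⟨P, hP, hxP⟩ := h
        refine ⟨P, Finset.mem_filter.2 ⟨hP, (hpure' P hP).resolve_right fun h => ?_⟩, hxP⟩
        exact Finset.disjoint_left.1 h hxP hx.1
    have hDs : (D.card : ℝ) ≤ s := by exact_mod_cast hC ▸ Finset.card_le_card hD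
    have hDs' : (D'.card : ℝ) ≤ s := by exact_mod_cast hC' ▸ Finset.card_le_card hD'
    have hDpos : (0 : ℝ) < D.card := lt_of_lt_of_le (by positivity) hcD
    have hDpos' : (0 : ℝ) < D'.card := lt_of_lt_of_le (by positivity) hcD'
    -- the total deviation over the pieces inside `D × D'`
    set S : ℝ := ∑ P ∈ 𝒜₁, ∑ Q ∈ 𝒬₁, (g P Q - d) * (s' * s') with hS
    have hSeq : S = crossEdges G (𝒜₁.biUnion id) (𝒬₁.biUnion id) -
        d * ((𝒜₁.biUnion id).card * (𝒬₁.biUnion id).card) := by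
      rw [hp1.card_biUnion, hq1.card_biUnion, crossEdges_biUnion hp1.disjoint hq1.disjoint]
      have e2 : d * (((𝒜₁.card * s' : ℕ) : ℝ) * ((𝒬₁.card * s' : ℕ) : ℝ)) =
          ∑ P ∈ 𝒜₁, ∑ Q ∈ 𝒬₁, d * (s' * s') := by
        rw [Finset.sum_const, Finset.sum_const, nsmul_eq_mul, nsmul_eq_mul]; push_cast; ring
      rw [e2, hS, ← Finset.sum_sub_distrib]
      refine Finset.sum_congr rfl fun P _ => ?_
      rw [← Finset.sum_sub_distrib]
      refine Finset.sum_congr rfl fun Q _ => ?_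
      rw [← hg P Q]
      ring
    have hSabs : ε ^ 3 / 2 * (s * s) ≤ |S| := by
      have h1 := crossEdges_le_add (G := G) hp1.biUnion_subset hq1.biUnion_subset
      have hcp : ((𝒜₁.biUnion id).card : ℝ) = D.card - (D \ 𝒜₁.biUnion id).card := by
        rw [Finset.card_sdiff_of_subset hp1.biUnion_subset,
          Nat.cast_sub (Finset.card_le_card hp1.biUnion_subset)]
        ring
      have hcq : ((𝒬₁.biUnion id).card : ℝ) = D'.card - (D' \ 𝒬₁.biUnion id).card := by
        rw [Finset.card_sdiff_of_subset hq1.biUnion_subset,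
          Nat.cast_sub (Finset.card_le_card hq1.biUnion_subset)]
        ring
      set r : ℝ := ((D \ 𝒜₁.biUnion id).card : ℝ)
      set r' : ℝ := ((D' \ 𝒬₁.biUnion id).card : ℝ)
      have hr0 : 0 ≤ r := Nat.cast_nonneg _
      have hr0' : 0 ≤ r' := Nat.cast_nonneg _
      have hcq0 : (0 : ℝ) ≤ (𝒬₁.biUnion id).card := Nat.cast_nonneg _
      rw [hcq] at hcq0
      have hdev : ε ^ 3 * (s * s) ≤ |crossEdges G D D' - d * (D.card * D'.card)| := by
        rw [edgeDensity_eq, edgeDensity_eq, hC, hC', ← hd] at hdens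
        have h2 : crossEdges G D D' - d * (D.card * D'.card) =
            (crossEdges G D D' / (D.card * D'.card) - d) * (D.card * D'.card) := by
          rw [sub_mul, div_mul_cancel₀ _ (by positivity)]
        rw [h2, abs_mul, abs_of_pos (by positivity : (0 : ℝ) < D.card * D'.card)]
        calc ε ^ 3 * (s * s) = ε * ((s * ε) * (s * ε)) := by ring
          _ ≤ _ := mul_le_mul hdens (mul_le_mul hcD hcD' (by positivity) (by positivity))
              (by positivity) (abs_nonneg _)
      have hloss : r * D'.card + D.card * r' ≤ 2 * ρ * (s * s) := by
        have h2 : r * D'.card ≤ ρ * s * s := mul_le_mul hr hDs' (by positivity) (by positivity)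
        have h3 : D.card * r' ≤ s * (ρ * s) := mul_le_mul hDs hr' hr0' (by positivity)
        linarith
      have h3 : |crossEdges G D D' - d * (D.card * D'.card) - S| ≤ 2 * ρ * (s * s) := by
        rw [hSeq, hcp, hcq]
        have h4 : 0 ≤ D.card * (D'.card : ℝ) - (D.card - r) * (D'.card - r') ∧
            D.card * (D'.card : ℝ) - (D.card - r) * (D'.card - r') ≤
              r * D'.card + D.card * r' := by
          constructor
          · nlinarith only [mul_nonneg hr0 hcq0, mul_nonneg hDpos.le hr0']
          · nlinarith only [mul_nonneg hr0 hr0']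
        have h5 : 0 ≤ d * (D.card * (D'.card : ℝ) - (D.card - r) * (D'.card - r')) :=
          mul_nonneg hd0 h4.1
        have h6 : d * (D.card * (D'.card : ℝ) - (D.card - r) * (D'.card - r')) ≤
            1 * (D.card * (D'.card : ℝ) - (D.card - r) * (D'.card - r')) :=
          mul_le_mul_of_nonneg_right hd1 h4.1
        rw [abs_le]
        constructor <;> linarith [h1.1, h1.2]
      have h4 := abs_sub_abs_le_abs_sub (crossEdges G D D' - d * (D.card * D'.card)) S
      have h5 : 4 * ρ * (s * s) ≤ ε ^ 3 * (s * s) :=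
        mul_le_mul_of_nonneg_right hρε (by positivity)
      linarith
    -- Cauchy–Schwarz
    have hCS : S ^ 2 ≤ (s * s) * ∑ P ∈ 𝒜₁, ∑ Q ∈ 𝒬₁, (g P Q - d) ^ 2 * (s' * s') := by
      have h1 := Finset.sum_mul_sq_le_sq_mul_sq (𝒜₁ ×ˢ 𝒬₁) (fun p => (g p.1 p.2 - d) * s')
        (fun _ => (s' : ℝ))
      have e1 : ∑ p ∈ 𝒜₁ ×ˢ 𝒬₁, (g p.1 p.2 - d) * s' * s' = S := by
        rw [hS, Finset.sum_product]
        exact Finset.sum_congr rfl fun P _ => Finset.sum_congr rfl fun Q _ => by ring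
      have e2 : ∑ p ∈ 𝒜₁ ×ˢ 𝒬₁, ((g p.1 p.2 - d) * s') ^ 2 =
          ∑ P ∈ 𝒜₁, ∑ Q ∈ 𝒬₁, (g P Q - d) ^ 2 * (s' * s') := by
        rw [Finset.sum_product]
        exact Finset.sum_congr rfl fun P _ => Finset.sum_congr rfl fun Q _ => by ring
      have e3 : ∑ p ∈ 𝒜₁ ×ˢ 𝒬₁, (s' : ℝ) ^ 2 ≤ s * s := by
        rw [Finset.sum_const, Finset.card_product, nsmul_eq_mul]
        have h2 : (𝒜₁.card : ℝ) * s' ≤ s :=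
          le_trans (by exact_mod_cast hp1.card_mul_le) hDs
        have h3 : (𝒬₁.card : ℝ) * s' ≤ s :=
          le_trans (by exact_mod_cast hq1.card_mul_le) hDs'
        push_cast
        calc (𝒜₁.card : ℝ) * 𝒬₁.card * s' ^ 2 = (𝒜₁.card * s') * (𝒬₁.card * s') := by ring
          _ ≤ _ := mul_le_mul h2 h3 (by positivity) (by positivity)
      rw [e1, e2] at h1
      refine h1.trans ?_
      rw [mul_comm]
      refine mul_le_mul_of_nonneg_right e3 (Finset.sum_nonneg fun _ _ =>
        Finset.sum_nonneg fun _ _ => by positivity)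
    have hgain : ε ^ 6 / 4 * (s * s) ≤
        ∑ P ∈ 𝒜₁, ∑ Q ∈ 𝒬₁, (g P Q - d) ^ 2 * (s' * s') := by
      have h1 : (ε ^ 3 / 2 * (s * s)) ^ 2 ≤ S ^ 2 := by
        rw [← sq_abs S]
        exact pow_le_pow_left₀ (by positivity) hSabs 2
      have h2 : (s * s : ℝ) * (ε ^ 6 / 4 * (s * s)) ≤
          (s * s) * ∑ P ∈ 𝒜₁, ∑ Q ∈ 𝒬₁, (g P Q - d) ^ 2 * (s' * s') := by
        refine le_trans (le_of_eq ?_) (h1.trans hCS)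
        ring
      exact le_of_mul_le_mul_left h2 (by positivity)
    linarith

end Regularity

/-! ### Regularity for patterns of bounded degree -/

section Regularity

variable {V : Type u} {G : SimpleGraph V} {ι : Type u}

/-- The energy of a family of packings: the contributions of the pairs of cells in `E`. -/
noncomputable def energy (G : SimpleGraph V) (E : Finset (ι × ι)) (s : ℕ)
    (P : ι → Finset (Finset V)) : ℝ :=
  ∑ e ∈ E, pairEnergy G s (P e.1) (P e.2)

/-- The number of irregular pairs of pieces that lie in pairs of cells belonging to `E`. -/
noncomputable def numIrregular (G : SimpleGraph V) (E : Finset (ι × ι)) (ε : ℝ)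
    (P : ι → Finset (Finset V)) : ℕ :=
  ∑ e ∈ E, ((P e.1 ×ˢ P e.2).filter fun p => ¬ G.IsUniform ε p.1 p.2).card

theorem IsPacking.bind {𝒜 : Finset (Finset V)} {X : Finset V} {s s' : ℕ} (h : IsPacking 𝒜 X s)
    {𝒬 : Finset V → Finset (Finset V)} (h𝒬 : ∀ C ∈ 𝒜, IsPacking (𝒬 C) C s') :
    IsPacking (𝒜.biUnion 𝒬) X s' := by
  refine ⟨fun P hP => ?_, fun P hP => ?_, ?_⟩
  · obtain ⟨C, hC, hP⟩ := Finset.mem_biUnion.1 hP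
    exact ((h𝒬 C hC).subset P hP).trans (h.subset C hC)
  · obtain ⟨C, hC, hP⟩ := Finset.mem_biUnion.1 hP
    exact (h𝒬 C hC).card P hP
  · intro P hP Q hQ hPQ
    obtain ⟨C, hC, hP⟩ := Finset.mem_biUnion.1 (Finset.mem_coe.1 hP)
    obtain ⟨C', hC', hQ⟩ := Finset.mem_biUnion.1 (Finset.mem_coe.1 hQ)
    by_cases hCC : C = C'
    · subst hCC
      exact (h𝒬 C hC).disjoint hP hQ hPQ
    · exact (h.disjoint hC hC' hCC).mono ((h𝒬 C hC).subset P hP) ((h𝒬 C' hC').subset Q hQ)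

theorem IsPacking.pairwiseDisjoint_bind {𝒜 : Finset (Finset V)} {X : Finset V} {s s' : ℕ}
    (h : IsPacking 𝒜 X s) (hs' : 1 ≤ s') {𝒬 : Finset V → Finset (Finset V)}
    (h𝒬 : ∀ C ∈ 𝒜, IsPacking (𝒬 C) C s') : (𝒜 : Set (Finset V)).PairwiseDisjoint 𝒬 := by
  intro C hC C' hC' hCC
  rw [Function.onFun, Finset.disjoint_left]
  intro P hP hP'
  have h1 := (h.disjoint hC hC' hCC).mono ((h𝒬 C hC).subset P hP) ((h𝒬 C' hC').subset P hP')
  have h2 := (h𝒬 C hC).card P hP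
  rw [disjoint_self, Finset.bot_eq_empty] at h1
  subst h1
  simp at h2
  omega

theorem pairEnergy_bind {𝒜 𝒞 : Finset (Finset V)} {X Y : Finset V} {s s' : ℕ}
    (h : IsPacking 𝒜 X s) (h' : IsPacking 𝒞 Y s) (hs' : 1 ≤ s')
    {𝒬 ℛ : Finset V → Finset (Finset V)} (h𝒬 : ∀ C ∈ 𝒜, IsPacking (𝒬 C) C s')
    (hℛ : ∀ C ∈ 𝒞, IsPacking (ℛ C) C s') :
    pairEnergy G s' (𝒜.biUnion 𝒬) (𝒞.biUnion ℛ) =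
      ∑ C ∈ 𝒜, ∑ C' ∈ 𝒞, pairEnergy G s' (𝒬 C) (ℛ C') := by
  unfold pairEnergy
  rw [Finset.sum_biUnion (h.pairwiseDisjoint_bind hs' h𝒬)]
  refine Finset.sum_congr rfl fun C _ => ?_
  rw [eq_comm, Finset.sum_comm]
  refine Finset.sum_congr rfl fun P _ => ?_
  rw [Finset.sum_biUnion (h'.pairwiseDisjoint_bind hs' hℛ)]

/-- One step of the energy increment argument: the pieces are split along the witnesses of all
irregular pairs and repacked with sets of a smaller common size. -/
theorem exists_refinement_step {X : ι → Finset V} {E : Finset (ι × ι)} {s₀ s s' q M : ℕ}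
    {P : ι → Finset (Finset V)} (hX : ∀ i, (X i).card = s₀) (hP : ∀ i, IsPacking (P i) (X i) s)
    (hE₁ : ∀ i, (E.filter fun e => e.1 = i).card ≤ q)
    (hE₂ : ∀ i, (E.filter fun e => e.2 = i).card ≤ q) (hPM : ∀ i, (P i).card ≤ M)
    {ε ρ : ℝ} (hε : 0 < ε) (hs : 0 < s) (hs' : 1 ≤ s') (hρ : 2 ^ (2 * q * M) * (s' : ℝ) ≤ ρ * s)
    (hρε : 4 * ρ ≤ ε ^ 3) :
    ∃ P' : ι → Finset (Finset V), (∀ i, IsPacking (P' i) (X i) s') ∧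
      (∀ i, ((X i \ (P' i).biUnion id).card : ℝ) ≤ (X i \ (P i).biUnion id).card + ρ * s₀) ∧
      energy G E s P - 4 * ρ * (E.card * (s₀ * s₀)) +
        ε ^ 6 / 4 * (numIrregular G E ε P * (s * s)) ≤ energy G E s' P' := by
  let ℱ : ι → Finset V → Finset (Finset V) := fun i C =>
    (E.filter fun e => e.1 = i).biUnion
      (fun e => (P e.2).image fun C' => (G.nonuniformWitnesses ε C C').1) ∪
    (E.filter fun e => e.2 = i).biUnion
      (fun e => (P e.1).image fun C' => (G.nonuniformWitnesses ε C' C).2)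
  have hℱcard : ∀ i C, (ℱ i C).card ≤ 2 * q * M := by
    intro i C
    refine (Finset.card_union_le _ _).trans ?_
    have h1 : ∀ (A : Finset (ι × ι)) (f : ι × ι → Finset (Finset V)), A.card ≤ q →
        (∀ e, (f e).card ≤ M) → (A.biUnion f).card ≤ q * M := fun A f hA hf =>
      (Finset.card_biUnion_le_card_mul _ _ _ fun e _ => hf e).trans (Nat.mul_le_mul_right _ hA)
    have h2 := h1 _ (fun e => (P e.2).image fun C' => (G.nonuniformWitnesses ε C C').1) (hE₁ i)
      fun e => Finset.card_image_le.trans (hPM e.2)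
    have h3 := h1 _ (fun e => (P e.1).image fun C' => (G.nonuniformWitnesses ε C' C).2) (hE₂ i)
      fun e => Finset.card_image_le.trans (hPM e.1)
    linarith
  choose 𝒬 h𝒬pack h𝒬pure h𝒬left using fun i C => exists_pure_packing C (ℱ i C) hs'
  have hρ0 : 0 ≤ ρ := by
    have h1 : (0 : ℝ) < s := by exact_mod_cast hs
    by_contra h
    push Not at h
    have h2 := mul_neg_of_neg_of_pos h h1
    have h3 : (0 : ℝ) ≤ 2 ^ (2 * q * M) * (s' : ℝ) := by positivity
    linarith
  have hleft : ∀ i C, ((C \ (𝒬 i C).biUnion id).card : ℝ) ≤ ρ * s := by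
    intro i C
    refine le_trans ?_ hρ
    have h1 : (C \ (𝒬 i C).biUnion id).card ≤ 2 ^ (2 * q * M) * s' :=
      (h𝒬left i C).trans (Nat.mul_le_mul_right _ (Nat.pow_le_pow_right (by norm_num) (hℱcard i C)))
    exact_mod_cast h1
  have hcardR : ∀ i, ((P i).card : ℝ) * s ≤ s₀ := fun i => by
    exact_mod_cast hX i ▸ (hP i).card_mul_le
  refine ⟨fun i => (P i).biUnion (𝒬 i), fun i => (hP i).bind fun C _ => h𝒬pack i C, ?_, ?_⟩
  · intro i
    have hsub : X i \ ((P i).biUnion (𝒬 i)).biUnion id ⊆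
        (X i \ (P i).biUnion id) ∪ (P i).biUnion fun C => C \ (𝒬 i C).biUnion id := by
      intro x hx
      rw [Finset.mem_sdiff, Finset.biUnion_biUnion] at hx
      rw [Finset.mem_union, Finset.mem_sdiff]
      by_cases h : x ∈ (P i).biUnion id
      · right
        obtain ⟨C, hC, hxC⟩ := Finset.mem_biUnion.1 h
        exact Finset.mem_biUnion.2 ⟨C, hC, Finset.mem_sdiff.2 ⟨hxC, fun h' =>
          hx.2 (Finset.mem_biUnion.2 ⟨C, hC, h'⟩)⟩⟩
      · exact Or.inl ⟨hx.1, h⟩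
    have h1 := (Finset.card_le_card hsub).trans (Finset.card_union_le _ _)
    have h2 : ((X i \ ((P i).biUnion (𝒬 i)).biUnion id).card : ℝ) ≤
        (X i \ (P i).biUnion id).card + ((P i).biUnion fun C => C \ (𝒬 i C).biUnion id).card := by
      exact_mod_cast h1
    have h3 : (((P i).biUnion fun C => C \ (𝒬 i C).biUnion id).card : ℝ) ≤
        ∑ C ∈ P i, ((C \ (𝒬 i C).biUnion id).card : ℝ) := by
      exact_mod_cast Finset.card_biUnion_le
    have h4 : ∑ C ∈ P i, ((C \ (𝒬 i C).biUnion id).card : ℝ) ≤ (P i).card * (ρ * s) := by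
      rw [← nsmul_eq_mul]
      exact Finset.sum_le_card_nsmul _ _ _ fun C _ => hleft i C
    have h5 := mul_le_mul_of_nonneg_left (hcardR i) hρ0
    linarith
  · have hpair : ∀ e ∈ E, pairEnergy G s (P e.1) (P e.2) - 4 * ρ * (s₀ * s₀) + ε ^ 6 / 4 *
        ((((P e.1 ×ˢ P e.2).filter fun p => ¬ G.IsUniform ε p.1 p.2).card : ℝ) * (s * s)) ≤
        pairEnergy G s' ((P e.1).biUnion (𝒬 e.1)) ((P e.2).biUnion (𝒬 e.2)) := by
      intro e he
      rw [pairEnergy_bind (hP e.1) (hP e.2) hs' (fun C _ => h𝒬pack e.1 C)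
        (fun C _ => h𝒬pack e.2 C)]
      have hone : ∀ C ∈ P e.1, ∀ C' ∈ P e.2,
          (crossEdges G C C' / (s * s)) ^ 2 * (s * s) - 4 * ρ * (s * s) +
            (if ¬ G.IsUniform ε C C' then ε ^ 6 / 4 * (s * s) else 0) ≤
          pairEnergy G s' (𝒬 e.1 C) (𝒬 e.2 C') := by
        intro C hC C' hC'
        obtain ⟨h1, h2⟩ := pairEnergy_ge (G := G) hs hs' ((hP e.1).card C hC)
          ((hP e.2).card C' hC') (h𝒬pack e.1 C) (h𝒬pack e.2 C') (hleft e.1 C) (hleft e.2 C')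
        split_ifs with hirr
        · rw [add_zero]; exact h1
        · have hl := G.left_nonuniformWitnesses_card hirr
          have hr := G.right_nonuniformWitnesses_card hirr
          rw [(hP e.1).card C hC] at hl
          rw [(hP e.2).card C' hC'] at hr
          refine h2 ε _ _ hε hρε (G.left_nonuniformWitnesses_subset hirr)
            (G.right_nonuniformWitnesses_subset hirr) (fun A hA => h𝒬pure e.1 C A hA _ ?_)
            (fun A hA => h𝒬pure e.2 C' A hA _ ?_) hl hr
            (by simpa only [Rat.cast_abs, Rat.cast_sub] using G.nonuniformWitnesses_spec hirr)
          · exact Finset.mem_union_left _ (Finset.mem_biUnion.2 ⟨e,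
              Finset.mem_filter.2 ⟨he, rfl⟩, Finset.mem_image_of_mem _ hC'⟩)
          · exact Finset.mem_union_right _ (Finset.mem_biUnion.2 ⟨e,
              Finset.mem_filter.2 ⟨he, rfl⟩, Finset.mem_image_of_mem
                (fun C'' => (G.nonuniformWitnesses ε C'' C').2) hC⟩)
      have hsum := Finset.sum_le_sum fun C hC => Finset.sum_le_sum fun C' hC' => hone C hC C' hC'
      refine le_trans ?_ hsum
      simp only [Finset.sum_add_distrib, Finset.sum_sub_distrib]
      have e1 : ∑ C ∈ P e.1, ∑ C' ∈ P e.2, (if ¬ G.IsUniform ε C C' then ε ^ 6 / 4 * (s * s : ℝ)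
          else 0) = ε ^ 6 / 4 *
          ((((P e.1 ×ˢ P e.2).filter fun p => ¬ G.IsUniform ε p.1 p.2).card : ℝ) * (s * s)) := by
        rw [← Finset.sum_product' (f := fun C C' => if ¬ G.IsUniform ε C C' then
          ε ^ 6 / 4 * (s * s : ℝ) else 0), ← Finset.sum_filter, Finset.sum_const, nsmul_eq_mul]
        ring
      have e2 : ∑ C ∈ P e.1, ∑ C' ∈ P e.2, 4 * ρ * (s * s : ℝ) ≤ 4 * ρ * (s₀ * s₀) := by
        rw [Finset.sum_const, Finset.sum_const, nsmul_eq_mul, nsmul_eq_mul]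
        have h3 : ((P e.1).card * s) * ((P e.2).card * s) ≤ (s₀ : ℝ) * s₀ :=
          mul_le_mul (hcardR _) (hcardR _) (by positivity) (by positivity)
        have h4 := mul_le_mul_of_nonneg_left h3 (by linarith : 0 ≤ 4 * ρ)
        linarith
      have e3 : ∑ C ∈ P e.1, ∑ C' ∈ P e.2, (crossEdges G C C' / (s * s)) ^ 2 * (s * s : ℝ) =
        pairEnergy G s (P e.1) (P e.2) := rfl
      rw [e1, e3]
      linarith
    have hsum := Finset.sum_le_sum hpair
    refine le_trans (le_of_eq ?_) hsum
    unfold energy numIrregular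
    rw [Finset.sum_add_distrib, Finset.sum_sub_distrib, Finset.sum_const, nsmul_eq_mul,
      ← Finset.mul_sum, ← Finset.sum_mul]
    push_cast
    ring

/-- A regularity lemma for a bounded-degree pattern `E` of pairs of cells: all cells can be packed
with pieces of a common, not too small size so that little is left over in each cell and few of
the relevant pairs of pieces are irregular. The bound `M` does not depend on the number of cells. -/
theorem exists_regular_packing (ε δ : ℝ) (hε : 0 < ε) (hδ : 0 < δ) (q : ℕ) :
    ∃ M : ℕ, 1 ≤ M ∧ ∀ (V ι : Type u) [Fintype ι] (G : SimpleGraph V) (X : ι → Finset V)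
      (E : Finset (ι × ι)) (s₀ : ℕ), M ≤ s₀ → (∀ i, (X i).card = s₀) →
      (∀ i, (E.filter fun e => e.1 = i).card ≤ q) →
      (∀ i, (E.filter fun e => e.2 = i).card ≤ q) →
      ∃ (s : ℕ) (P : ι → Finset (Finset V)), 1 ≤ s ∧ s₀ ≤ M * s ∧
        (∀ i, IsPacking (P i) (X i) s) ∧
        (∀ i, ((X i \ (P i).biUnion id).card : ℝ) ≤ δ * s₀) ∧
        (numIrregular G E ε P : ℝ) * (s * s) ≤ δ * (Fintype.card ι * (s₀ * s₀)) := by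
  -- the gain of one step and the number of steps
  obtain ⟨a, ha⟩ : ∃ a : ℝ, a = ε ^ 6 * δ / 8 := ⟨_, rfl⟩
  have ha0 : 0 < a := by rw [ha]; positivity
  obtain ⟨T, hT⟩ : ∃ T : ℕ, (q : ℝ) < T * a := by
    obtain ⟨T, hT⟩ := exists_nat_gt ((q : ℝ) / a)
    exact ⟨T, (div_lt_iff₀ ha0).1 hT⟩
  obtain ⟨ρ, hρ0, hρ1, hρ2, hρ3⟩ : ∃ ρ : ℝ, 0 < ρ ∧ 4 * ρ ≤ ε ^ 3 ∧ 4 * ρ * q ≤ a ∧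
      T * ρ ≤ δ := by
    refine ⟨min (ε ^ 3 / 4) (min (a / (4 * (q + 1))) (δ / (T + 1))), ?_, ?_, ?_, ?_⟩
    · refine lt_min (by positivity) (lt_min (by positivity) (by positivity))
    · have := min_le_left (ε ^ 3 / 4) (min (a / (4 * (q + 1))) (δ / (T + 1)))
      linarith
    · have h1 := (min_le_right (ε ^ 3 / 4) (min (a / (4 * (q + 1))) (δ / (T + 1)))).trans
        (min_le_left _ _)
      have h2 : a / (4 * (q + 1)) * (4 * (q + 1)) = a := div_mul_cancel₀ _ (by positivity)
      have h3 := mul_le_mul_of_nonneg_right h1 (by positivity : (0 : ℝ) ≤ 4 * q)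
      have h4 : 0 < a / (4 * (q + 1)) := by positivity
      linarith
    · have h1 := (min_le_right (ε ^ 3 / 4) (min (a / (4 * (q + 1))) (δ / (T + 1)))).trans
        (min_le_right _ _)
      have h2 : δ / (T + 1) * (T + 1) = δ := div_mul_cancel₀ _ (by positivity)
      have h3 := mul_le_mul_of_nonneg_left h1 (Nat.cast_nonneg (α := ℝ) T)
      have h4 : 0 < δ / (T + 1) := by positivity
      linarith
  have hiter : ∀ t : ℕ, ∃ M : ℕ, 1 ≤ M ∧ ∀ (V ι : Type u) [Fintype ι] (G : SimpleGraph V)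
      (X : ι → Finset V) (E : Finset (ι × ι)) (s₀ : ℕ), M ≤ s₀ → (∀ i, (X i).card = s₀) →
      (∀ i, (E.filter fun e => e.1 = i).card ≤ q) →
      (∀ i, (E.filter fun e => e.2 = i).card ≤ q) →
      ∃ (s : ℕ) (P : ι → Finset (Finset V)), 1 ≤ s ∧ s₀ ≤ M * s ∧
        (∀ i, IsPacking (P i) (X i) s) ∧
        (∀ i, ((X i \ (P i).biUnion id).card : ℝ) ≤ t * ρ * s₀) ∧
        ((numIrregular G E ε P : ℝ) * (s * s) ≤ δ * (Fintype.card ι * (s₀ * s₀)) ∨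
          t * a * (Fintype.card ι * (s₀ * s₀)) ≤ energy G E s P) := by
    intro t
    induction t with
    | zero =>
      refine ⟨1, le_rfl, fun V ι _ G X E s₀ hs₀ hX _ _ => ⟨s₀, fun i => {X i}, hs₀, by simp,
        fun i => ⟨by simp, by simpa using hX i, by simp⟩, by simp, Or.inr ?_⟩⟩
      simp only [Nat.cast_zero, zero_mul]
      exact Finset.sum_nonneg fun e _ => Finset.sum_nonneg fun _ _ => Finset.sum_nonneg fun _ _ =>
        by positivity
    | succ t ih =>
      obtain ⟨M, hM, ih⟩ := ih
      obtain ⟨M', hM'⟩ := exists_nat_ge ((M : ℝ) * (2 * 2 ^ (2 * q * M)) / ρ)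
      refine ⟨max M M', hM.trans (le_max_left _ _),
        fun V ι _ G X E s₀ hs₀ hX hE₁ hE₂ => ?_⟩
      obtain ⟨s, P, hs, hsM, hP, hleft, hgood⟩ := ih V ι G X E s₀ ((le_max_left _ _).trans hs₀)
        hX hE₁ hE₂
      by_cases hreg : (numIrregular G E ε P : ℝ) * (s * s) ≤ δ * (Fintype.card ι * (s₀ * s₀))
      · refine ⟨s, P, hs, hsM.trans (Nat.mul_le_mul_right _ (le_max_left _ _)), hP, fun i => ?_,
          Or.inl hreg⟩
        refine (hleft i).trans ?_
        push_cast
        have : 0 ≤ ρ * s₀ := by positivity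
        linarith
      · have hen := hgood.resolve_left hreg
        push Not at hreg
        have hsR : (0 : ℝ) < s := by exact_mod_cast hs
        have hMR : (0 : ℝ) < M := by exact_mod_cast hM
        have hs₀M : (s₀ : ℝ) ≤ M * s := by exact_mod_cast hsM
        have hs₀M' : (M : ℝ) * (2 * 2 ^ (2 * q * M)) / ρ ≤ s₀ :=
          hM'.trans (by exact_mod_cast (le_max_right _ _).trans hs₀)
        obtain ⟨b, hb⟩ : ∃ b : ℝ, b = 2 ^ (2 * q * M) := ⟨_, rfl⟩
        have hb1 : 1 ≤ b := hb ▸ one_le_pow₀ (by norm_num)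
        rw [← hb] at hs₀M' hM'
        have hbig : 2 * b ≤ ρ * s := by
          have h1 := hs₀M'.trans hs₀M
          rw [div_le_iff₀ hρ0] at h1
          have h2 : (M : ℝ) * (2 * b) ≤ M * (ρ * s) := by linarith
          exact le_of_mul_le_mul_left h2 hMR
        set s' : ℕ := ⌊ρ * s / b⌋₊ with hs'
        have hs'1 : 1 ≤ s' := Nat.le_floor (by
          rw [Nat.cast_one, le_div_iff₀ (by linarith)]; linarith)
        have hs'2 : (s' : ℝ) ≤ ρ * s / b := Nat.floor_le (by positivity)
        have hs'3 : ρ * s / b < s' + 1 := Nat.lt_floor_add_one _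
        have hPM : ∀ i, (P i).card ≤ M := by
          intro i
          have h1 := (hP i).card_mul_le
          rw [hX i] at h1
          exact Nat.le_of_mul_le_mul_right (h1.trans hsM) hs
        obtain ⟨P', hP', hleft', hen'⟩ := exists_refinement_step (G := G) hX hP hE₁ hE₂ hPM hε hs
          hs'1 (ρ := ρ) (by
            rw [← hb]
            rw [le_div_iff₀ (by linarith)] at hs'2
            linarith) hρ1
        refine ⟨s', P', hs'1, ?_, hP', ?_, Or.inr ?_⟩
        · have h1 : ρ * s ≤ 2 * b * s' := by
            rw [div_lt_iff₀ (by linarith)] at hs'3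
            have : (1 : ℝ) ≤ s' := by exact_mod_cast hs'1
            have h2 := mul_le_mul_of_nonneg_left this (by linarith : 0 ≤ b)
            linarith
          have h2 : (s₀ : ℝ) ≤ M * (2 * b) / ρ * s' := by
            rw [div_mul_eq_mul_div, le_div_iff₀ hρ0]
            have h3 := mul_le_mul_of_nonneg_right hs₀M hρ0.le
            have h4 := mul_le_mul_of_nonneg_left h1 hMR.le
            linarith
          have h3 : (s₀ : ℝ) ≤ M' * s' := h2.trans
            (mul_le_mul_of_nonneg_right hM' (Nat.cast_nonneg _))
          have h4 : s₀ ≤ M' * s' := by exact_mod_cast h3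
          exact h4.trans (Nat.mul_le_mul_right _ (le_max_right _ _))
        · intro i
          refine (hleft' i).trans ?_
          have := hleft i
          push_cast
          linarith
        · have hEcard : (E.card : ℝ) ≤ q * Fintype.card ι := by
            have h1 : E.card ≤ q * (Finset.univ : Finset ι).card :=
              Finset.card_le_mul_card_image_of_maps_to (f := Prod.fst)
                (fun e _ => Finset.mem_univ _) q fun i _ => hE₁ i
            exact_mod_cast h1
          have h1 := mul_le_mul_of_nonneg_left hreg.le (by positivity : 0 ≤ ε ^ 6 / 4)
          have h2 : 4 * ρ * (E.card * (s₀ * s₀ : ℝ)) ≤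
              a * (Fintype.card ι * (s₀ * s₀ : ℝ)) := by
            have h3 := mul_le_mul_of_nonneg_right hEcard (by positivity : (0 : ℝ) ≤ s₀ * s₀)
            have h4 := mul_le_mul_of_nonneg_left h3 (by positivity : 0 ≤ 4 * ρ)
            have h5 := mul_le_mul_of_nonneg_right hρ2
              (by positivity : (0 : ℝ) ≤ Fintype.card ι * (s₀ * s₀))
            linarith
          have h6 : ε ^ 6 / 4 * (δ * (Fintype.card ι * (s₀ * s₀ : ℝ))) =
              2 * (a * (Fintype.card ι * (s₀ * s₀ : ℝ))) := by rw [ha]; ring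
          rw [h6] at h1
          push_cast
          linarith
  obtain ⟨M, hM, h⟩ := hiter T
  refine ⟨M, hM, fun V ι _ G X E s₀ hs₀ hX hE₁ hE₂ => ?_⟩
  obtain ⟨s, P, hs, hsM, hP, hleft, hgood⟩ := h V ι G X E s₀ hs₀ hX hE₁ hE₂
  refine ⟨s, P, hs, hsM, hP, fun i => (hleft i).trans
    (mul_le_mul_of_nonneg_right hρ3 (Nat.cast_nonneg _)), ?_⟩
  by_contra hcon
  have hen := hgood.resolve_left hcon
  have hub : energy G E s P ≤ q * Fintype.card ι * (s₀ * s₀) := by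
    have h1 : energy G E s P ≤ ∑ e ∈ E, ((s₀ : ℝ) * s₀) := by
      refine Finset.sum_le_sum fun e _ => ?_
      have := pairEnergy_le (G := G) (hP e.1) (hP e.2)
      rwa [hX, hX] at this
    rw [Finset.sum_const, nsmul_eq_mul] at h1
    have hEcard : (E.card : ℝ) ≤ q * Fintype.card ι := by
      have h1 : E.card ≤ q * (Finset.univ : Finset ι).card :=
        Finset.card_le_mul_card_image_of_maps_to (f := Prod.fst)
          (fun e _ => Finset.mem_univ _) q fun i _ => hE₁ i
      exact_mod_cast h1
    exact h1.trans (mul_le_mul_of_nonneg_right hEcard (by positivity))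
  have hs₀R : (0 : ℝ) < s₀ := by exact_mod_cast (Nat.lt_of_lt_of_le hM hs₀)
  rcases (Fintype.card ι).eq_zero_or_pos with h0 | h0
  · -- without cells there are no irregular pairs
    have := Fintype.card_eq_zero_iff.1 h0
    apply hcon
    have hE : E = ∅ := Finset.eq_empty_of_isEmpty E
    rw [hE, h0]
    simp [numIrregular]
  · have h1 : (0 : ℝ) < Fintype.card ι * (s₀ * s₀) := by positivity
    have h2 := mul_lt_mul_of_pos_right hT h1
    linarith

end Regularity

/-! ### Dense spots and cores -/

section Spots

variable {V : Type u}

theorem BipGraph.mem_verts {D : BipGraph V} {v : V} : v ∈ D.verts ↔ v ∈ D.U ∨ v ∈ D.W := by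
  unfold BipGraph.verts
  rw [Finset.mem_union]

variable [Fintype V] {G H : SimpleGraph V} {m γ : ℝ}

theorem IsDenseSpot.mono (h : H ≤ G) {D : BipGraph V} (hD : IsDenseSpot H m γ D) :
    IsDenseSpot G m γ D :=
  ⟨hD.le.trans h, hD.nonempty, hD.density_gt, hD.degree_gt⟩

theorem IsNowhereDense.anti (h : H ≤ G) (hG : IsNowhereDense G m γ) : IsNowhereDense H m γ :=
  fun D hD => hG D (hD.mono h)

/-- Every graph splits into edge-disjoint dense spots, each closed under taking all edges between
its two sides, and a nowhere-dense rest. -/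
theorem exists_dense_spots (G : SimpleGraph V) (m γ : ℝ) :
    ∃ 𝒟 : Finset (BipGraph V), (∀ D ∈ 𝒟, IsDenseSpot G m γ D) ∧
      (∀ D ∈ 𝒟, ∀ D' ∈ 𝒟, D ≠ D' → ∀ x y : V, D.F.Adj x y → ¬ D'.F.Adj x y) ∧
      (∀ D ∈ 𝒟, ∀ x ∈ D.U, ∀ y ∈ D.W, G.Adj x y →
        (spotGraph (𝒟 : Set (BipGraph V))).Adj x y) ∧
      IsNowhereDense (G \ spotGraph (𝒟 : Set (BipGraph V))) m γ := by
  induction hN : numEdges G using Nat.strong_induction_on generalizing G with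
  | _ N ih =>
    by_cases hG : IsNowhereDense G m γ
    · exact ⟨∅, by simp, by simp, by simp, hG.anti sdiff_le⟩
    · unfold IsNowhereDense at hG
      push Not at hG
      obtain ⟨D, hD⟩ := hG
      -- enlarge the spot by all edges between its two sides
      let D₁ : BipGraph V :=
        { U := D.U
          W := D.W
          F := edgesBetween G D.U D.W
          disj := D.disj
          between := fun x y h => h.2 }
      have hle : D.F ≤ D₁.F := fun x y h => ⟨hD.le h, D.between x y h⟩
      have hD₁G : D₁.F ≤ G := fun x y h => h.1
      have hD₁ : IsDenseSpot G m γ D₁ := by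
        refine ⟨hD₁G, fun h => hD.nonempty (le_bot_iff.1 (h ▸ hle)), ?_, ?_⟩
        · refine hD.density_gt.trans_le ?_
          have : (numEdges D.F : ℝ) ≤ numEdges D₁.F := by exact_mod_cast numEdges_mono hle
          exact div_le_div_of_nonneg_right this (by positivity)
        · intro v hv
          refine (hD.degree_gt v hv).trans_le ?_
          exact_mod_cast degree_mono_graph hle v
      have hlt : G \ D₁.F < G := by
        refine lt_of_le_of_ne sdiff_le fun h => hD₁.nonempty ?_
        have := disjoint_sdiff_self_left (x := D₁.F) (y := G)
        rw [h] at this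
        exact le_bot_iff.1 (this hD₁G le_rfl)
      obtain ⟨𝒟, h1, h2, h3, h4⟩ := ih _ (hN ▸ numEdges_lt hlt) (G \ D₁.F) rfl
      have hspot : ∀ x y, (spotGraph ((insert D₁ 𝒟 : Finset (BipGraph V)) :
          Set (BipGraph V))).Adj x y ↔
          D₁.F.Adj x y ∨ (spotGraph (𝒟 : Set (BipGraph V))).Adj x y := by
        intro x y
        simp only [spotGraph, Finset.coe_insert, Set.mem_insert_iff, exists_eq_or_imp]
      refine ⟨insert D₁ 𝒟, ?_, ?_, ?_, ?_⟩
      · intro D' hD'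
        rcases Finset.mem_insert.1 hD' with rfl | hD'
        · exact hD₁
        · exact (h1 D' hD').mono sdiff_le
      · intro D' hD' D'' hD'' hne x y hxy hxy'
        rcases Finset.mem_insert.1 hD' with rfl | hD' <;>
          rcases Finset.mem_insert.1 hD'' with rfl | hD''
        · exact hne rfl
        · exact ((h1 D'' hD'').le hxy').2 hxy
        · exact ((h1 D' hD').le hxy).2 hxy'
        · exact h2 D' hD' D'' hD'' hne x y hxy hxy'
      · intro D' hD' x hx y hy hxy
        rw [hspot]
        by_cases hF : D₁.F.Adj x y
        · exact Or.inl hF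
        · rcases Finset.mem_insert.1 hD' with rfl | hD'
          · exact absurd ⟨hxy, Or.inl ⟨hx, hy⟩⟩ hF
          · exact Or.inr (h3 D' hD' x hx y hy ⟨hxy, hF⟩)
      · refine h4.anti ?_
        intro x y h
        exact ⟨⟨h.1, fun h' => h.2 ((hspot x y).2 (Or.inl h'))⟩,
          fun h' => h.2 ((hspot x y).2 (Or.inr h'))⟩

/-- Removing vertices of small degree one at a time leaves a vertex set inside which all degrees are
large, at the price of few edges. -/
theorem exists_core (R : SimpleGraph V) {c : ℝ} (hc : 0 ≤ c) (A : Finset V) :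
    ∃ K ⊆ A, (∀ v ∈ K, c < degInto R v K) ∧
      (numEdges (edgesBetween R A A \ edgesBetween R K K) : ℝ) ≤ c * A.card := by
  induction A using Finset.strongInduction with
  | _ A ih =>
    by_cases h : ∀ v ∈ A, c < degInto R v A
    · refine ⟨A, le_rfl, h, ?_⟩
      have h0 : numEdges (edgesBetween R A A \ edgesBetween R A A) ≤ 0 :=
        numEdges_le_card ∅ fun x y hxy => absurd hxy.1 hxy.2
      rw [Nat.le_zero.1 h0]
      push_cast
      positivity
    · push Not at h
      obtain ⟨v, hv, hdeg⟩ := h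
      obtain ⟨K, hK, hKdeg, hKe⟩ := ih (A.erase v) (Finset.erase_ssubset hv)
      refine ⟨K, hK.trans (Finset.erase_subset _ _), hKdeg, ?_⟩
      have h1 : edgesBetween R A A \ edgesBetween R K K ≤
          (edgesBetween R A A \ edgesBetween R (A.erase v : Finset V) (A.erase v : Finset V)) ⊔
          (edgesBetween R (A.erase v : Finset V) (A.erase v : Finset V) \ edgesBetween R K K) := by
        intro x y hxy
        by_cases h : (edgesBetween R (A.erase v : Finset V) (A.erase v : Finset V)).Adj x y
        · exact Or.inr ⟨h, hxy.2⟩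
        · exact Or.inl ⟨hxy.1, h⟩
      have h2 := (numEdges_mono h1).trans numEdges_sup_le
      have h3 : numEdges (edgesBetween R A A \
          edgesBetween R (A.erase v : Finset V) (A.erase v : Finset V)) ≤ degInto R v A := by
        refine (numEdges_le_card ((A.filter fun u => R.Adj v u).image fun u => (v, u)) ?_).trans
          Finset.card_image_le
        intro x y hxy
        have hA : x ∈ A ∧ y ∈ A := by
          rcases hxy.1.2 with h | h
          · exact h
          · exact h
        have hv' : x = v ∨ y = v := by
          by_contra hcon
          push Not at hcon
          exact hxy.2 ⟨hxy.1.1, Or.inl ⟨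
            Finset.mem_coe.2 (Finset.mem_erase.2 ⟨hcon.1, hA.1⟩),
            Finset.mem_coe.2 (Finset.mem_erase.2 ⟨hcon.2, hA.2⟩)⟩⟩
        rcases hv' with rfl | rfl
        · left
          exact Finset.mem_image_of_mem _ (Finset.mem_filter.2 ⟨hA.2, hxy.1.1⟩)
        · right
          exact Finset.mem_image_of_mem _ (Finset.mem_filter.2 ⟨hA.1, hxy.1.1.symm⟩)
      have h4 : (numEdges (edgesBetween R A A \ edgesBetween R K K) : ℝ) ≤
          degInto R v A + numEdges (edgesBetween R (A.erase v : Finset V) (A.erase v : Finset V) \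
            edgesBetween R K K) := by exact_mod_cast h2.trans (Nat.add_le_add_right h3 _)
      have h5 : (A.card : ℝ) = (A.erase v).card + 1 := by
        exact_mod_cast (Finset.card_erase_add_one hv).symm
      rw [h5]
      linarith

/-- A vertex sends at most its degree into edge-disjoint subgraphs. -/
theorem sum_degInto_le_of_edgeDisjoint {𝒟 : Finset (BipGraph V)} (hle : ∀ D ∈ 𝒟, D.F ≤ G)
    (hdisj : ∀ D ∈ 𝒟, ∀ D' ∈ 𝒟, D ≠ D' → ∀ x y : V, D.F.Adj x y → ¬ D'.F.Adj x y) (v : V) :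
    ∑ D ∈ 𝒟, degInto D.F v Finset.univ ≤ degInto G v Finset.univ := by
  unfold degInto
  rw [← Finset.card_biUnion]
  · refine Finset.card_le_card fun x hx => ?_
    obtain ⟨D, hD, hx⟩ := Finset.mem_biUnion.1 hx
    rw [Finset.mem_filter] at hx ⊢
    exact ⟨hx.1, hle D hD hx.2⟩
  · intro D hD D' hD' hne
    rw [Function.onFun, Finset.disjoint_left]
    intro x hx hx'
    rw [Finset.mem_filter] at hx hx'
    exact hdisj D hD D' hD' hne v x hx.2 hx'.2

theorem sum_numEdges_le_of_edgeDisjoint {𝒟 : Finset (BipGraph V)} (hle : ∀ D ∈ 𝒟, D.F ≤ G)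
    (hdisj : ∀ D ∈ 𝒟, ∀ D' ∈ 𝒟, D ≠ D' → ∀ x y : V, D.F.Adj x y → ¬ D'.F.Adj x y) :
    ∑ D ∈ 𝒟, numEdges D.F ≤ numEdges G := by
  have h : 2 * ∑ D ∈ 𝒟, numEdges D.F ≤ 2 * numEdges G := by
    rw [Finset.mul_sum, two_mul_numEdges]
    simp only [two_mul_numEdges]
    rw [Finset.sum_comm]
    exact Finset.sum_le_sum fun v _ => sum_degInto_le_of_edgeDisjoint hle hdisj v
  omega

/-- Edge-disjoint dense spots in a graph of maximum degree at most `d`: a vertex lies in at most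
`d / m` of them. -/
theorem card_spots_mul_le {𝒟 : Finset (BipGraph V)} (hD : ∀ D ∈ 𝒟, IsDenseSpot G m γ D)
    (hdisj : ∀ D ∈ 𝒟, ∀ D' ∈ 𝒟, D ≠ D' → ∀ x y : V, D.F.Adj x y → ¬ D'.F.Adj x y) (v : V) :
    ((𝒟.filter fun D => v ∈ D.verts).card : ℝ) * m ≤ degInto G v Finset.univ := by
  have h1 := sum_degInto_le_of_edgeDisjoint (fun D hD' => (hD D hD').le) hdisj v
  have h2 : ((𝒟.filter fun D => v ∈ D.verts).card : ℝ) * m ≤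
      ∑ D ∈ 𝒟.filter (fun D => v ∈ D.verts), (degInto D.F v Finset.univ : ℝ) := by
    rw [← nsmul_eq_mul]
    refine Finset.card_nsmul_le_sum _ _ _ fun D hD' => ?_
    rw [Finset.mem_filter] at hD'
    have := (hD D hD'.1).degree_gt v hD'.2
    rw [degree_eq_degInto] at this
    exact this.le
  have h3 : ∑ D ∈ 𝒟.filter (fun D => v ∈ D.verts), degInto D.F v Finset.univ ≤
      ∑ D ∈ 𝒟, degInto D.F v Finset.univ :=
    Finset.sum_le_sum_of_subset (Finset.filter_subset _ _)
  exact h2.trans (by exact_mod_cast h3.trans h1)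

/-- The sides of a dense spot are short compared with the maximum degree. -/
theorem IsDenseSpot.card_le {D : BipGraph V} (hγ : 0 < γ) (hD : IsDenseSpot G m γ D) {d : ℝ}
    (hd : ∀ v, (degInto G v Finset.univ : ℝ) ≤ d) :
    γ * D.U.card ≤ d ∧ γ * D.W.card ≤ d ∧
      γ * (D.U.card * D.W.card) ≤ (numEdges D.F : ℝ) := by
  have hUW : 0 < (D.U.card : ℝ) * D.W.card := by
    by_contra h
    have h0 : (D.U.card : ℝ) * D.W.card = 0 := le_antisymm (not_lt.1 h) (by positivity)
    have := hD.density_gt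
    rw [h0, div_zero] at this
    linarith
  have hU : 0 < (D.U.card : ℝ) := by
    by_contra h
    have h0 : (D.U.card : ℝ) = 0 := le_antisymm (not_lt.1 h) (by positivity)
    rw [h0] at hUW
    simp at hUW
  have hW : 0 < (D.W.card : ℝ) := by
    by_contra h
    have h0 : (D.W.card : ℝ) = 0 := le_antisymm (not_lt.1 h) (by positivity)
    rw [h0] at hUW
    simp at hUW
  have h1 : γ * (D.U.card * D.W.card) < numEdges D.F := (lt_div_iff₀ hUW).1 hD.density_gt
  have hdeg : ∀ v, ∀ A : Finset V, (degInto D.F v A : ℝ) ≤ d := fun v A => by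
    have h2 : degInto D.F v A ≤ degInto G v Finset.univ :=
      (degInto_mono_set (Finset.subset_univ A)).trans (degInto_mono_graph hD.le v _)
    exact le_trans (by exact_mod_cast h2) (hd v)
  have h2 : (numEdges D.F : ℝ) ≤ D.U.card * d := by
    rw [numEdges_eq_sum_degInto D.disj D.between, ← nsmul_eq_mul]
    push_cast
    exact Finset.sum_le_card_nsmul _ _ _ fun v _ => hdeg v _
  have h3 : (numEdges D.F : ℝ) ≤ D.W.card * d := by
    rw [numEdges_eq_sum_degInto D.disj D.between, sum_degInto_comm, ← nsmul_eq_mul]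
    push_cast
    exact Finset.sum_le_card_nsmul _ _ _ fun v _ => hdeg v _
  refine ⟨?_, ?_, h1.le⟩
  · have h4 : D.W.card * (γ * D.U.card) ≤ D.W.card * d := by linarith
    exact le_of_mul_le_mul_left h4 hW
  · have h4 : D.U.card * (γ * D.W.card) ≤ D.U.card * d := by linarith
    exact le_of_mul_le_mul_left h4 hU

end Spots

/-! ### Types of vertices and avoiding sets -/

section Classes

variable {V : Type u}

/-- The type of a vertex: the spots that have it on their first side, those that have it on their
second side, and its value under a labelling `c`. -/
noncomputable def spotKey {β : Type*} (𝒟 : Finset (BipGraph V)) (c : V → β) (v : V) :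
    Finset (BipGraph V) × Finset (BipGraph V) × β :=
  (𝒟.filter fun D => v ∈ D.U, 𝒟.filter fun D => v ∈ D.W, c v)

theorem spotKey_eq_iff {β : Type*} {𝒟 : Finset (BipGraph V)} {c : V → β} {v w : V} :
    spotKey 𝒟 c v = spotKey 𝒟 c w ↔
      (∀ D ∈ 𝒟, (v ∈ D.U ↔ w ∈ D.U) ∧ (v ∈ D.W ↔ w ∈ D.W)) ∧ c v = c w := by
  unfold spotKey
  simp only [Prod.mk.injEq, Finset.ext_iff, Finset.mem_filter, and_congr_right_iff]
  constructor
  · rintro ⟨h1, h2, h3⟩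
    exact ⟨fun D hD => ⟨h1 D hD, h2 D hD⟩, h3⟩
  · rintro ⟨h, h3⟩
    exact ⟨fun D hD => (h D hD).1, fun D hD => (h D hD).2, h3⟩

/-- Two sets lie on opposite sides of a common spot. -/
def Linked (𝒟 : Set (BipGraph V)) (C C' : Finset V) : Prop :=
  ∃ D ∈ 𝒟, (C ⊆ D.U ∧ C' ⊆ D.W) ∨ (C ⊆ D.W ∧ C' ⊆ D.U)

theorem Linked.symm {𝒟 : Set (BipGraph V)} {C C' : Finset V} (h : Linked 𝒟 C C') :
    Linked 𝒟 C' C := by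
  obtain ⟨D, hD, h⟩ := h
  exact ⟨D, hD, h.symm.imp And.symm And.symm⟩

/-- A set coloured by `f` contains disjoint monochromatic sets of size `s` that leave fewer than
`s` vertices of each colour uncovered. -/
theorem exists_monochromatic_packing {β : Type*} (A : Finset V) (f : V → β) {s : ℕ} (hs : 1 ≤ s) :
    ∃ 𝒳 : Finset (Finset V), IsPacking 𝒳 A s ∧ (∀ X ∈ 𝒳, ∀ x ∈ X, ∀ y ∈ X, f x = f y) ∧
      (A \ 𝒳.biUnion id).card ≤ (A.image f).card * s := by
  choose 𝒬 h1 _ h3 using fun c => exists_pure_packing (A.filter fun v => f v = c) ∅ hs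
  have hcol : ∀ c, ∀ X ∈ 𝒬 c, ∀ x ∈ X, f x = c := fun c X hX x hx =>
    (Finset.mem_filter.1 ((h1 c).subset X hX hx)).2
  refine ⟨(A.image f).biUnion 𝒬, ⟨?_, ?_, ?_⟩, ?_, ?_⟩
  · intro X hX
    obtain ⟨c, -, hX⟩ := Finset.mem_biUnion.1 hX
    exact ((h1 c).subset X hX).trans (Finset.filter_subset _ _)
  · intro X hX
    obtain ⟨c, -, hX⟩ := Finset.mem_biUnion.1 hX
    exact (h1 c).card X hX
  · intro X hX Y hY hne
    obtain ⟨c, -, hX⟩ := Finset.mem_biUnion.1 (Finset.mem_coe.1 hX)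
    obtain ⟨d, -, hY⟩ := Finset.mem_biUnion.1 (Finset.mem_coe.1 hY)
    by_cases hcd : c = d
    · subst hcd
      exact (h1 c).disjoint hX hY hne
    · rw [Function.onFun, Finset.disjoint_left]
      intro x hx hx'
      exact hcd ((hcol c X hX x hx).symm.trans (hcol d Y hY x hx'))
  · intro X hX x hx y hy
    obtain ⟨c, -, hX⟩ := Finset.mem_biUnion.1 hX
    rw [hcol c X hX x hx, hcol c X hX y hy]
  · have hsub : A \ ((A.image f).biUnion 𝒬).biUnion id ⊆
        (A.image f).biUnion fun c => (A.filter fun v => f v = c) \ (𝒬 c).biUnion id := by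
      intro v hv
      rw [Finset.mem_sdiff] at hv
      refine Finset.mem_biUnion.2 ⟨f v, Finset.mem_image_of_mem _ hv.1, Finset.mem_sdiff.2
        ⟨Finset.mem_filter.2 ⟨hv.1, rfl⟩, fun h => hv.2 ?_⟩⟩
      obtain ⟨X, hX, hvX⟩ := Finset.mem_biUnion.1 h
      exact Finset.mem_biUnion.2 ⟨X, Finset.mem_biUnion.2
        ⟨f v, Finset.mem_image_of_mem _ hv.1, hX⟩, hvX⟩
    refine (Finset.card_le_card hsub).trans (Finset.card_biUnion_le_card_mul _ _ _ fun c _ => ?_)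
    simpa using h3 c

variable [Fintype V]

/-- The vertices of spots whose type is shared by fewer than `m` vertices. -/
noncomputable def rareVertices {β : Type*} (𝒟 : Finset (BipGraph V)) (c : V → β) (m : ℝ) :
    Finset V :=
  (𝒟.biUnion BipGraph.verts).filter fun v =>
    ((Finset.univ.filter fun w => spotKey 𝒟 c w = spotKey 𝒟 c v).card : ℝ) < m

theorem card_image_spotKey_mul_le {β : Type*} (𝒟 : Finset (BipGraph V)) (c : V → β) (m : ℝ) :
    (((𝒟.biUnion BipGraph.verts \ rareVertices 𝒟 c m).image (spotKey 𝒟 c)).card : ℝ) * m ≤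
      Fintype.card V := by
  have h1 : (((𝒟.biUnion BipGraph.verts \ rareVertices 𝒟 c m).image (spotKey 𝒟 c)).card : ℝ) * m ≤
      ∑ κ ∈ (𝒟.biUnion BipGraph.verts \ rareVertices 𝒟 c m).image (spotKey 𝒟 c),
        ((Finset.univ.filter fun w => spotKey 𝒟 c w = κ).card : ℝ) := by
    rw [← nsmul_eq_mul]
    refine Finset.card_nsmul_le_sum _ _ _ fun κ hκ => ?_
    obtain ⟨v, hv, rfl⟩ := Finset.mem_image.1 hκ
    rw [Finset.mem_sdiff, rareVertices, Finset.mem_filter] at hv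
    by_contra h
    exact hv.2 ⟨hv.1, not_le.1 h⟩
  refine h1.trans ?_
  rw [← Nat.cast_sum, ← Finset.card_biUnion]
  · exact_mod_cast Finset.card_le_univ _
  · intro κ _ κ' _ hne
    rw [Function.onFun, Finset.disjoint_left]
    intro x hx hx'
    rw [Finset.mem_filter] at hx hx'
    exact hne (hx.2.symm.trans hx'.2)

variable {G : SimpleGraph V} {𝒟 : Finset (BipGraph V)} {γ ω Λ : ℝ} {k : ℕ}

/-- In a graph of bounded degree, a set of linear size meets few spots heavily. -/
theorem card_heavy_spots_le (hγ : 0 < γ) (hk : 0 < k) (hω : 0 ≤ ω)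
    (hD : ∀ D ∈ 𝒟, IsDenseSpot G (γ * k) γ D)
    (hdisj : ∀ D ∈ 𝒟, ∀ D' ∈ 𝒟, D ≠ D' → ∀ x y : V, D.F.Adj x y → ¬ D'.F.Adj x y)
    (hdeg : ∀ v, (degInto G v Finset.univ : ℝ) ≤ ω * k) {Y : Finset V}
    (hY : (Y.card : ℝ) ≤ Λ * k) :
    ((𝒟.filter fun D => γ ^ 2 * k < ((Y ∩ D.verts).card : ℝ)).card : ℝ) ≤ Λ * ω / γ ^ 3 := by
  have hk' : (0 : ℝ) < k := by exact_mod_cast hk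
  have h1 : ((𝒟.filter fun D => γ ^ 2 * k < ((Y ∩ D.verts).card : ℝ)).card : ℝ) * (γ ^ 2 * k) ≤
      ∑ D ∈ 𝒟, ((Y ∩ D.verts).card : ℝ) := by
    refine le_trans ?_ (Finset.sum_le_sum_of_subset_of_nonneg (Finset.filter_subset
      (fun D : BipGraph V => γ ^ 2 * k < ((Y ∩ D.verts).card : ℝ)) 𝒟)
      fun _ _ _ => Nat.cast_nonneg _)
    rw [← nsmul_eq_mul]
    exact Finset.card_nsmul_le_sum _ _ _ fun D h => (Finset.mem_filter.1 h).2.le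
  have h2 : ∑ D ∈ 𝒟, (Y ∩ D.verts).card = ∑ v ∈ Y, (𝒟.filter fun D => v ∈ D.verts).card := by
    simp only [← Finset.filter_mem_eq_inter]
    exact Finset.sum_card_bipartiteAbove_eq_sum_card_bipartiteBelow _
  have h3 : ∑ v ∈ Y, ((𝒟.filter fun D => v ∈ D.verts).card : ℝ) ≤ Y.card * (ω / γ) := by
    rw [← nsmul_eq_mul]
    refine Finset.sum_le_card_nsmul _ _ _ fun v _ => ?_
    have h := (card_spots_mul_le hD hdisj v).trans (hdeg v)
    rw [le_div_iff₀ hγ]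
    exact le_of_mul_le_mul_right (by linarith) hk'
  have h4 : (Y.card : ℝ) * (ω / γ) ≤ Λ * k * (ω / γ) :=
    mul_le_mul_of_nonneg_right hY (by positivity)
  have h5 : ∑ D ∈ 𝒟, ((Y ∩ D.verts).card : ℝ) =
      ∑ v ∈ Y, ((𝒟.filter fun D => v ∈ D.verts).card : ℝ) := by exact_mod_cast h2
  obtain ⟨x, hx⟩ : ∃ x : ℝ,
    x = ((𝒟.filter fun D => γ ^ 2 * k < ((Y ∩ D.verts).card : ℝ)).card : ℝ) := ⟨_, rfl⟩
  rw [← hx] at h1 ⊢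
  have h6 : x * (γ ^ 2 * k) ≤ Λ * k * (ω / γ) := by linarith
  rw [le_div_iff₀ (by positivity)]
  have h7 : Λ * k * (ω / γ) * γ = Λ * ω * k := by field_simp
  have h8 : x * (γ ^ 2 * k) * γ ≤ Λ * k * (ω / γ) * γ := mul_le_mul_of_nonneg_right h6 hγ.le
  exact le_of_mul_le_mul_right (by linarith) hk'

/-- Vertices of rare type avoid every set of linear size: an exceptional vertex lies only in spots
which the set meets heavily, so there are few possible types for it. -/
theorem rareVertices_isAvoiding {β : Type*} [Fintype β] (c : V → β) (hγ : 0 < γ) (hk : 0 < k)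
    (hω : 0 ≤ ω)
    (hD : ∀ D ∈ 𝒟, IsDenseSpot G (γ * k) γ D)
    (hdisj : ∀ D ∈ 𝒟, ∀ D' ∈ 𝒟, D ≠ D' → ∀ x y : V, D.F.Adj x y → ¬ D'.F.Adj x y)
    (hdeg : ∀ v, (degInto G v Finset.univ : ℝ) ≤ ω * k) {q : ℕ} (hq : Λ * ω / γ ^ 3 ≤ q)
    {τ ε : ℝ} (hτ : 0 ≤ τ) (hτε : 4 ^ q * Fintype.card β * τ ≤ ε) (X : Set V) :
    IsAvoiding X (𝒟 : Set (BipGraph V)) Λ ε γ k (rareVertices 𝒟 c (τ * k)) := by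
  refine ⟨fun v hv => ?_, fun Y _ hY => ?_⟩
  · obtain ⟨D, hD, hv⟩ := Finset.mem_biUnion.1 (Finset.mem_filter.1 hv).1
    exact ⟨D, hD, hv⟩
  · obtain ⟨ℋ, hℋ⟩ : ∃ ℋ, ℋ = 𝒟.filter fun D => γ ^ 2 * k < ((Y ∩ D.verts).card : ℝ) := ⟨_, rfl⟩
    have hℋq : ℋ.card ≤ q := by
      have := (card_heavy_spots_le hγ hk hω hD hdisj hdeg hY).trans hq
      rw [← hℋ] at this
      exact_mod_cast this
    obtain ⟨B, hB⟩ : ∃ B, B = (rareVertices 𝒟 c (τ * k)).filter fun v =>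
      ¬ ∃ D ∈ (𝒟 : Set (BipGraph V)), v ∈ D.verts ∧ ((Y ∩ D.verts).card : ℝ) ≤ γ ^ 2 * k :=
        ⟨_, rfl⟩
    suffices h : (B.card : ℝ) ≤ ε * k by
      rw [hB] at h
      convert h
    have hmaps : B.image (spotKey 𝒟 c) ⊆ ℋ.powerset ×ˢ ℋ.powerset ×ˢ Finset.univ := by
      intro κ hκ
      obtain ⟨v, hv, rfl⟩ := Finset.mem_image.1 hκ
      rw [hB, Finset.mem_filter] at hv
      have hheavy : ∀ D ∈ 𝒟, v ∈ D.verts → D ∈ ℋ := fun D hD hvD => by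
        rw [hℋ, Finset.mem_filter]
        exact ⟨hD, not_le.1 fun h => hv.2 ⟨D, hD, hvD, h⟩⟩
      unfold spotKey
      simp only [Finset.mem_product, Finset.mem_powerset, Finset.mem_univ, and_true]
      constructor
      · intro D hD
        rw [Finset.mem_filter] at hD
        exact hheavy D hD.1 (BipGraph.mem_verts.2 (Or.inl hD.2))
      · intro D hD
        rw [Finset.mem_filter] at hD
        exact hheavy D hD.1 (BipGraph.mem_verts.2 (Or.inr hD.2))
    have h1 : ((B.image (spotKey 𝒟 c)).card : ℝ) ≤ 4 ^ q * Fintype.card β := by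
      have h := Finset.card_le_card hmaps
      rw [Finset.card_product, Finset.card_product, Finset.card_powerset, Finset.card_univ,
        ← mul_assoc, ← mul_pow] at h
      have h' : (2 * 2) ^ ℋ.card * Fintype.card β ≤ 4 ^ q * Fintype.card β :=
        Nat.mul_le_mul_right _ (Nat.pow_le_pow_right (by norm_num) hℋq)
      exact_mod_cast h.trans h'
    have h2 : (B.card : ℝ) ≤ (B.image (spotKey 𝒟 c)).card * (τ * k) := by
      rw [Finset.card_eq_sum_card_image (spotKey 𝒟 c) B, ← nsmul_eq_mul]
      push_cast
      refine Finset.sum_le_card_nsmul _ _ _ fun κ hκ => ?_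
      obtain ⟨v, hv, rfl⟩ := Finset.mem_image.1 hκ
      rw [hB, Finset.mem_filter, rareVertices, Finset.mem_filter] at hv
      refine le_trans ?_ hv.1.2.le
      exact_mod_cast Finset.card_le_card (Finset.filter_subset_filter _ (Finset.subset_univ _))
    have h3 : ((B.image (spotKey 𝒟 c)).card : ℝ) * (τ * k) ≤
        4 ^ q * Fintype.card β * (τ * k) := mul_le_mul_of_nonneg_right h1 (by positivity)
    have h4 : 4 ^ q * Fintype.card β * τ * (k : ℝ) ≤ ε * k :=
      mul_le_mul_of_nonneg_right hτε (Nat.cast_nonneg _)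
    linarith

/-- In a packing by sets of size `s`, only few members are linked to a given one. -/
theorem card_linked_mul_le (hγ : 0 < γ) (hk : 0 < k)
    (hD : ∀ D ∈ 𝒟, IsDenseSpot G (γ * k) γ D)
    (hdisj : ∀ D ∈ 𝒟, ∀ D' ∈ 𝒟, D ≠ D' → ∀ x y : V, D.F.Adj x y → ¬ D'.F.Adj x y)
    (hdeg : ∀ v, (degInto G v Finset.univ : ℝ) ≤ ω * k) {𝒳 : Finset (Finset V)} {A : Finset V}
    {s : ℕ} (h𝒳 : IsPacking 𝒳 A s) {X : Finset V} (hX : X.Nonempty) :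
    ((𝒳.filter fun Y => Linked (𝒟 : Set (BipGraph V)) X Y).card : ℝ) * s ≤
      2 * ω ^ 2 / γ ^ 2 * k := by
  have hk' : (0 : ℝ) < k := by exact_mod_cast hk
  obtain ⟨x, hx⟩ := hX
  have h1 := (h𝒳.filter fun Y => Linked (𝒟 : Set (BipGraph V)) X Y).card_biUnion
  have h2 : (𝒳.filter fun Y => Linked (𝒟 : Set (BipGraph V)) X Y).biUnion id ⊆
      (𝒟.filter fun D => x ∈ D.verts).biUnion BipGraph.verts := by
    intro y hy
    obtain ⟨Y, hY, hy⟩ := Finset.mem_biUnion.1 hy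
    obtain ⟨D, hD, h⟩ := (Finset.mem_filter.1 hY).2
    refine Finset.mem_biUnion.2 ⟨D, Finset.mem_filter.2 ⟨hD, ?_⟩, ?_⟩
    · exact BipGraph.mem_verts.2 (h.imp (fun h => h.1 hx) (fun h => h.1 hx))
    · exact BipGraph.mem_verts.2 (h.symm.imp (fun h => h.2 hy) (fun h => h.2 hy))
  have h3 : (((𝒟.filter fun D => x ∈ D.verts).biUnion BipGraph.verts).card : ℝ) ≤
      (𝒟.filter fun D => x ∈ D.verts).card * (2 * (ω * k / γ)) := by
    have h : (((𝒟.filter fun D => x ∈ D.verts).biUnion BipGraph.verts).card : ℝ) ≤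
        ∑ D ∈ 𝒟.filter (fun D => x ∈ D.verts), (D.verts.card : ℝ) := by
      exact_mod_cast Finset.card_biUnion_le
    refine h.trans ?_
    rw [← nsmul_eq_mul]
    refine Finset.sum_le_card_nsmul _ _ _ fun D hD' => ?_
    have h4 := (hD D (Finset.mem_filter.1 hD').1).card_le hγ hdeg
    have h5 : (D.verts.card : ℝ) ≤ D.U.card + D.W.card := by
      unfold BipGraph.verts
      exact_mod_cast Finset.card_union_le _ _
    have h6 : (D.U.card : ℝ) ≤ ω * k / γ := by
      rw [le_div_iff₀ hγ]
      linarith [h4.1]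
    have h7 : (D.W.card : ℝ) ≤ ω * k / γ := by
      rw [le_div_iff₀ hγ]
      linarith [h4.2.1]
    linarith
  have h4 : ((𝒟.filter fun D => x ∈ D.verts).card : ℝ) ≤ ω / γ := by
    have h := (card_spots_mul_le hD hdisj x).trans (hdeg x)
    rw [le_div_iff₀ hγ]
    exact le_of_mul_le_mul_right (by linarith) hk'
  have hω : 0 ≤ ω / γ := le_trans (Nat.cast_nonneg _) h4
  have h5 : ((𝒟.filter fun D => x ∈ D.verts).card : ℝ) * (2 * (ω * k / γ)) ≤
      ω / γ * (2 * (ω * k / γ)) := by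
    refine mul_le_mul_of_nonneg_right h4 ?_
    rw [mul_div_right_comm]
    positivity
  have h6 : ω / γ * (2 * (ω * k / γ)) = 2 * ω ^ 2 / γ ^ 2 * k := by
    field_simp
  have h7 : ((𝒳.filter fun Y => Linked (𝒟 : Set (BipGraph V)) X Y).card : ℝ) * s ≤
      (((𝒟.filter fun D => x ∈ D.verts).biUnion BipGraph.verts).card : ℝ) := by
    exact_mod_cast h1 ▸ Finset.card_le_card h2
  linarith

end Classes

/-! ### Clusters -/

section Clusters

variable {V : Type u}

/-- The edges of `H` in regular pairs of clusters of density at least `γ²` that lie on opposite sides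
of a spot. -/
noncomputable def regularGraph (H : SimpleGraph V) (𝒟 : Set (BipGraph V)) (𝒞 : Finset (Finset V))
    (ε γ : ℝ) : SimpleGraph V where
  Adj x y := H.Adj x y ∧ ∃ C ∈ 𝒞, ∃ C' ∈ 𝒞, C ≠ C' ∧ x ∈ C ∧ y ∈ C' ∧ Linked 𝒟 C C' ∧
    H.IsUniform ε C C' ∧ γ ^ 2 ≤ (H.edgeDensity C C' : ℝ)
  symm := ⟨fun _ _ ⟨h, C, hC, C', hC', hne, hx, hy, hl, hu, hd⟩ =>
    ⟨h.symm, C', hC', C, hC, hne.symm, hy, hx, hl.symm, hu.symm, by rwa [H.edgeDensity_comm]⟩⟩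
  loopless := ⟨fun x ⟨h, _⟩ => H.irrefl (v := x) h⟩

theorem exists_irregular_pairs {ι : Type u} (H : SimpleGraph V) (E : Finset (ι × ι)) (ε : ℝ)
    {X : ι → Finset V} {P : ι → Finset (Finset V)} {s : ℕ} (hP : ∀ i, IsPacking (P i) (X i) s) :
    ∃ T : Finset (V × V), (T.card : ℝ) ≤ (numIrregular H E ε P : ℝ) * (s * s) ∧
      ∀ e ∈ E, ∀ C ∈ P e.1, ∀ C' ∈ P e.2, ¬ H.IsUniform ε C C' →
        ∀ x ∈ C, ∀ y ∈ C', (x, y) ∈ T := by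
  refine ⟨E.biUnion fun e => ((P e.1 ×ˢ P e.2).filter fun p => ¬ H.IsUniform ε p.1 p.2).biUnion
    fun p => p.1 ×ˢ p.2, ?_, ?_⟩
  · have h : (E.biUnion fun e => ((P e.1 ×ˢ P e.2).filter fun p =>
        ¬ H.IsUniform ε p.1 p.2).biUnion fun p => p.1 ×ˢ p.2).card ≤
        numIrregular H E ε P * (s * s) := by
      unfold numIrregular
      rw [Finset.sum_mul]
      refine Finset.card_biUnion_le.trans (Finset.sum_le_sum fun e _ => ?_)
      refine Finset.card_biUnion_le_card_mul _ _ _ fun p hp => ?_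
      rw [Finset.mem_filter, Finset.mem_product] at hp
      rw [Finset.card_product, (hP _).card _ hp.1.1, (hP _).card _ hp.1.2]
    exact_mod_cast h
  · intro e he C hC C' hC' hu x hx y hy
    exact Finset.mem_biUnion.2 ⟨e, he, Finset.mem_biUnion.2 ⟨(C, C'),
      Finset.mem_filter.2 ⟨Finset.mem_product.2 ⟨hC, hC'⟩, hu⟩, Finset.mem_product.2 ⟨hx, hy⟩⟩⟩

variable [Fintype V] {H : SimpleGraph V} {𝒟 : Finset (BipGraph V)} {γ ε : ℝ} {k : ℕ}

/-- The pairs of clusters of density below `γ²` inside the spots contain few edges, as the spots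
themselves have density at least `γ`. -/
theorem exists_sparse_pairs {m d : ℝ} (hγ : 0 < γ) (hD : ∀ D ∈ 𝒟, IsDenseSpot H m γ D)
    (hdisj : ∀ D ∈ 𝒟, ∀ D' ∈ 𝒟, D ≠ D' → ∀ x y : V, D.F.Adj x y → ¬ D'.F.Adj x y)
    (hdeg : ∀ v, (degInto H v Finset.univ : ℝ) ≤ d) {𝒞 : Finset (Finset V)}
    (h𝒞 : (𝒞 : Set (Finset V)).PairwiseDisjoint id) :
    ∃ T : Finset (V × V), (T.card : ℝ) ≤ γ * numEdges H ∧
      ∀ D ∈ 𝒟, ∀ C ∈ 𝒞, ∀ C' ∈ 𝒞, C ⊆ D.U → C' ⊆ D.W → (H.edgeDensity C C' : ℝ) < γ ^ 2 →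
        ∀ x ∈ C, ∀ y ∈ C', H.Adj x y → (x, y) ∈ T := by
  obtain ⟨S, hS⟩ : ∃ S : BipGraph V → Finset (Finset V × Finset V), ∀ D, S D =
      (𝒞 ×ˢ 𝒞).filter fun p => p.1 ⊆ D.U ∧ p.2 ⊆ D.W ∧ (H.edgeDensity p.1 p.2 : ℝ) < γ ^ 2 :=
    ⟨_, fun _ => rfl⟩
  refine ⟨𝒟.biUnion fun D => (S D).biUnion fun p => (p.1 ×ˢ p.2).filter fun e => H.Adj e.1 e.2,
    ?_, ?_⟩
  · have h1 : ∀ D ∈ 𝒟, (((S D).biUnion fun p =>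
        (p.1 ×ˢ p.2).filter fun e => H.Adj e.1 e.2).card : ℝ) ≤ γ * numEdges D.F := by
      intro D hD'
      have h2 : (((S D).biUnion fun p => (p.1 ×ˢ p.2).filter fun e => H.Adj e.1 e.2).card : ℝ) ≤
          ∑ p ∈ S D, γ ^ 2 * ((p.1 ×ˢ p.2).card : ℝ) := by
        have hle : (((S D).biUnion fun p => (p.1 ×ˢ p.2).filter fun e => H.Adj e.1 e.2).card : ℝ) ≤
            ∑ p ∈ S D, (((p.1 ×ˢ p.2).filter fun e => H.Adj e.1 e.2).card : ℝ) := by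
          exact_mod_cast Finset.card_biUnion_le
        refine hle.trans (Finset.sum_le_sum fun p hp => ?_)
        have hp' := hp
        rw [hS, Finset.mem_filter] at hp'
        have hd : (H.edgeDensity p.1 p.2 : ℝ) =
            (((p.1 ×ˢ p.2).filter fun e => H.Adj e.1 e.2).card : ℝ) / (p.1.card * p.2.card) := by
          rw [SimpleGraph.edgeDensity_def, SimpleGraph.interedges_def]
          push_cast
          rfl
        have h3 := hp'.2.2.2
        rw [hd] at h3
        rw [Finset.card_product]
        push_cast
        by_cases h0 : (p.1.card : ℝ) * p.2.card = 0
        · have h4 : (((p.1 ×ˢ p.2).filter fun e => H.Adj e.1 e.2).card : ℝ) ≤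
              p.1.card * p.2.card := by
            have h5 := Finset.card_le_card (Finset.filter_subset
              (fun e : V × V => H.Adj e.1 e.2) (p.1 ×ˢ p.2))
            rw [Finset.card_product] at h5
            exact_mod_cast h5
          rw [h0] at h4 ⊢
          simpa using h4
        · have h6 : 0 < (p.1.card : ℝ) * p.2.card := lt_of_le_of_ne (by positivity) (Ne.symm h0)
          exact ((div_lt_iff₀ h6).1 h3).le
      have h3 : ∑ p ∈ S D, (p.1 ×ˢ p.2).card ≤ (D.U ×ˢ D.W).card := by
        rw [← Finset.card_biUnion]
        · refine Finset.card_le_card fun e he => ?_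
          obtain ⟨p, hp, he⟩ := Finset.mem_biUnion.1 he
          rw [hS, Finset.mem_filter] at hp
          rw [Finset.mem_product] at he ⊢
          exact ⟨hp.2.1 he.1, hp.2.2.1 he.2⟩
        · intro p hp p' hp' hne
          rw [Function.onFun, Finset.disjoint_left]
          intro e he he'
          rw [Finset.mem_coe, hS, Finset.mem_filter, Finset.mem_product] at hp hp'
          rw [Finset.mem_product] at he he'
          refine hne (Prod.ext ?_ ?_)
          · by_contra h
            exact Finset.disjoint_left.1 (h𝒞 hp.1.1 hp'.1.1 h) he.1 he'.1
          · by_contra h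
            exact Finset.disjoint_left.1 (h𝒞 hp.1.2 hp'.1.2 h) he.2 he'.2
      have h4 : (∑ p ∈ S D, ((p.1 ×ˢ p.2).card : ℝ)) ≤ D.U.card * D.W.card := by
        rw [Finset.card_product] at h3
        exact_mod_cast h3
      have h5 := ((hD D hD').card_le hγ hdeg).2.2
      rw [← Finset.mul_sum] at h2
      have h6 : γ ^ 2 * (∑ p ∈ S D, ((p.1 ×ˢ p.2).card : ℝ)) ≤
          γ ^ 2 * (D.U.card * D.W.card) := mul_le_mul_of_nonneg_left h4 (by positivity)
      have h7 : γ * (γ * (D.U.card * D.W.card)) ≤ γ * (numEdges D.F : ℝ) :=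
        mul_le_mul_of_nonneg_left h5 hγ.le
      linarith
    have h2 : ((𝒟.biUnion fun D => (S D).biUnion fun p =>
        (p.1 ×ˢ p.2).filter fun e => H.Adj e.1 e.2).card : ℝ) ≤ ∑ D ∈ 𝒟, γ * (numEdges D.F : ℝ) :=
      le_trans (by exact_mod_cast Finset.card_biUnion_le) (Finset.sum_le_sum h1)
    refine h2.trans ?_
    rw [← Finset.mul_sum]
    refine mul_le_mul_of_nonneg_left ?_ hγ.le
    exact_mod_cast sum_numEdges_le_of_edgeDisjoint (fun D h => (hD D h).le) hdisj
  · intro D hD' C hC C' hC' hU hW hd x hx y hy hxy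
    refine Finset.mem_biUnion.2 ⟨D, hD', Finset.mem_biUnion.2 ⟨(C, C'), ?_, ?_⟩⟩
    · rw [hS, Finset.mem_filter, Finset.mem_product]
      exact ⟨⟨hC, hC'⟩, hU, hW, hd⟩
    · rw [Finset.mem_filter, Finset.mem_product]
      exact ⟨⟨hx, hy⟩, hxy⟩

/-- The choice of the constants that govern the clusters: a type is rare if it has fewer than `τ k`
vertices, `τ₁ k` is the size of the cells to which the regularity lemma is applied with error `δ`,
`q₁` bounds the number of spots that a set meets heavily, and `q` the number of cells linked to
a given one. -/
theorem exists_cluster_constants (Λ γ ε : ℝ) (hγ : 0 < γ) (hε : 0 < ε) :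
    ∃ (q₁ q : ℕ) (τ δ τ₁ : ℝ), 0 < τ ∧ 0 < δ ∧ 0 < τ₁ ∧ Λ / (ε * γ ^ 3) ≤ q₁ ∧
      4 ^ q₁ * 4 * τ ≤ ε ∧ δ ≤ ε * (ε / γ) / 2 ∧ δ ≤ ε / γ / 2 ∧ τ₁ ≤ ε ∧ τ₁ ≤ 1 ∧
      2 * τ₁ ≤ ε * (ε / γ) * τ ∧ 4 / (ε ^ 2 * γ ^ 2 * τ₁) ≤ q := by
  obtain ⟨q₁, hq₁⟩ := exists_nat_ge (Λ / (ε * γ ^ 3))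
  obtain ⟨τ, hτ⟩ : ∃ τ : ℝ, τ = ε / (4 ^ q₁ * 4) := ⟨_, rfl⟩
  have hτ0 : 0 < τ := by rw [hτ]; positivity
  obtain ⟨τ₁, hτ₁⟩ : ∃ τ₁ : ℝ, τ₁ = min ε (min 1 (ε * (ε / γ) * τ / 2)) := ⟨_, rfl⟩
  have hτ₁0 : 0 < τ₁ := by
    rw [hτ₁]
    exact lt_min hε (lt_min one_pos (by positivity))
  obtain ⟨q, hq⟩ := exists_nat_ge (4 / (ε ^ 2 * γ ^ 2 * τ₁))
  refine ⟨q₁, q, τ, min (ε * (ε / γ) / 2) (ε / γ / 2), τ₁, hτ0,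
    lt_min (by positivity) (by positivity), hτ₁0, hq₁, ?_, min_le_left _ _, min_le_right _ _, ?_, ?_,
    ?_, hq⟩
  · rw [hτ]
    exact le_of_eq (by field_simp)
  · rw [hτ₁]
    exact min_le_left _ _
  · rw [hτ₁]
    exact (min_le_right _ _).trans (min_le_left _ _)
  · have : τ₁ ≤ ε * (ε / γ) * τ / 2 := by
      rw [hτ₁]
      exact (min_le_right _ _).trans (min_le_right _ _)
    linarith

/-- The vertices of dense spots in a graph of bounded degree split into an avoiding set, clusters
of a common size on which the types are constant, and few others. Apart from few, the edges
of spots are in regular dense pairs of clusters or are incident with the avoiding set. The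
labelling `t` is allowed to depend on the avoiding set. -/
theorem exists_clusters (Λ γ ε : ℝ) (hΛ : 0 < Λ) (hγ : 0 < γ) (hε : 0 < ε) :
    ∃ ν : ℝ, 0 < ν ∧ ∃ k₀ : ℕ, ∀ k : ℕ, k₀ < k →
      ∀ (V : Type u) [Fintype V] (H : SimpleGraph V) (𝒟 : Finset (BipGraph V))
        (c : V → Bool × Bool) (t : Finset V → V → Bool) (ω : ℝ), 0 ≤ ω → ε * ω ≤ 1 →
        (∀ D ∈ 𝒟, IsDenseSpot H (γ * k) γ D) →
        (∀ D ∈ 𝒟, ∀ D' ∈ 𝒟, D ≠ D' → ∀ x y : V, D.F.Adj x y → ¬ D'.F.Adj x y) →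
        (∀ v, (degInto H v Finset.univ : ℝ) ≤ ω * k) →
        numEdges H ≤ k * Fintype.card V →
        ∃ (𝔄 : Finset V) (𝒞 : Finset (Finset V)) (s : ℕ),
          (∀ X : Set V, IsAvoiding X (𝒟 : Set (BipGraph V)) Λ ε γ k 𝔄) ∧
          (∀ C ∈ 𝒞, Disjoint C 𝔄) ∧ (𝒞 : Set (Finset V)).PairwiseDisjoint id ∧
          0 < s ∧ ν * k ≤ s ∧ (s : ℝ) ≤ ε * k ∧ (∀ C ∈ 𝒞, C.card = s) ∧
          (∀ C ∈ 𝒞, ∀ x ∈ C, ∃ D ∈ 𝒟, x ∈ D.verts) ∧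
          (∀ C ∈ 𝒞, ∀ x ∈ C, ∀ y ∈ C,
            spotKey 𝒟 c x = spotKey 𝒟 c y ∧ t 𝔄 x = t 𝔄 y) ∧
          (numEdges (spotGraph (𝒟 : Set (BipGraph V)) \
            (regularGraph H 𝒟 𝒞 ε γ ⊔
              edgesBetween H 𝔄 ((𝔄 : Set V) ∪ clusterUnion 𝒞))) : ℝ) ≤
            (2 * (ε / γ) + γ) * k * Fintype.card V := by
  obtain ⟨q₁, q, τ, δ, τ₁, hτ, hδ, hτ₁, hq₁, hτε, hδ₁, hδ₂, hτ₁ε, hτ₁1, hττ₁, hq⟩ :=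
    exists_cluster_constants Λ γ ε hγ hε
  obtain ⟨M, hM, hreg⟩ := exists_regular_packing.{u} ε δ hε hδ q
  have hM' : (0 : ℝ) < M := by exact_mod_cast hM
  obtain ⟨k₀, hk₀⟩ := exists_nat_ge (2 * (M + 1) / τ₁)
  refine ⟨τ₁ / (2 * M), by positivity, k₀, ?_⟩
  intro k hk V _ H 𝒟 c t ω hω hεω hD hdisj hdeg hedges
  have hk0 : 0 < k := by omega
  have hk0' : (0 : ℝ) < k := by exact_mod_cast hk0
  have hτk : 2 * (M + 1) ≤ τ₁ * k := by
    have h1 : (k₀ : ℝ) ≤ k := by exact_mod_cast hk.le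
    have h2 := (div_le_iff₀ hτ₁).1 (hk₀.trans h1)
    linarith
  obtain ⟨s₀, hs₀⟩ : ∃ s₀, s₀ = ⌊τ₁ * (k : ℝ)⌋₊ := ⟨_, rfl⟩
  have hs₀le : (s₀ : ℝ) ≤ τ₁ * k := hs₀ ▸ Nat.floor_le (by positivity)
  have hs₀gt : τ₁ * k < s₀ + 1 := hs₀ ▸ Nat.lt_floor_add_one _
  have hs₀half : τ₁ * k ≤ 2 * s₀ := by linarith
  have hMs₀ : M ≤ s₀ := by
    have : (M : ℝ) ≤ s₀ := by linarith
    exact_mod_cast this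
  have hs₀1 : 1 ≤ s₀ := hM.trans hMs₀
  have hs₀1' : (0 : ℝ) < s₀ := by exact_mod_cast hs₀1
  obtain ⟨𝔄, h𝔄⟩ : ∃ 𝔄, 𝔄 = rareVertices 𝒟 c (τ * k) := ⟨_, rfl⟩
  have hωε : ω ≤ 1 / ε := by
    rw [le_div_iff₀ hε]
    linarith
  have havoid : ∀ X : Set V, IsAvoiding X (𝒟 : Set (BipGraph V)) Λ ε γ k 𝔄 := by
    intro X
    rw [h𝔄]
    refine rareVertices_isAvoiding c hγ hk0 hω hD hdisj hdeg (q := q₁) ?_ hτ.le ?_ X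
    · refine le_trans ?_ hq₁
      rw [← div_div, div_le_div_iff_of_pos_right (by positivity), div_eq_mul_one_div]
      exact mul_le_mul_of_nonneg_left hωε hΛ.le
    · have : Fintype.card (Bool × Bool) = 4 := rfl
      rw [this]
      exact_mod_cast hτε
  -- the cells to which the regularity lemma is applied
  obtain ⟨A, hA⟩ : ∃ A, A = 𝒟.biUnion BipGraph.verts \ 𝔄 := ⟨_, rfl⟩
  obtain ⟨𝒳, h𝒳, h𝒳mono, h𝒳left⟩ :=
    exists_monochromatic_packing A (fun v => (spotKey 𝒟 c v, t 𝔄 v)) hs₀1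
  have himage : ((A.image fun v => (spotKey 𝒟 c v, t 𝔄 v)).card : ℝ) * (τ * k) ≤
      2 * Fintype.card V := by
    have h1 : ((A.image (spotKey 𝒟 c)).card : ℝ) * (τ * k) ≤ Fintype.card V := by
      have h := card_image_spotKey_mul_le 𝒟 c (τ * k)
      rw [← h𝔄, ← hA] at h
      convert h
    have h2 : (A.image fun v => (spotKey 𝒟 c v, t 𝔄 v)).card ≤
        (A.image (spotKey 𝒟 c)).card * 2 := by
      refine (Finset.card_le_card (t := A.image (spotKey 𝒟 c) ×ˢ (Finset.univ : Finset Bool))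
        fun p hp => ?_).trans (by rw [Finset.card_product]; rfl)
      obtain ⟨v, hv, rfl⟩ := Finset.mem_image.1 hp
      exact Finset.mem_product.2 ⟨Finset.mem_image_of_mem _ hv, Finset.mem_univ _⟩
    have h3 : ((A.image fun v => (spotKey 𝒟 c v, t 𝔄 v)).card : ℝ) ≤
        (A.image (spotKey 𝒟 c)).card * 2 := by exact_mod_cast h2
    have h4 := mul_le_mul_of_nonneg_right h3 (by positivity : 0 ≤ τ * k)
    linarith
  have hlink : ∀ X ∈ 𝒳, (𝒳.filter fun Y => Linked (𝒟 : Set (BipGraph V)) X Y).card ≤ q := by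
    intro X hX
    have hXne : X.Nonempty := by
      rw [← Finset.card_pos, h𝒳.card X hX]
      exact hs₀1
    have h1 := card_linked_mul_le hγ hk0 hD hdisj hdeg h𝒳 hXne
    have h2 : ω ^ 2 ≤ 1 / ε ^ 2 := by
      rw [← one_div_pow]
      exact pow_le_pow_left₀ hω hωε 2
    have h3 : 2 * ω ^ 2 / γ ^ 2 * k ≤ 4 / (ε ^ 2 * γ ^ 2 * τ₁) * s₀ := by
      calc 2 * ω ^ 2 / γ ^ 2 * k ≤ 2 * (1 / ε ^ 2) / γ ^ 2 * k := by gcongr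
        _ = 2 / (ε ^ 2 * γ ^ 2 * τ₁) * (τ₁ * k) := by field_simp
        _ ≤ 2 / (ε ^ 2 * γ ^ 2 * τ₁) * (2 * s₀) := by gcongr
        _ = 4 / (ε ^ 2 * γ ^ 2 * τ₁) * s₀ := by ring
    have h4 : ((𝒳.filter fun Y => Linked (𝒟 : Set (BipGraph V)) X Y).card : ℝ) ≤ q :=
      le_trans (le_of_mul_le_mul_right (h1.trans h3) hs₀1') hq
    exact_mod_cast h4
  obtain ⟨ι, _, X, hXinj, hX𝒳⟩ : ∃ (ι : Type u) (_ : Fintype ι) (X : ι → Finset V),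
      Function.Injective X ∧ ∀ Y, Y ∈ 𝒳 ↔ ∃ i, X i = Y :=
    ⟨{Y // Y ∈ 𝒳}, inferInstance, Subtype.val, Subtype.val_injective, fun Y => by simp⟩
  have hX : ∀ i, X i ∈ 𝒳 := fun i => (hX𝒳 _).2 ⟨i, rfl⟩
  obtain ⟨E, hE⟩ : ∃ E : Finset (ι × ι), E =
    Finset.univ.filter fun e => Linked (𝒟 : Set (BipGraph V)) (X e.1) (X e.2) := ⟨_, rfl⟩
  obtain ⟨s, P, hs, hsM, hP, hPleft, hPirr⟩ := hreg V ι H X E s₀ hMs₀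
    (fun i => h𝒳.card _ (hX i))
    (fun i => by
      refine le_trans (Finset.card_le_card_of_injOn (fun e => X e.2) (fun e he => ?_)
        fun e he e' he' h => ?_) (hlink _ (hX i))
      · rw [Finset.mem_coe, Finset.mem_filter, hE, Finset.mem_filter] at he
        rw [Finset.mem_coe, Finset.mem_filter]
        exact ⟨hX _, he.2 ▸ he.1.2⟩
      · rw [Finset.mem_coe, Finset.mem_filter] at he he'
        exact Prod.ext (he.2.trans he'.2.symm) (hXinj h))
    (fun i => by
      refine le_trans (Finset.card_le_card_of_injOn (fun e => X e.1) (fun e he => ?_)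
        fun e he e' he' h => ?_) (hlink _ (hX i))
      · rw [Finset.mem_coe, Finset.mem_filter, hE, Finset.mem_filter] at he
        rw [Finset.mem_coe, Finset.mem_filter]
        exact ⟨hX _, he.2 ▸ he.1.2.symm⟩
      · rw [Finset.mem_coe, Finset.mem_filter] at he he'
        exact Prod.ext (hXinj h) (he.2.trans he'.2.symm))
  obtain ⟨𝒞, h𝒞⟩ : ∃ 𝒞, 𝒞 = Finset.univ.biUnion P := ⟨_, rfl⟩
  have hmem : ∀ C, C ∈ 𝒞 ↔ ∃ i, C ∈ P i := fun C => by
    rw [h𝒞, Finset.mem_biUnion]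
    simp
  have hCA : ∀ C ∈ 𝒞, C ⊆ A := fun C hC => by
    obtain ⟨i, hi⟩ := (hmem C).1 hC
    exact ((hP i).subset C hi).trans (h𝒳.subset _ (hX i))
  have hCdisj : (𝒞 : Set (Finset V)).PairwiseDisjoint id := by
    intro C hC C' hC' hne
    obtain ⟨i, hi⟩ := (hmem C).1 hC
    obtain ⟨j, hj⟩ := (hmem C').1 hC'
    by_cases hij : i = j
    · subst hij
      exact (hP i).disjoint hi hj hne
    · exact (h𝒳.disjoint (hX i) (hX j) fun h => hij (hXinj h)).mono ((hP i).subset C hi)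
        ((hP j).subset C' hj)
  have hmono : ∀ i, ∀ x ∈ X i, ∀ y ∈ X i, spotKey 𝒟 c x = spotKey 𝒟 c y ∧ t 𝔄 x = t 𝔄 y :=
    fun i x hx y hy => Prod.mk.inj (h𝒳mono _ (hX i) x hx y hy)
  have hCmono : ∀ C ∈ 𝒞, ∀ x ∈ C, ∀ y ∈ C,
      spotKey 𝒟 c x = spotKey 𝒟 c y ∧ t 𝔄 x = t 𝔄 y := fun C hC x hx y hy => by
    obtain ⟨i, hi⟩ := (hmem C).1 hC
    exact hmono i x ((hP i).subset C hi hx) y ((hP i).subset C hi hy)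
  -- without any cell there are no clusters, so their size may be taken as `s₀`
  have hsize : ∃ s', 0 < s' ∧ s' ≤ s₀ ∧ s₀ ≤ M * s' ∧ ∀ C ∈ 𝒞, C.card = s' := by
    by_cases hne : 𝒞.Nonempty
    · obtain ⟨C, hC⟩ := hne
      obtain ⟨i, hi⟩ := (hmem C).1 hC
      refine ⟨s, hs, ?_, hsM, fun C' hC' => ?_⟩
      · rw [← (hP i).card C hi, ← h𝒳.card _ (hX i)]
        exact Finset.card_le_card ((hP i).subset C hi)
      · obtain ⟨j, hj⟩ := (hmem C').1 hC'
        exact (hP j).card C' hj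
    · rw [Finset.not_nonempty_iff_eq_empty] at hne
      exact ⟨s₀, hs₀1, le_rfl, Nat.le_mul_of_pos_left _ hM, fun C hC => by simp [hne] at hC⟩
  obtain ⟨s', hs'0, hs's₀, hs'M, hs'card⟩ := hsize
  have hιs₀ : (Fintype.card ι : ℝ) * s₀ ≤ Fintype.card V := by
    have h1 : 𝒳.card = Fintype.card ι := by
      rw [← Finset.card_univ, ← Finset.card_image_of_injective Finset.univ hXinj]
      congr 1
      ext Y
      rw [hX𝒳]
      simp
    have h2 := h𝒳.card_mul_le.trans (Finset.card_le_univ A)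
    rw [h1] at h2
    exact_mod_cast h2
  -- `N` are the vertices of spots outside the clusters and the avoiding set
  obtain ⟨N, hN⟩ : ∃ N, N = (A \ 𝒳.biUnion id) ∪
    Finset.univ.biUnion fun i => X i \ (P i).biUnion id := ⟨_, rfl⟩
  have hcover : ∀ D ∈ 𝒟, ∀ v ∈ D.verts, v ∉ N → v ∈ 𝔄 ∨ ∃ i, ∃ C ∈ P i, v ∈ C := by
    intro D hD' v hv hvN
    by_contra hcon
    push Not at hcon
    have hvA : v ∈ A := by
      rw [hA]
      exact Finset.mem_sdiff.2 ⟨Finset.mem_biUnion.2 ⟨D, hD', hv⟩, hcon.1⟩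
    refine hvN ?_
    rw [hN]
    by_cases hvX : v ∈ 𝒳.biUnion id
    · obtain ⟨Y, hY, hvY⟩ := Finset.mem_biUnion.1 hvX
      obtain ⟨i, rfl⟩ := (hX𝒳 Y).1 hY
      refine Finset.mem_union_right _ (Finset.mem_biUnion.2 ⟨i, Finset.mem_univ _,
        Finset.mem_sdiff.2 ⟨hvY, fun h => ?_⟩⟩)
      obtain ⟨C, hC, hvC⟩ := Finset.mem_biUnion.1 h
      exact hcon.2 i C hC hvC
    · exact Finset.mem_union_left _ (Finset.mem_sdiff.2 ⟨hvA, hvX⟩)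
  obtain ⟨B, hB⟩ : ∃ B, B = ε / γ := ⟨_, rfl⟩
  have hB0 : 0 < B := by rw [hB]; positivity
  rw [← hB] at hδ₁ hδ₂ hττ₁ ⊢
  obtain ⟨n, hn⟩ : ∃ n : ℝ, n = Fintype.card V := ⟨_, rfl⟩
  have hn0 : 0 ≤ n := by rw [hn]; exact Nat.cast_nonneg _
  rw [← hn] at himage hιs₀ ⊢
  have hNcard : (N.card : ℝ) ≤ 3 / 2 * (ε * B) * n := by
    have h1 : ((A \ 𝒳.biUnion id).card : ℝ) ≤ ε * B * n := by
      obtain ⟨a, ha⟩ : ∃ a : ℝ, a = (A \ 𝒳.biUnion id).card := ⟨_, rfl⟩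
      obtain ⟨m, hm⟩ : ∃ m : ℝ, m = (A.image fun v => (spotKey 𝒟 c v, t 𝔄 v)).card := ⟨_, rfl⟩
      have h2 : a ≤ m * s₀ := by
        have h : (A \ 𝒳.biUnion id).card ≤
            (A.image fun v => (spotKey 𝒟 c v, t 𝔄 v)).card * s₀ := by convert h𝒳left
        rw [ha, hm]
        exact_mod_cast h
      rw [← hm] at himage
      rw [← ha]
      have h3 : a * (τ * k) ≤ m * s₀ * (τ * k) := mul_le_mul_of_nonneg_right h2 (by positivity)
      have h4 : m * (τ * k) * s₀ ≤ 2 * n * s₀ := mul_le_mul_of_nonneg_right himage hs₀1'.le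
      have h5 : 2 * n * s₀ ≤ 2 * n * (τ₁ * k) := mul_le_mul_of_nonneg_left hs₀le (by positivity)
      have h6 : n * k * (2 * τ₁) ≤ n * k * (ε * B * τ) :=
        mul_le_mul_of_nonneg_left hττ₁ (by positivity)
      have h7 : a * (τ * k) ≤ ε * B * n * (τ * k) := by linarith
      exact le_of_mul_le_mul_right h7 (by positivity)
    have h2 : ((Finset.univ.biUnion fun i => X i \ (P i).biUnion id).card : ℝ) ≤
        ε * B / 2 * n := by
      have h3 : ((Finset.univ.biUnion fun i => X i \ (P i).biUnion id).card : ℝ) ≤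
          ∑ i, ((X i \ (P i).biUnion id).card : ℝ) := by
        exact_mod_cast Finset.card_biUnion_le
      have h4 : ∑ i, ((X i \ (P i).biUnion id).card : ℝ) ≤ Fintype.card ι * (δ * s₀) := by
        rw [← nsmul_eq_mul, ← Finset.card_univ]
        exact Finset.sum_le_card_nsmul _ _ _ fun i _ => hPleft i
      have h5 : δ * (Fintype.card ι * s₀) ≤ δ * n := mul_le_mul_of_nonneg_left hιs₀ hδ.le
      have h6 : δ * n ≤ ε * B / 2 * n := mul_le_mul_of_nonneg_right hδ₁ hn0
      linarith
    have h3 : (N.card : ℝ) ≤ (A \ 𝒳.biUnion id).card +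
        (Finset.univ.biUnion fun i => X i \ (P i).biUnion id).card := by
      rw [hN]
      exact_mod_cast Finset.card_union_le _ _
    linarith
  obtain ⟨T₁, hT₁card, hT₁⟩ := exists_sparse_pairs hγ hD hdisj hdeg hCdisj
  obtain ⟨T₂, hT₂card, hT₂⟩ := exists_irregular_pairs H E ε hP
  refine ⟨𝔄, 𝒞, s', havoid, ?_, hCdisj, hs'0, ?_, ?_, hs'card, ?_, hCmono, ?_⟩
  · intro C hC
    have := hCA C hC
    rw [hA] at this
    exact Finset.disjoint_left.2 fun v hv hv' => (Finset.mem_sdiff.1 (this hv)).2 hv'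
  · have h1 : (s₀ : ℝ) ≤ M * s' := by exact_mod_cast hs'M
    rw [div_mul_eq_mul_div, div_le_iff₀ (by positivity)]
    linarith
  · have h1 : (s' : ℝ) ≤ s₀ := by exact_mod_cast hs's₀
    have h2 : τ₁ * k ≤ ε * k := mul_le_mul_of_nonneg_right hτ₁ε hk0'.le
    linarith
  · intro C hC x hx
    have := hCA C hC hx
    rw [hA, Finset.mem_sdiff, Finset.mem_biUnion] at this
    exact this.1
  · obtain ⟨Q, hQ⟩ : ∃ Q, Q = spotGraph (𝒟 : Set (BipGraph V)) \ (regularGraph H 𝒟 𝒞 ε γ ⊔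
      edgesBetween H 𝔄 ((𝔄 : Set V) ∪ clusterUnion 𝒞)) := ⟨_, rfl⟩
    have hclaim : ∀ D ∈ 𝒟, ∀ x ∈ D.U, ∀ y ∈ D.W, D.F.Adj x y → Q.Adj x y → x ∉ N → y ∉ N →
        (x, y) ∈ T₁ ∪ T₂ := by
      intro D hD' x hx y hy hxy hq hxN hyN
      have hHxy : H.Adj x y := (hD D hD').le hxy
      rw [hQ] at hq
      have hncap : ∀ u v, H.Adj x y → ((x = u ∧ y = v) ∨ (x = v ∧ y = u)) → u ∈ 𝔄 →
          v ∉ (𝔄 : Set V) ∪ clusterUnion 𝒞 := by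
        intro u v h huv hu hv
        refine hq.2 (Or.inr ⟨h, ?_⟩)
        rcases huv with ⟨rfl, rfl⟩ | ⟨rfl, rfl⟩
        · exact Or.inl ⟨hu, hv⟩
        · exact Or.inr ⟨hv, hu⟩
      have hin : ∀ v ∈ D.verts, v ∉ N → v ∈ (𝔄 : Set V) ∪ clusterUnion 𝒞 := by
        intro v hv hvN
        rcases hcover D hD' v hv hvN with h | ⟨i, C, hC, hvC⟩
        · exact Or.inl h
        · exact Or.inr ⟨C, (hmem C).2 ⟨i, hC⟩, hvC⟩
      have hxV : x ∈ D.verts := BipGraph.mem_verts.2 (Or.inl hx)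
      have hyV : y ∈ D.verts := BipGraph.mem_verts.2 (Or.inr hy)
      rcases hcover D hD' x hxV hxN with h | ⟨i, C, hC, hxC⟩
      · exact absurd (hin y hyV hyN) (hncap x y hHxy (Or.inl ⟨rfl, rfl⟩) h)
      rcases hcover D hD' y hyV hyN with h | ⟨j, C', hC', hyC'⟩
      · exact absurd (hin x hxV hxN) (hncap y x hHxy (Or.inr ⟨rfl, rfl⟩) h)
      have hXU : X i ⊆ D.U := fun z hz =>
        (((spotKey_eq_iff.1 (hmono i x ((hP i).subset C hC hxC) z hz).1).1 D hD').1).1 hx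
      have hXW : X j ⊆ D.W := fun z hz =>
        (((spotKey_eq_iff.1 (hmono j y ((hP j).subset C' hC' hyC') z hz).1).1 D hD').2).1 hy
      have hCU : C ⊆ D.U := ((hP i).subset C hC).trans hXU
      have hCW : C' ⊆ D.W := ((hP j).subset C' hC').trans hXW
      have hCm : C ∈ 𝒞 := (hmem C).2 ⟨i, hC⟩
      have hCm' : C' ∈ 𝒞 := (hmem C').2 ⟨j, hC'⟩
      have hne : C ≠ C' := by
        rintro rfl
        exact Finset.disjoint_left.1 D.disj hx (hCW hxC)
      by_cases hu : H.IsUniform ε C C'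
      · have hd : (H.edgeDensity C C' : ℝ) < γ ^ 2 := by
          by_contra hd
          exact hq.2 (Or.inl ⟨hHxy, C, hCm, C', hCm', hne, hxC, hyC', ⟨D, hD', Or.inl ⟨hCU, hCW⟩⟩,
            hu, not_lt.1 hd⟩)
        exact Finset.mem_union_left _
          (hT₁ D hD' C hCm C' hCm' hCU hCW hd x hxC y hyC' hHxy)
      · refine Finset.mem_union_right _ (hT₂ (i, j) ?_ C hC C' hC' hu x hxC y hyC')
        rw [hE, Finset.mem_filter]
        exact ⟨Finset.mem_univ _, D, hD', Or.inl ⟨hXU, hXW⟩⟩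
    rw [← hQ]
    have hQle : Q ≤ edgesBetween H N Set.univ ⊔ (Q \ edgesBetween H N Set.univ) := by
      rw [sup_sdiff_self_right]
      exact le_sup_right
    have h1 := (numEdges_mono hQle).trans numEdges_sup_le
    have h2 : (numEdges (edgesBetween H N Set.univ) : ℝ) ≤ N.card * (ω * k) := by
      have h3 := numEdges_le_sum_degInto (G := edgesBetween H N Set.univ) N Finset.univ
        fun x y h => by
          rcases h.2 with h | h
          · exact Or.inl ⟨h.1, Finset.mem_univ _⟩
          · exact Or.inr ⟨h.2, Finset.mem_univ _⟩
      have h4 : ∑ u ∈ N, (degInto (edgesBetween H N Set.univ) u Finset.univ : ℝ) ≤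
          N.card * (ω * k) := by
        rw [← nsmul_eq_mul]
        refine Finset.sum_le_card_nsmul _ _ _ fun u _ => le_trans ?_ (hdeg u)
        have hle : edgesBetween H N Set.univ ≤ H := fun x y h => h.1
        exact_mod_cast degInto_mono_graph hle u _
      exact le_trans (by exact_mod_cast h3) h4
    have h3 : numEdges (Q \ edgesBetween H N Set.univ) ≤ (T₁ ∪ T₂).card := by
      refine numEdges_le_card _ fun x y hxy => ?_
      have hq := hxy.1
      obtain ⟨D, hD', hF⟩ : (spotGraph (𝒟 : Set (BipGraph V))).Adj x y := by
        rw [hQ] at hq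
        exact hq.1
      have hH := (hD D hD').le hF
      have hxN : x ∉ N := fun h => hxy.2 ⟨hH, Or.inl ⟨h, Set.mem_univ _⟩⟩
      have hyN : y ∉ N := fun h => hxy.2 ⟨hH, Or.inr ⟨Set.mem_univ _, h⟩⟩
      rcases D.between x y hF with ⟨hx, hy⟩ | ⟨hx, hy⟩
      · exact Or.inl (hclaim D hD' x hx y hy hF hq hxN hyN)
      · exact Or.inr (hclaim D hD' y hy x hx hF.symm hq.symm hyN hxN)
    have h4 : (numEdges Q : ℝ) ≤ N.card * (ω * k) + (T₁.card + T₂.card) := by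
      have h5 : (numEdges Q : ℝ) ≤ numEdges (edgesBetween H N Set.univ) + (T₁.card + T₂.card) := by
        exact_mod_cast h1.trans (Nat.add_le_add_left (h3.trans (Finset.card_union_le _ _)) _)
      linarith
    have h5 : (N.card : ℝ) * (ω * k) ≤ 3 / 2 * B * n * k := by
      have h6 : (N.card : ℝ) * (ω * k) ≤ 3 / 2 * (ε * B) * n * (ω * k) :=
        mul_le_mul_of_nonneg_right hNcard (by positivity)
      have h7 : 3 / 2 * B * n * k * (ε * ω) ≤ 3 / 2 * B * n * k * 1 :=
        mul_le_mul_of_nonneg_left hεω (by positivity)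
      linarith
    have h6 : (T₂.card : ℝ) ≤ B / 2 * n * k := by
      have h7 : δ * (Fintype.card ι * (s₀ * s₀)) ≤ δ * (n * k) := by
        refine mul_le_mul_of_nonneg_left ?_ hδ.le
        have h8 : (s₀ : ℝ) ≤ k := by
          have := mul_le_mul_of_nonneg_right hτ₁1 hk0'.le
          linarith
        calc (Fintype.card ι : ℝ) * (s₀ * s₀) = Fintype.card ι * s₀ * s₀ := by ring
          _ ≤ n * k := mul_le_mul hιs₀ h8 hs₀1'.le hn0
      have h8 : δ * (n * k) ≤ B / 2 * (n * k) := mul_le_mul_of_nonneg_right hδ₂ (by positivity)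
      linarith
    have h7 : γ * (numEdges H : ℝ) ≤ γ * (k * n) := by
      refine mul_le_mul_of_nonneg_left ?_ hγ.le
      rw [hn]
      exact_mod_cast hedges
    linarith

end Clusters

/-! ### Sparse decompositions -/

section Decomposition

theorem isPartitionOf_pair {V : Type u} {A B X : Set V} (h : Disjoint A B) (hX : A ∪ B = X) :
    IsPartitionOf {A, B} X := by
  refine ⟨?_, by rw [Set.sUnion_pair, hX]⟩
  rintro C (rfl | rfl) D (rfl | rfl) hne
  · exact absurd rfl hne
  · exact h
  · exact h.symm
  · exact absurd rfl hne

theorem degInto_eq_zero {V : Type u} {G : SimpleGraph V} {v : V} (h : ∀ u, ¬ G.Adj v u)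
    (A : Finset V) : degInto G v A = 0 := by
  unfold degInto
  rw [Finset.card_eq_zero, Finset.filter_eq_empty_iff]
  exact fun u _ => h u

/-- A graph without degrees between `ω k` and `Ω₂ k` has a sparse decomposition, whose huge vertices
are those of degree at least `Ω₂ k`. The labels of a vertex record its side of the partition
and whether it lies in the nowhere-dense part. -/
theorem exists_sparse_decomposition (Λ γ ε ρ : ℝ) (hΛ : 0 < Λ) (hγ : 0 < γ) (hε : 0 < ε)
    (hρ : 0 < ρ) :
    ∃ ν : ℝ, 0 < ν ∧ ∃ k₀ : ℕ, ∀ k : ℕ, k₀ < k → ∀ b : ℝ,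
      ∀ (V : Type u) [Fintype V] (G : SimpleGraph V) (S : Set V) (ω Ω₂ : ℝ), 0 ≤ ω → ε * ω ≤ 1 →
        (∀ v, (G.degree v : ℝ) ≤ ω * k ∨ Ω₂ * k ≤ G.degree v) →
        numEdges G ≤ k * Fintype.card V →
        ∃ (Ψ : Finset V) (𝒞 : Finset (Finset V)) (𝒟 : Set (BipGraph V))
          (Greg Gexp : G.Subgraph) (𝔄 : Finset V),
          IsSparseDecomposition G {S, Sᶜ} k Ω₂ ω Λ γ ε ν ρ Ψ 𝒞 𝒟 Greg Gexp 𝔄 ∧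
          RespectsThreshold G 𝒞 𝔄 b ∧
          (numEdges (G \ capturedGraph G Ψ 𝒞 Greg Gexp 𝔄) : ℝ) ≤
            (2 * (ε / γ) + γ + ρ) * k * Fintype.card V ∧
          (numEdges (spotGraph 𝒟 \ (Greg.spanningCoe ⊔
              edgesBetween G 𝔄 ((𝔄 : Set V) ∪ clusterUnion 𝒞))) : ℝ) ≤
            (2 * (ε / γ) + γ) * k * Fintype.card V := by
  obtain ⟨ν, hν, k₀, hclusters⟩ := exists_clusters.{u} Λ γ ε hΛ hγ hε
  refine ⟨ν, hν, k₀, fun k hk b V _ G S ω Ω₂ hω hεω hgap hedges => ?_⟩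
  have hk0 : (0 : ℝ) < k := by
    have : 0 < k := by omega
    exact_mod_cast this
  obtain ⟨Ψ, hΨ⟩ : ∃ Ψ : Finset V, ∀ v, v ∈ Ψ ↔ Ω₂ * k ≤ (G.degree v : ℝ) :=
    ⟨Finset.univ.filter fun v => Ω₂ * k ≤ (G.degree v : ℝ), fun v => by simp⟩
  have hmod : ∀ v ∉ Ψ, (degInto G v Finset.univ : ℝ) ≤ ω * k := fun v hv => by
    have h := (hgap v).resolve_right fun h => hv ((hΨ v).2 h)
    rwa [degree_eq_degInto] at h
  obtain ⟨H, hH⟩ : ∃ H, H = (removeVerts G Ψ).spanningCoe := ⟨_, rfl⟩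
  have hHadj' : ∀ x y, (removeVerts G Ψ).Adj x y ↔ G.Adj x y ∧ x ∉ Ψ ∧ y ∉ Ψ := fun x y => by
    unfold removeVerts
    rw [SimpleGraph.Subgraph.deleteVerts_adj]
    simp
    tauto
  have hHverts : (removeVerts G Ψ).verts = (Ψ : Set V)ᶜ := by
    unfold removeVerts
    rw [SimpleGraph.Subgraph.deleteVerts_verts, SimpleGraph.Subgraph.verts_top,
      Set.compl_eq_univ_sdiff]
  have hHadj : ∀ x y, H.Adj x y ↔ G.Adj x y ∧ x ∉ Ψ ∧ y ∉ Ψ := fun x y => by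
    rw [hH]
    exact hHadj' x y
  have hHG : H ≤ G := fun x y h => ((hHadj x y).1 h).1
  have hHdeg : ∀ v, (degInto H v Finset.univ : ℝ) ≤ ω * k := by
    intro v
    by_cases hv : v ∈ Ψ
    · rw [degInto_eq_zero fun u h => ((hHadj v u).1 h).2.1 hv]
      push_cast
      positivity
    · exact le_trans (by exact_mod_cast degInto_mono_graph hHG v _) (hmod v hv)
  obtain ⟨𝒟, hD, hdisj, hcov, hnd⟩ := exists_dense_spots H (γ * k) γ
  obtain ⟨R, hR⟩ : ∃ R, R = H \ spotGraph (𝒟 : Set (BipGraph V)) := ⟨_, rfl⟩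
  rw [← hR] at hnd
  have hRH : R ≤ H := hR ▸ sdiff_le
  obtain ⟨K, -, hK, hKe⟩ := exists_core R (c := ρ * k) (by positivity) Finset.univ
  have hKΨ : ∀ v ∈ K, v ∉ Ψ := by
    intro v hv
    have h1 : 0 < degInto R v K := by
      have : (0 : ℝ) < degInto R v K := lt_of_le_of_lt (by positivity) (hK v hv)
      exact_mod_cast this
    obtain ⟨u, hu⟩ := Finset.card_pos.1 h1
    exact ((hHadj v u).1 (hRH (Finset.mem_filter.1 hu).2)).2.1
  have hDΨ : ∀ D ∈ 𝒟, ∀ v ∈ D.verts, v ∉ Ψ := by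
    intro D hD' v hv
    have h1 : (0 : ℝ) < D.F.degree v := lt_of_le_of_lt (by positivity) ((hD D hD').degree_gt v hv)
    have h2 : 0 < D.F.degree v := by exact_mod_cast h1
    obtain ⟨u, hu⟩ := (D.F.degree_pos_iff_exists_adj v).1 h2
    exact ((hHadj v u).1 ((hD D hD').le hu)).2.1
  obtain ⟨𝔄, 𝒞, s, havoid, hC𝔄, hCdisj, hs0, hνs, hsε, hCcard, hCD, hCmono, hcount⟩ :=
    hclusters k hk V H 𝒟 (fun v => (decide (v ∈ S), decide (v ∈ K)))
      (fun A v => decide ((degInto G v A : ℝ) ≤ b)) ω hω hεω hD hdisj hHdeg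
      ((numEdges_mono hHG).trans hedges)
  have hCΨ : ∀ C ∈ 𝒞, ∀ x ∈ C, x ∉ Ψ := fun C hC x hx => by
    obtain ⟨D, hD', hxD⟩ := hCD C hC x hx
    exact hDΨ D hD' x hxD
  have hkey : ∀ C ∈ 𝒞, ∀ x ∈ C, ∀ y ∈ C,
      (∀ D ∈ 𝒟, (x ∈ D.U ↔ y ∈ D.U) ∧ (x ∈ D.W ↔ y ∈ D.W)) ∧ (x ∈ S ↔ y ∈ S) ∧
        (x ∈ K ↔ y ∈ K) ∧ ((degInto G x 𝔄 : ℝ) ≤ b ↔ (degInto G y 𝔄 : ℝ) ≤ b) := by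
    intro C hC x hx y hy
    obtain ⟨h1, h2⟩ := hCmono C hC x hx y hy
    obtain ⟨h3, h4⟩ := spotKey_eq_iff.1 h1
    rw [Prod.mk.injEq, decide_eq_decide, decide_eq_decide] at h4
    exact ⟨h3, h4.1, h4.2, decide_eq_decide.1 h2⟩
  have hCne : ∀ C ∈ 𝒞, ∃ x, x ∈ C := fun C hC => by
    refine Finset.card_pos.1 ?_
    rw [hCcard C hC]
    exact hs0
  have hCeq : ∀ C ∈ 𝒞, ∀ C' ∈ 𝒞, ∀ x ∈ C, x ∈ C' → C = C' := fun C hC C' hC' x hx hx' => by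
    by_contra hne
    exact Finset.disjoint_left.1 (hCdisj hC hC' hne) hx hx'
  obtain ⟨Greg, hGregV, hGreg⟩ : ∃ Greg : G.Subgraph, Greg.verts = clusterUnion 𝒞 ∧
      ∀ x y, Greg.Adj x y ↔ (regularGraph H 𝒟 𝒞 ε γ).Adj x y :=
    ⟨{ verts := clusterUnion 𝒞
       Adj := (regularGraph H 𝒟 𝒞 ε γ).Adj
       adj_sub := fun h => hHG h.1
       edge_vert := fun h => by
        obtain ⟨_, C, hC, _, _, _, hx, _⟩ := h
        exact ⟨C, hC, hx⟩
       symm := (regularGraph H 𝒟 𝒞 ε γ).symm }, rfl, fun _ _ => Iff.rfl⟩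
  obtain ⟨Gexp, hGexpV, hGexp⟩ : ∃ Gexp : G.Subgraph, Gexp.verts = (K : Set V) ∧
      ∀ x y, Gexp.Adj x y ↔ R.Adj x y ∧ x ∈ K ∧ y ∈ K :=
    ⟨{ verts := K
       Adj := fun x y => R.Adj x y ∧ x ∈ K ∧ y ∈ K
       adj_sub := fun h => hHG (hRH h.1)
       edge_vert := fun h => h.2.1
       symm := ⟨fun _ _ h => ⟨h.1.symm, h.2.2, h.2.1⟩⟩ }, rfl, fun _ _ => Iff.rfl⟩
  have hRspot : ∀ x y, R.Adj x y → ¬ (spotGraph (𝒟 : Set (BipGraph V))).Adj x y := fun x y h => by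
    rw [hR] at h
    exact h.2
  have hreg_spot : ∀ x y, Greg.Adj x y → (spotGraph (𝒟 : Set (BipGraph V))).Adj x y := by
    intro x y h
    obtain ⟨hadj, C, hC, C', hC', hne, hx, hy, ⟨D, hD', hl⟩, -⟩ := (hGreg x y).1 h
    rcases hl with ⟨h1, h2⟩ | ⟨h1, h2⟩
    · exact hcov D hD' x (h1 hx) y (h2 hy) hadj
    · exact (hcov D hD' y (h2 hy) x (h1 hx) hadj.symm).symm
  have hspotH : spotGraph (𝒟 : Set (BipGraph V)) ≤ H := by
    rintro x y ⟨D, hD', h⟩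
    exact (hD D hD').le h
  have hcoverH : ∀ C ∈ 𝒞, (C : Set V) ⊆ (Ψ : Set V)ᶜ := fun C hC x hx => hCΨ C hC x hx
  have hcount' : (numEdges (spotGraph (𝒟 : Set (BipGraph V)) \ (Greg.spanningCoe ⊔
      edgesBetween G 𝔄 ((𝔄 : Set V) ∪ clusterUnion 𝒞))) : ℝ) ≤
      (2 * (ε / γ) + γ) * k * Fintype.card V := by
    refine le_trans ?_ hcount
    have hle : regularGraph H 𝒟 𝒞 ε γ ⊔ edgesBetween H 𝔄 ((𝔄 : Set V) ∪ clusterUnion 𝒞) ≤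
        Greg.spanningCoe ⊔ edgesBetween G 𝔄 ((𝔄 : Set V) ∪ clusterUnion 𝒞) := by
      refine sup_le_sup (fun x y h => (hGreg x y).2 h) (fun x y h => ⟨hHG h.1, h.2⟩)
    exact_mod_cast numEdges_mono (sdiff_le_sdiff_left hle)
  refine ⟨Ψ, 𝒞, (𝒟 : Set (BipGraph V)), Greg, Gexp, 𝔄, ⟨?_, ?_, ?_, ?_⟩, ?_, ?_, hcount'⟩
  · exact isPartitionOf_pair disjoint_compl_right (Set.union_compl_self S)
  · exact fun v hv => (hΨ v).1 hv
  · intro v hv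
    refine le_trans ?_ (hmod v hv)
    rw [degree_eq_degInto]
    have hle : spotGraph (𝒟 : Set (BipGraph V)) ⊔ Gexp.spanningCoe ⊔ edgesBetween G Ψ Set.univ ≤
        G := sup_le (sup_le (hspotH.trans hHG) fun x y h => Gexp.adj_sub h) fun x y h => h.1
    exact_mod_cast degInto_mono_graph hle v _
  · constructor
    case partition =>
      rw [hHverts, Set.image_pair]
      refine isPartitionOf_pair (Disjoint.mono Set.sdiff_subset Set.sdiff_subset
        (disjoint_compl_right (a := S))) ?_
      rw [← Set.union_sdiff_distrib, Set.union_compl_self, Set.compl_eq_univ_sdiff]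
    case cluster_subset =>
      rw [hHverts]
      exact hcoverH
    case cluster_disjoint => exact fun C hC C' hC' hne => hCdisj hC hC' hne
    case reg_le =>
      refine ⟨?_, fun x y h => ?_⟩
      · rw [hGregV, hHverts]
        rintro x ⟨C, hC, hx⟩
        exact hcoverH C hC hx
      · have := (hHadj x y).1 ((hGreg x y).1 h).1
        exact (hHadj' x y).2 this
    case reg_not_exp => exact fun x y h h' => hRspot x y ((hGexp x y).1 h').1 (hreg_spot x y h)
    case reg_verts => exact hGregV
    case reg_pair =>
      intro x y h
      obtain ⟨hadj, C, hC, C', hC', hne, hx, hy, hl, hu, hd⟩ := (hGreg x y).1 h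
      refine ⟨C, hC, C', hC', hne, hx, hy, fun a ha c hc => ?_, ?_, ?_⟩
      · rw [hGreg]
        constructor
        · intro hac
          exact ⟨(hHadj a c).2 ((hHadj' a c).1 hac), C, hC, C', hC', hne, ha, hc, hl, hu, hd⟩
        · intro hac
          exact (hHadj' a c).2 ((hHadj a c).1 hac.1)
      · subst hH
        convert hu
      · subst hH
        convert hd
    case cluster_card =>
      intro C hC C' hC'
      rw [hCcard C hC, hCcard C' hC']
      exact ⟨hνs, rfl, hsε⟩
    case spot_dense =>
      intro D hD'
      refine ⟨fun x y h => ⟨?_, fun h' => ?_⟩, (hD D hD').nonempty, (hD D hD').density_gt,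
        (hD D hD').degree_gt⟩
      · rw [← hH]
        exact (hD D hD').le h
      · exact hRspot x y ((hGexp x y).1 h').1 ⟨D, hD', h⟩
    case spot_edge_disjoint => exact hdisj
    case spot_covered =>
      intro D hD' x hx y hy h
      exact hcov D hD' x hx y hy ((hHadj x y).2 ((hHadj' x y).1 h))
    case reg_in_spot =>
      rintro C₁ hC₁ C₂ hC₂ ⟨x, hx, y, hy, h⟩
      obtain ⟨-, C, hC, C', hC', -, hxC, hyC, hl, -⟩ := (hGreg x y).1 h
      rw [hCeq C₁ hC₁ C hC x hx hxC, hCeq C₂ hC₂ C' hC' y hy hyC]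
      exact hl
    case cluster_prepartition =>
      intro C hC
      obtain ⟨z, hz⟩ := hCne C hC
      have hside : ∃ X ∈ ({S, Sᶜ} : Set (Set V)), (C : Set V) ⊆ X := by
        by_cases hzS : z ∈ S
        · exact ⟨S, by simp, fun x hx => ((hkey C hC z hz x hx).2.1).1 hzS⟩
        · exact ⟨Sᶜ, by simp, fun x hx h => hzS (((hkey C hC z hz x hx).2.1).2 h)⟩
      obtain ⟨X, hX, hCX⟩ := hside
      have hCX' : (C : Set V) ⊆ X \ Ψ := fun x hx => ⟨hCX hx, hcoverH C hC hx⟩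
      refine ⟨X \ Ψ, Set.mem_image_of_mem _ hX, ?_⟩
      rw [hGexpV]
      by_cases hzK : z ∈ K
      · exact Or.inl fun x hx => ⟨hCX' hx, ((hkey C hC z hz x hx).2.2.1).1 hzK⟩
      · exact Or.inr fun x hx => ⟨hCX' hx, fun h => hzK (((hkey C hC z hz x hx).2.2.1).2 h)⟩
    case cluster_spot =>
      intro C hC D hD'
      obtain ⟨z, hz⟩ := hCne C hC
      constructor
      · by_cases hzU : z ∈ D.U
        · exact Or.inr fun x hx => (((hkey C hC z hz x hx).1 D hD').1).1 hzU
        · exact Or.inl (Finset.disjoint_left.2 fun x hx h =>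
            hzU ((((hkey C hC z hz x hx).1 D hD').1).2 h))
      · by_cases hzW : z ∈ D.W
        · exact Or.inr fun x hx => (((hkey C hC z hz x hx).1 D hD').2).1 hzW
        · exact Or.inl (Finset.disjoint_left.2 fun x hx h =>
            hzW ((((hkey C hC z hz x hx).1 D hD').2).2 h))
    case exp_le =>
      refine ⟨?_, fun x y h => ?_⟩
      · rw [hGexpV, hHverts]
        exact fun x hx => hKΨ x hx
      · exact (hHadj' x y).2 ((hHadj x y).1 (hRH ((hGexp x y).1 h).1))
    case exp_nowhereDense =>
      refine hnd.anti ?_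
      exact fun x y h => ((hGexp x y).1 h).1
    case exp_degree =>
      intro v hv
      rw [hGexpV] at hv
      refine (hK v hv).trans_le ?_
      rw [degree_eq_degInto]
      have h1 : degInto R v K ≤ degInto Gexp.spanningCoe v Finset.univ := by
        unfold degInto
        refine Finset.card_le_card fun u hu => ?_
        rw [Finset.mem_filter] at hu ⊢
        exact ⟨Finset.mem_univ _, (hGexp v u).2 ⟨hu.2, hv, hu.1⟩⟩
      exact_mod_cast h1
    case avoiding_subset =>
      rw [hHverts]
      intro v hv
      refine ⟨?_, ?_⟩
      · obtain ⟨D, hD', hvD⟩ := (havoid Set.univ).covered v hv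
        exact hDΨ D hD' v hvD
      · rintro ⟨C, hC, hvC⟩
        exact Finset.disjoint_left.1 (hC𝔄 C hC) hvC hv
    case avoiding => exact havoid _
  · intro C hC
    obtain ⟨z, hz⟩ := hCne C hC
    by_cases hzb : (degInto G z 𝔄 : ℝ) ≤ b
    · exact Or.inl fun x hx => ((hkey C hC z hz x hx).2.2.2).1 hzb
    · exact Or.inr fun x hx => not_le.1 fun h => hzb (((hkey C hC z hz x hx).2.2.2).2 h)
  · obtain ⟨L₁, hL₁⟩ : ∃ L₁, L₁ = spotGraph (𝒟 : Set (BipGraph V)) \ (Greg.spanningCoe ⊔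
      edgesBetween G 𝔄 ((𝔄 : Set V) ∪ clusterUnion 𝒞)) := ⟨_, rfl⟩
    obtain ⟨L₂, hL₂⟩ : ∃ L₂, L₂ = edgesBetween R ((Finset.univ : Finset V) : Set V)
      ((Finset.univ : Finset V) : Set V) \ edgesBetween R K K := ⟨_, rfl⟩
    have hle : G \ capturedGraph G Ψ 𝒞 Greg Gexp 𝔄 ≤ L₁ ⊔ L₂ := by
      intro x y h
      have h1 : ¬ (capturedGraph G Ψ 𝒞 Greg Gexp 𝔄).Adj x y := h.2
      unfold capturedGraph at h1
      simp only [SimpleGraph.sup_adj, not_or] at h1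
      obtain ⟨⟨⟨hr, he⟩, hp⟩, ha⟩ := h1
      have hxy : H.Adj x y := (hHadj x y).2 ⟨h.1,
        fun hx => hp ⟨h.1, Or.inl ⟨hx, Set.mem_univ _⟩⟩,
        fun hy => hp ⟨h.1, Or.inr ⟨Set.mem_univ _, hy⟩⟩⟩
      by_cases hs : (spotGraph (𝒟 : Set (BipGraph V))).Adj x y
      · left
        rw [hL₁]
        exact ⟨hs, fun h => h.elim hr ha⟩
      · right
        rw [hL₂]
        have hRxy : R.Adj x y := by
          rw [hR]
          exact ⟨hxy, hs⟩
        refine ⟨⟨hRxy, Or.inl ⟨by simp, by simp⟩⟩, fun h => he ((hGexp x y).2 ⟨hRxy, ?_⟩)⟩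
        rcases h.2 with h | h
        · exact h
        · exact h
    rw [← hL₁] at hcount'
    rw [← hL₂, Finset.card_univ] at hKe
    have h1 : (numEdges (G \ capturedGraph G Ψ 𝒞 Greg Gexp 𝔄) : ℝ) ≤ numEdges L₁ + numEdges L₂ := by
      exact_mod_cast (numEdges_mono hle).trans numEdges_sup_le
    linarith

/-- A graph with few edges has the sparse decomposition all of whose parts are empty. -/
theorem isSparseDecomposition_empty {V : Type u} [Fintype V] (G : SimpleGraph V) (S : Set V) (k : ℕ)
    (Ω₂ ω Λ γ ε ν ρ : ℝ) (hω : 0 ≤ ω) (hε : 0 ≤ ε) :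
    IsSparseDecomposition G {S, Sᶜ} k Ω₂ ω Λ γ ε ν ρ ∅ ∅ ∅ ⊥ ⊥ ∅ := by
  have hverts : (removeVerts G ∅).verts = Set.univ := by
    unfold removeVerts
    rw [SimpleGraph.Subgraph.deleteVerts_verts, SimpleGraph.Subgraph.verts_top,
      Finset.coe_empty, Set.sdiff_empty]
  have hpart : IsPartitionOf {S, Sᶜ} (Set.univ : Set V) :=
    isPartitionOf_pair disjoint_compl_right (Set.union_compl_self S)
  refine ⟨hpart, by simp, fun v _ => ?_, ?_⟩
  · rw [degree_eq_degInto]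
    rw [degInto_eq_zero]
    rotate_left
    · rintro u ((⟨D, hD, -⟩ | h) | h)
      · exact hD
      · exact h
      · rcases h.2 with h | h
        · simpa using h.1
        · simpa using h.2
    push_cast
    positivity
  · constructor
    case partition =>
      rw [hverts]
      simpa using hpart
    case exp_nowhereDense =>
      intro D hD
      exact hD.nonempty (le_bot_iff.1 fun x y h => hD.le h)
    case avoiding =>
      refine ⟨by simp, fun Y _ _ => ?_⟩
      simp only [Finset.filter_empty, Finset.card_empty, Nat.cast_zero]
      positivity
    case reg_verts =>
      ext v
      simp [clusterUnion]
    all_goals simp [bot_le]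

end Decomposition

/-! ### Conclusion -/

section Conclusion

theorem coe_largeVertices {V : Type u} [Fintype V] (G : SimpleGraph V) (k : ℕ) (η : ℝ) :
    (largeVertices G k η : Set V) = (smallVertices G k η : Set V)ᶜ := by
  ext v
  simp [largeVertices, smallVertices]

theorem le_of_ratio_le {Ω : ℕ → ℝ} {r : ℝ} (hr : r ≤ 1) (hpos : ∀ j, 1 ≤ j → 0 < Ω j)
    (hΩ : ∀ j, 1 ≤ j → Ω j / Ω (j + 1) ≤ r) {i j : ℕ} (hi : 1 ≤ i) (hij : i ≤ j) : Ω i ≤ Ω j := by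
  induction j, hij using Nat.le_induction with
  | base => exact le_rfl
  | succ j hij ih =>
    refine ih.trans ?_
    have h := (hΩ j (hi.trans hij)).trans hr
    exact (div_le_one (hpos (j + 1) (by omega))).1 h

end Conclusion

end SparseDecomp

theorem lemma4p12 (η Λ γ ε ρ : ℝ) (hη : 0 < η) (hΛ : 0 < Λ) (hγ : 0 < γ) (hε : 0 < ε)
    (hρ : 0 < ρ) :
    ∃ ν : ℝ, 0 < ν ∧ ∃ k₀ : ℕ, ∀ k : ℕ, k₀ < k → ∀ b : ℝ,
      ∀ Ω : ℕ → ℝ, (∀ j : ℕ, 1 ≤ j → 0 < Ω j) →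
        (∀ j : ℕ, 1 ≤ j → Ω j / Ω (j + 1) ≤ η ^ 2 / 100) →
      ∀ (V : Type u) [Fintype V] [Nonempty V] (G : SimpleGraph V), SparseDecomp.IsLKS G k η →
      ∃ i : ℕ, 1 ≤ i ∧ (i : ℝ) ≤ 100 / η ^ 2 ∧
      ∃ G' : SimpleGraph V, G' ≤ G ∧ SparseDecomp.IsLKSSmall G' k (η / 2) ∧
      ∃ (Ψ : Finset V) (𝒞 : Finset (Finset V)) (𝒟 : Set (SparseDecomp.BipGraph V))
        (Greg Gexp : G'.Subgraph) (𝔄 : Finset V),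
        SparseDecomp.IsSparseDecomposition G'
          {(SparseDecomp.smallVertices G' k (η / 2) : Set V),
            (SparseDecomp.largeVertices G' k (η / 2) : Set V)}
          k (Ω (i + 1)) (Ω i) Λ γ ε ν ρ Ψ 𝒞 𝒟 Greg Gexp 𝔄 ∧
        SparseDecomp.RespectsThreshold G' 𝒞 𝔄 b ∧
        (SparseDecomp.numEdges
            (G' \ SparseDecomp.capturedGraph G' Ψ 𝒞 Greg Gexp 𝔄) : ℝ) ≤
          (4 * ε / γ + ε * Ω ⌊100 / η ^ 2⌋₊ + γ + ρ) * k * Fintype.card V ∧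
        (SparseDecomp.numEdges
            (SparseDecomp.spotGraph 𝒟 \
              (Greg.spanningCoe ⊔
                SparseDecomp.edgesBetween G' 𝔄
                  ((𝔄 : Set V) ∪ SparseDecomp.clusterUnion 𝒞))) : ℝ) ≤
          (4 * ε / γ + ε * Ω ⌊100 / η ^ 2⌋₊ + γ) * k * Fintype.card V := by
  have hη7 : 0 < η ^ 7 := by positivity
  obtain ⟨ν, hν, k₁, hdec⟩ := SparseDecomp.exists_sparse_decomposition.{u} Λ γ ε ρ hΛ hγ hε hρ
  obtain ⟨k₂, hk₂⟩ := exists_nat_ge (10 ^ 19 / η ^ 7)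
  refine ⟨ν, hν, max k₁ k₂, ?_⟩
  intro k hk b Ω hpos hΩ V _ _ G hG
  have hkη : 10 ^ 19 ≤ η ^ 7 * k := by
    have h1 : (k₂ : ℝ) ≤ k := by exact_mod_cast ((le_max_right k₁ k₂).trans_lt hk).le
    have h2 := (div_le_iff₀ hη7).1 (hk₂.trans h1)
    linarith
  obtain ⟨i, hi, hiη, G', hG', hsmall, hgap⟩ :=
    SparseDecomp.exists_degree_gap hη hkη hpos hΩ hG
  obtain ⟨N, hN⟩ : ∃ N, N = ⌊100 / η ^ 2⌋₊ := ⟨_, rfl⟩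
  have hη2 := (SparseDecomp.IsLKS.le_card hη hG).2
  have hiN : Ω i ≤ Ω N := by
    have hr : η ^ 2 / 100 ≤ 1 := by nlinarith only [hη, hη2]
    exact SparseDecomp.le_of_ratio_le hr hpos hΩ hi (hN ▸ Nat.le_floor hiη)
  have hΩi : 0 < Ω i := hpos i hi
  rw [← hN]
  obtain ⟨B, hB⟩ : ∃ B, B = ε / γ := ⟨_, rfl⟩
  have hB0 : 0 < B := by rw [hB]; positivity
  have h4B : 4 * ε / γ = 4 * B := by rw [hB]; ring
  have hεΩ : 0 < ε * Ω N := mul_pos hε (hΩi.trans_le hiN)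
  refine ⟨i, hi, hiη, G', hG', hsmall, ?_⟩
  rw [SparseDecomp.coe_largeVertices, h4B]
  by_cases hεi : ε * Ω i ≤ 1
  · obtain ⟨Ψ, 𝒞, 𝒟, Greg, Gexp, 𝔄, h1, h2, h3, h4⟩ :=
      hdec k ((le_max_left k₁ k₂).trans_lt hk) b V G'
        (SparseDecomp.smallVertices G' k (η / 2) : Set V) (Ω i) (Ω (i + 1)) hΩi.le hεi hgap
        hsmall.numEdges_le
    rw [← hB] at h3 h4
    refine ⟨Ψ, 𝒞, 𝒟, Greg, Gexp, 𝔄, h1, h2, h3.trans ?_, h4.trans ?_⟩ <;>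
    · gcongr
      linarith
  · -- here the error term already exceeds the number of edges
    have hbig : 1 ≤ ε * Ω N :=
      (not_le.1 hεi).le.trans (mul_le_mul_of_nonneg_left hiN hε.le)
    have hedges : (SparseDecomp.numEdges G' : ℝ) ≤ k * Fintype.card V := by
      exact_mod_cast hsmall.numEdges_le
    have hmain : ∀ (H : SimpleGraph V) (c : ℝ), H ≤ G' → 1 ≤ c →
        (SparseDecomp.numEdges H : ℝ) ≤ c * k * Fintype.card V := by
      intro H c hH hc
      have h1 : (SparseDecomp.numEdges H : ℝ) ≤ SparseDecomp.numEdges G' := by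
        exact_mod_cast SparseDecomp.numEdges_mono hH
      have h2 : (1 : ℝ) * (k * Fintype.card V) ≤ c * (k * Fintype.card V) :=
        mul_le_mul_of_nonneg_right hc (by positivity)
      linarith
    refine ⟨∅, ∅, ∅, ⊥, ⊥, ∅, SparseDecomp.isSparseDecomposition_empty G' _ k _ _ Λ γ ε ν ρ hΩi.le
      hε.le, by simp [SparseDecomp.RespectsThreshold], hmain _ _ sdiff_le (by linarith), ?_⟩
    refine hmain _ _ (sdiff_le.trans ?_) (by linarith)
    rintro x y ⟨D, hD, -⟩
    exact absurd hD (Set.notMem_empty D)
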